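/- **Setting.** Let $\mathfrak G=(B,\Delta,S,\varepsilon)$ be a regular finite quantum groupoid: $B$ is a finite dimensional C*-algebra with a coalgebra structure $(\Delta,\varepsilon)$ such that $\Delta$ is a (not necessarily unital) $*$-homomorphism, $\varepsilon(bc_1)\varepsilon(c_2d)=\varepsilon(bcd)$ and $(\Delta(1)\otimes1)(1\otimes\Delta(1))=(\Delta\otimes\mathrm{id})\Delta(1)$; $S$ is an anti-algebra and anti-coalgebra map with $b_1S(b_2)=\varepsilon_t(b):=(\varepsilon\otimes\mathrm{id})(\Delta(1)(b\otimes1))$ and $S(b_1)b_2=\varepsilon_s(b):=(\mathrm{id}\otimes\varepsilon)((1\otimes b)\Delta(1))$; and $S^2=\mathrm{id}$ on $B_t=\varepsilon_t(B)$. Put $B_s=\varepsilon_s(B)$. Scalar products are linear in the first variable. Let $UCorep(\mathfrak G)$ be the category of finite dimensional unitary corepresentations, described through their comodules: an object $U$ is a finite dimensional Hilbert space $H_U$ with a linear map $v\mapsto U(v\otimes1)=v^1\otimes v^2\in H_U\otimes B$ which is coassociative, counital and satisfies $\langle v^1,w\rangle v^2=\langle v,w^1\rangle S(w^2)^*$;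 morphisms are the colinear maps. It is a monoidal category: $H_{U\otimes V}=H_U\otimes_{B_s}H_V=P(H_U\otimes H_V)$ with $v\otimes_{B_s}w=P(v\otimes w)=v^1\otimes w^1\,\varepsilon(v^2w^2)$ and coaction $v\otimes w\mapsto v^1\otimes w^1\otimes v^2w^2$; the unit object $\mathbf 1$ is $B_s$ with $\langle z,t\rangle=\varepsilon(t^*z)$ and coaction $\Delta|_{B_s}$. For an orthonormal basis $(\xi_j)$ of $H_U$ the matrix coefficients $U_{j,i}\in B$ are given by $U(\xi_i\otimes1)=\sum_j\xi_j\otimes U_{j,i}$. Let $\mathcal M$ be a left $UCorep(\mathfrak G)$-module C*-category (a C*-category with a bilinear $*$-functor $\boxtimes$ and coherent unitary isomorphisms $(U\otimes V)\boxtimes N\cong U\boxtimes(V\boxtimes N)$ and $\mathbf 1\boxtimes N\cong N$, suppressed below), and let $M$ be a generator: every object of $\mathcal M$ is isomorphic to a subobject of $U\boxtimes M$ for some $U$. Put $F(U)=\mathcal M(M,U\boxtimes M)$ and $F(T)X=(T\otimes\mathrm{id})X$. Let $(U^x)_{x\in\Omega}$ be an exhaustive family of pairwise inequivalent irreducible unitary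 corepresentations, $H_x=H_{U^x}$, let $\overline{H}$ denote the conjugate of a Hilbert space $H$, and let $$A=\bigoplus_{x\in\Omega}F(U^x)\otimes\overline{H_x}.$$ For a decomposition of $U$ into irreducibles by isometries $w_i:H_{x_i}\to H_U$ (that is, $w_i\in\mathrm{Mor}(U^{x_i},U)$ and $\sum_iw_iw_i^*=1$), put $p(X\otimes\overline\xi)=\sum_iF(w_i^*)X\otimes\overline{w_i^*\xi}\in A$ for $X\in F(U)$, $\xi\in H_U$. For $U=U^x$ choose a conjugate $\overline U$ with $R:\mathbf 1\to\overline U\otimes U$ and $\overline R:\mathbf 1\to U\otimes\overline U$ satisfying the conjugate equations, and put $X^\bullet=(\mathrm{id}\otimes X^*)R\in F(\overline U)$ and $\xi^\bullet=(\overline\xi\otimes\mathrm{id})\overline R(1)\in H_{\overline U}$. Define on $A$ $$(X\otimes\overline\xi)\cdot(Y\otimes\overline\eta)=p\big((\mathrm{id}\otimes X)Y\otimes\overline{\eta\otimes_{B_s}\xi}\big),\qquad(X\otimes\overline\xi)^*=p\big(X^\bullet\otimes\overline{\xi^\bullet}\big),\qquad 1_A=p\big(\mathrm{id}_M\otimes\overline{1_B}\big).$$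 **Statement.** Decompositions and conjugates as above exist. For every choice of them, $A$ is a unital associative $*$-algebra, and: (i) There is a linear map $\mathfrak a:A\to A\otimes B$ such that, for every $x\in\Omega$, $X\in F(U^x)$ and every orthonormal basis $(\xi_j)$ of $H_x$, $$\mathfrak a(X\otimes\overline{\xi_i})=\sum_jX\otimes\overline{\xi_j}\otimes(U^x_{j,i})^*,$$ and $\mathfrak a$ is a right coaction of $\mathfrak G$ on $A$: a $*$-homomorphism with $(\mathfrak a\otimes\mathrm{id})\mathfrak a=(\mathrm{id}\otimes\Delta)\mathfrak a$, $(\mathrm{id}\otimes\varepsilon)\mathfrak a=\mathrm{id}$ and $\mathfrak a(1_A)\in A\otimes B_t$. (ii) $A$ admits a unique C*-completion to which $\mathfrak a$ extends as a continuous coaction: there are a unital C*-algebra $\overline A$, an injective unital $*$-homomorphism $\iota:A\to\overline A$ with dense range and a continuous right coaction $\overline{\mathfrak a}$ of $\mathfrak G$ on $\overline A$ with $\overline{\mathfrak a}\circ\iota=(\iota\otimes\mathrm{id})\circ\mathfrak a$; and for any two such triples $(\overline A_k,\iota_k,\overline{\mathfrak a}_k)$, $k=1,2$, there is a unique $*$-isomorphism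 $\Phi:\overline A_1\to\overline A_2$ with $\Phi\circ\iota_1=\iota_2$, and it intertwines $\overline{\mathfrak a}_1$ and $\overline{\mathfrak a}_2$. -/

import Mathlib

open CategoryTheory MonoidalCategory TensorProduct
open scoped TensorProduct ComplexConjugate

universe u v w w' t t'

noncomputable section

set_option linter.unusedSectionVars false
set_option linter.unusedSimpArgs false

section Counital

variable {B : Type u} [CStarAlgebra B] [Coalgebra ℂ B]

local notation "Δ" => (CoalgebraStruct.comul : B →ₗ[ℂ] B ⊗[ℂ] B)
local notation "ε" => (CoalgebraStruct.counit : B →ₗ[ℂ] ℂ)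

/-- The target counital map `ε_t(b) = (ε ⊗ id)(Δ(1)(b ⊗ 1))`. -/
def targetCounital : B →ₗ[ℂ] B :=
  (TensorProduct.lid ℂ B).toLinearMap ∘ₗ (ε).rTensor B ∘ₗ
    LinearMap.mulLeft ℂ (Δ 1) ∘ₗ (TensorProduct.mk ℂ B B).flip 1

/-- The source counital map `ε_s(b) = (id ⊗ ε)((1 ⊗ b)Δ(1))`. -/
def sourceCounital : B →ₗ[ℂ] B :=
  (TensorProduct.rid ℂ B).toLinearMap ∘ₗ (ε).lTensor B ∘ₗ
    LinearMap.mulRight ℂ (Δ 1) ∘ₗ TensorProduct.mk ℂ B B 1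

end Counital

/-- A weak Hopf C*-algebra (finite quantum groupoid): a finite dimensional C*-algebra with a
coalgebra structure and an antipode satisfying the weak Hopf axioms. -/
class WeakHopfCStarAlgebra (B : Type u) [CStarAlgebra B] extends Coalgebra ℂ B where
  /-- The antipode. -/
  antipode : B →ₗ[ℂ] B
  finiteDimensional : FiniteDimensional ℂ B
  comul_mul (b c : B) : comul (b * c) = comul b * comul c
  comul_star (b : B) : comul (star b) = star (comul b)
  /-- `ε(b c₁) ε(c₂ d) = ε(b c d)` -/
  counit_mul (b c d : B) :
    LinearMap.mul' ℂ ℂ (TensorProduct.map (counit ∘ₗ LinearMap.mulLeft ℂ b)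
      (counit ∘ₗ LinearMap.mulRight ℂ d) (comul c)) = counit (b * c * d)
  /-- `(Δ(1) ⊗ 1)(1 ⊗ Δ(1)) = (Δ ⊗ id)Δ(1)` -/
  comul_one :
    (comul 1 ⊗ₜ[ℂ] (1 : B)) * (TensorProduct.assoc ℂ B B B).symm ((1 : B) ⊗ₜ[ℂ] comul 1) =
      comul.rTensor B (comul 1)
  antipode_one : antipode 1 = 1
  antipode_mul (b c : B) : antipode (b * c) = antipode c * antipode b
  /-- `Δ(S(b)) = S(b₂) ⊗ S(b₁)` -/
  comul_antipode (b : B) :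
    comul (antipode b) = TensorProduct.map antipode antipode (TensorProduct.comm ℂ B B (comul b))
  counit_antipode (b : B) : counit (antipode b) = counit b
  /-- `b₁ S(b₂) = ε_t(b)` -/
  mul_antipode (b : B) : LinearMap.mul' ℂ B (antipode.lTensor B (comul b)) = targetCounital b
  /-- `S(b₁) b₂ = ε_s(b)` -/
  antipode_mul_id (b : B) : LinearMap.mul' ℂ B (antipode.rTensor B (comul b)) = sourceCounital b

attribute [instance] WeakHopfCStarAlgebra.finiteDimensional

/-- A finite quantum groupoid is regular if the square of the antipode is the identity on the
target counital subalgebra `B_t`. -/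
class IsRegularQuantumGroupoid (B : Type u) [CStarAlgebra B] [WeakHopfCStarAlgebra B] : Prop where
  antipode_antipode (b : B) : WeakHopfCStarAlgebra.antipode
    (WeakHopfCStarAlgebra.antipode (targetCounital b)) = targetCounital b

namespace WeakHopfCStarAlgebra

variable {B : Type u} [CStarAlgebra B] [WeakHopfCStarAlgebra B]

local notation "Δ" => (CoalgebraStruct.comul : B →ₗ[ℂ] B ⊗[ℂ] B)
local notation "ε" => (CoalgebraStruct.counit : B →ₗ[ℂ] ℂ)
local notation "S" => (antipode : B →ₗ[ℂ] B)

variable (B) in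
/-- The target counital subalgebra `B_t`. -/
def target : Submodule ℂ B := LinearMap.range targetCounital

variable (B) in
/-- The source counital subalgebra `B_s`. -/
def source : Submodule ℂ B := LinearMap.range sourceCounital

/-- `(id ⊗ ε)` -/
abbrev epsR (B : Type u) [CStarAlgebra B] [WeakHopfCStarAlgebra B] (H : Type w) [AddCommGroup H]
    [Module ℂ H] : H ⊗[ℂ] B →ₗ[ℂ] H :=
  (TensorProduct.rid ℂ H).toLinearMap ∘ₗ (CoalgebraStruct.counit : B →ₗ[ℂ] ℂ).lTensor H

lemma epsR_comul (b : B) : epsR B B (Δ b) = b := by simp [epsR]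

lemma epsL_comul (b : B) : TensorProduct.lid ℂ B ((ε).rTensor B (Δ b)) = b := by simp

lemma counit_star (b : B) : ε (star b) = conj (ε b) := by
  obtain ⟨s, hs⟩ := TensorProduct.exists_finset (Δ b)
  have h1 : ∑ i ∈ s, ε (star i.1) • star i.2 = star b := by
    have := epsL_comul (star b)
    rw [comul_star, hs] at this
    simpa [star_sum, map_sum] using this
  have h2 : ∑ i ∈ s, ε i.2 • i.1 = b := by
    have := epsR_comul b
    rw [hs] at this
    simpa [map_sum, epsR] using this
  have h3 := congrArg (fun x => ε (star x)) h1
  have h4 := congrArg (fun x => conj (ε (star x))) h2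
  simp [star_sum, map_sum, star_smul] at h3 h4
  rw [← h3, ← Complex.conj_conj (ε (star b)), ← h4]
  simp only [map_sum, map_mul, Complex.conj_conj, mul_comm]

lemma comul_one_mul (b : B) : Δ 1 * Δ b = Δ b := by rw [← comul_mul, one_mul]

lemma comul_mul_one (b : B) : Δ b * Δ 1 = Δ b := by rw [← comul_mul, mul_one]

lemma star_comul_one : star (Δ 1) = Δ 1 := by rw [← comul_star, star_one]

/-- `(1 ⊗ Δ(1))(Δ(1) ⊗ 1) = (Δ ⊗ id)Δ(1)` -/
lemma comul_one' : (TensorProduct.assoc ℂ B B B).symm ((1 : B) ⊗ₜ[ℂ] Δ 1) * (Δ 1 ⊗ₜ[ℂ] (1 : B)) =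
    (Δ).rTensor B (Δ 1) := by
  have h1 : ∀ t : B ⊗[ℂ] B, star ((TensorProduct.assoc ℂ B B B).symm ((1 : B) ⊗ₜ[ℂ] t)) =
      (TensorProduct.assoc ℂ B B B).symm ((1 : B) ⊗ₜ[ℂ] star t) := by
    intro t
    induction t with
    | zero => simp
    | tmul x y => simp
    | add x y hx hy => simp only [tmul_add, map_add, star_add, hx, hy]
  have h2 : ∀ t : B ⊗[ℂ] B, star ((Δ).rTensor B t) = (Δ).rTensor B (star t) := by
    intro t
    induction t with
    | zero => simp
    | tmul x y => simp [comul_star]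
    | add x y hx hy => simp only [map_add, star_add, hx, hy]
  have := congrArg star (comul_one (B := B))
  rw [star_mul, h1, h2, TensorProduct.star_tmul, star_comul_one, star_one] at this
  exact this

lemma source_apply {s : Finset (B × B)} (hs : Δ 1 = ∑ i ∈ s, i.1 ⊗ₜ[ℂ] i.2) (b : B) :
    sourceCounital b = ∑ i ∈ s, ε (b * i.2) • i.1 := by
  simp [sourceCounital, hs, Finset.mul_sum, map_sum]

lemma target_apply {s : Finset (B × B)} (hs : Δ 1 = ∑ i ∈ s, i.1 ⊗ₜ[ℂ] i.2) (b : B) :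
    targetCounital b = ∑ i ∈ s, ε (i.1 * b) • i.2 := by
  simp [targetCounital, hs, Finset.sum_mul, map_sum]

lemma comul_source (b : B) : Δ (sourceCounital b) = (1 ⊗ₜ sourceCounital b) * Δ 1 := by
  obtain ⟨s, hs⟩ := TensorProduct.exists_finset (Δ 1)
  have := congrArg (epsR B (B ⊗[ℂ] B) ∘ₗ LinearMap.mulLeft ℂ (1 ⊗ₜ b)) (comul_one' (B := B))
  rw [hs] at this
  simp [map_sum, Finset.mul_sum, Finset.sum_mul, tmul_sum, sum_tmul, epsR] at this
  rw [source_apply hs, hs]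
  simp only [map_sum, map_smul, Finset.mul_sum, Finset.sum_mul, tmul_sum, tmul_smul,
    Algebra.TensorProduct.tmul_mul_tmul, one_mul, smul_mul_assoc]
  exact this.symm

lemma source_eq_of_comul {z : B} (h : Δ z = (1 ⊗ₜ z) * Δ 1) : sourceCounital z = z := by
  conv_rhs => rw [← epsR_comul z, h]
  simp [sourceCounital, epsR]

lemma mem_source_iff {z : B} : z ∈ source B ↔ Δ z = (1 ⊗ₜ z) * Δ 1 := by
  constructor
  · rintro ⟨b, rfl⟩
    exact comul_source b
  · intro h
    exact ⟨z, source_eq_of_comul h⟩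

lemma source_apply_self {z : B} (hz : z ∈ source B) : sourceCounital z = z :=
  source_eq_of_comul (mem_source_iff.1 hz)

lemma comul_source' (b : B) : Δ (sourceCounital b) = Δ 1 * (1 ⊗ₜ sourceCounital b) := by
  obtain ⟨s, hs⟩ := TensorProduct.exists_finset (Δ 1)
  have := congrArg (epsR B (B ⊗[ℂ] B) ∘ₗ LinearMap.mulLeft ℂ (1 ⊗ₜ b)) (comul_one (B := B))
  rw [hs] at this
  simp [map_sum, Finset.mul_sum, Finset.sum_mul, tmul_sum, sum_tmul, epsR] at this
  rw [source_apply hs, hs]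
  simp only [map_sum, map_smul, Finset.mul_sum, Finset.sum_mul, tmul_sum, tmul_smul,
    Algebra.TensorProduct.tmul_mul_tmul, mul_one, mul_smul_comm]
  rw [← this]
  simp only [Finset.smul_sum]

lemma comul_of_mem {z : B} (hz : z ∈ source B) : Δ z = (1 ⊗ₜ z) * Δ 1 := mem_source_iff.1 hz

lemma comul_of_mem' {z : B} (hz : z ∈ source B) : Δ z = Δ 1 * (1 ⊗ₜ z) := by
  have := comul_source' z
  rwa [source_apply_self hz] at this

lemma one_mem_source : (1 : B) ∈ source B := by
  rw [mem_source_iff, ← Algebra.TensorProduct.one_def, one_mul]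

lemma star_mem_source {z : B} (hz : z ∈ source B) : star z ∈ source B := by
  rw [mem_source_iff, comul_star, comul_of_mem' hz, star_mul, star_comul_one]
  simp

lemma mul_mem_source {z z' : B} (hz : z ∈ source B) (hz' : z' ∈ source B) : z * z' ∈ source B := by
  rw [mem_source_iff, comul_mul, comul_of_mem hz, comul_of_mem hz', mul_assoc,
    ← comul_of_mem hz', comul_one_mul, comul_of_mem hz', ← mul_assoc]
  simp

lemma counit_one_mul (b d : B) {s : Finset (B × B)} (hs : Δ 1 = ∑ i ∈ s, i.1 ⊗ₜ[ℂ] i.2) :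
    ∑ i ∈ s, ε (b * i.1) * ε (i.2 * d) = ε (b * d) := by
  have := counit_mul b 1 d
  rw [hs] at this
  simpa [map_sum] using this

lemma star_sum_comul_one {s : Finset (B × B)} (hs : Δ 1 = ∑ i ∈ s, i.1 ⊗ₜ[ℂ] i.2) :
    Δ 1 = ∑ i ∈ s, star i.1 ⊗ₜ[ℂ] star i.2 := by
  rw [← star_comul_one, hs, star_sum]
  simp

lemma counit_one_mul' (b d : B) {s : Finset (B × B)} (hs : Δ 1 = ∑ i ∈ s, i.1 ⊗ₜ[ℂ] i.2) :
    ∑ i ∈ s, ε (b * i.2) * ε (i.1 * d) = ε (b * d) := by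
  have h := congrArg conj (counit_one_mul (star d) (star b) hs)
  simp only [map_sum, map_mul, ← counit_star, star_mul, star_star] at h
  have h2 := congrArg (LinearMap.mul' ℂ ℂ ∘ₗ TensorProduct.map (ε ∘ₗ LinearMap.mulRight ℂ d)
    (ε ∘ₗ LinearMap.mulLeft ℂ b)) (hs.symm.trans (star_sum_comul_one hs))
  simp [map_sum] at h2
  rw [← h, ← (Finset.sum_congr rfl fun i _ => mul_comm _ _), h2]

/-- The left leg of `Δ(1)` lies in `B_s`. -/
lemma source_rTensor_comul_one : sourceCounital.rTensor B (Δ 1) = Δ 1 := by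
  obtain ⟨s, hs⟩ := TensorProduct.exists_finset (Δ 1)
  have h := congrArg ((epsR B B).rTensor B) (comul_one' (B := B))
  rw [hs] at h
  simp [map_sum, Finset.mul_sum, Finset.sum_mul, tmul_sum, sum_tmul] at h
  rw [hs]
  simp only [map_sum, source_apply hs, sum_tmul, LinearMap.rTensor_tmul]
  rw [Finset.sum_comm]
  exact h

/-- The right leg of `Δ(1)` lies in `B_t`. -/
lemma target_lTensor_comul_one : targetCounital.lTensor B (Δ 1) = Δ 1 := by
  obtain ⟨s, hs⟩ := TensorProduct.exists_finset (Δ 1)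
  have h := congrArg ((epsR B B).rTensor B) (comul_one' (B := B))
  rw [hs] at h
  simp [map_sum, Finset.mul_sum, Finset.sum_mul, tmul_sum, sum_tmul] at h
  rw [hs]
  simp only [map_sum, target_apply hs, tmul_sum, LinearMap.lTensor_tmul, ← smul_tmul]
  exact h

lemma target_one : targetCounital (1 : B) = 1 := by
  have := epsL_comul (1 : B)
  rwa [targetCounital, LinearMap.comp_apply, LinearMap.comp_apply, LinearMap.comp_apply,
    LinearMap.flip_apply, TensorProduct.mk_apply, ← Algebra.TensorProduct.one_def,
    LinearMap.mulLeft_apply, mul_one]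

lemma leg_mul_antipode {s : Finset (B × B)} (hs : Δ 1 = ∑ i ∈ s, i.1 ⊗ₜ[ℂ] i.2) :
    ∑ i ∈ s, i.1 * S i.2 = 1 := by
  have := mul_antipode (1 : B)
  rw [hs, target_one] at this
  simpa [map_sum] using this

lemma target_eq_antipode {z : B} (hz : z ∈ source B) : targetCounital z = S z := by
  obtain ⟨s, hs⟩ := TensorProduct.exists_finset (Δ 1)
  have h1 := leg_mul_antipode hs
  rw [← mul_antipode, comul_of_mem hz, hs]
  simp [map_sum, Finset.mul_sum, antipode_mul, ← mul_assoc, ← Finset.sum_mul, h1]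

lemma antipode_comul_one {s : Finset (B × B)} (hs : Δ 1 = ∑ i ∈ s, i.1 ⊗ₜ[ℂ] i.2) :
    Δ 1 = ∑ i ∈ s, S i.2 ⊗ₜ[ℂ] S i.1 := by
  have := comul_antipode (1 : B)
  rw [antipode_one] at this
  rw [this, hs]
  simp [map_sum]

lemma counit_mul_antipode {z : B} (hz : z ∈ source B) (b : B) : ε (b * S z) = ε (b * z) := by
  obtain ⟨s, hs⟩ := TensorProduct.exists_finset (Δ 1)
  rw [← target_eq_antipode hz, target_apply hs, Finset.mul_sum, map_sum,
    ← counit_one_mul' b z hs]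
  simp [mul_comm]

/-- `ε(1₂ S(z)) 1₁ = z` for `z ∈ B_s` -/
lemma leg_antipode {z : B} (hz : z ∈ source B) {s : Finset (B × B)}
    (hs : Δ 1 = ∑ i ∈ s, i.1 ⊗ₜ[ℂ] i.2) : ∑ i ∈ s, ε (i.2 * S z) • i.1 = z := by
  simp only [counit_mul_antipode hz]
  conv_rhs => rw [← epsR_comul z, comul_of_mem' hz, hs]
  simp [map_sum, Finset.sum_mul, epsR]

/-- `ε(z 1₁) S(1₂) = z` for `z ∈ B_s` -/
lemma antipode_leg {z : B} (hz : z ∈ source B) {s : Finset (B × B)}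
    (hs : Δ 1 = ∑ i ∈ s, i.1 ⊗ₜ[ℂ] i.2) : ∑ i ∈ s, ε (z * i.1) • S i.2 = z := by
  have h := congrArg (epsR B B ∘ₗ LinearMap.mulRight ℂ (1 ⊗ₜ S z))
    (hs.symm.trans (antipode_comul_one hs))
  simp [map_sum, epsR] at h
  rw [leg_antipode hz hs] at h
  conv_rhs => rw [h]
  simp [← antipode_mul, counit_antipode]

/-- The right leg of `Δ(1)` commutes with `B_s`. -/
lemma tmul_comm_comul_one {z : B} (hz : z ∈ source B) :
    ((1 : B) ⊗ₜ[ℂ] z) * Δ 1 = Δ 1 * (1 ⊗ₜ z) := by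
  rw [← comul_of_mem hz, comul_of_mem' hz]

section Regular

variable [IsRegularQuantumGroupoid B]

lemma counit_leg_mul_leg (z : B) {s : Finset (B × B)} (hs : Δ 1 = ∑ i ∈ s, i.1 ⊗ₜ[ℂ] i.2) :
    ∑ i ∈ s, ε (z * i.1 * i.2) = ε z := by
  have hT : (S).lTensor B ((S).lTensor B (Δ 1)) = Δ 1 := by
    conv_lhs => rw [← target_lTensor_comul_one]
    conv_rhs => rw [← target_lTensor_comul_one]
    rw [hs]
    simp [map_sum, IsRegularQuantumGroupoid.antipode_antipode]
  have h0 := leg_mul_antipode hs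
  have h1 : ∑ i ∈ s, i.2 * S i.1 = 1 := by
    have h := congrArg S h0
    have h' := congrArg (LinearMap.mul' ℂ B ∘ₗ (TensorProduct.comm ℂ B B).toLinearMap ∘ₗ
      (S).rTensor B) hT
    rw [hs] at h'
    simp [map_sum, antipode_mul, antipode_one] at h h'
    rw [← h', h]
  have h2 : ∑ i ∈ s, S i.2 * i.1 = 1 := by
    have h := congrArg S h1
    have h' := congrArg (LinearMap.mul' ℂ B ∘ₗ (TensorProduct.comm ℂ B B).toLinearMap ∘ₗ
      (S).lTensor B) (hs.symm.trans (antipode_comul_one hs))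
    simp [map_sum, antipode_mul, antipode_one] at h h'
    rw [h', h]
  have h3 : ∑ i ∈ s, ε (z * i.1 * i.2) = ∑ i ∈ s, ε (z * S i.2 * S i.1) := by
    have h' := congrArg (ε ∘ₗ LinearMap.mulLeft ℂ z ∘ₗ LinearMap.mul' ℂ B)
      (hs.symm.trans (antipode_comul_one hs))
    simpa [map_sum, mul_assoc] using h'
  have h4 : ∑ i ∈ s, ε (z * S i.2 * S i.1) = ∑ i ∈ s, ε (z * S i.2 * i.1) := by
    have key := (source_rTensor_comul_one (B := B)).symm
    conv_lhs at key => rw [hs]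
    conv_rhs at key => rw [hs]
    have k1 := congrArg (ε ∘ₗ LinearMap.mulLeft ℂ z ∘ₗ LinearMap.mul' ℂ B ∘ₗ
      TensorProduct.map S S ∘ₗ (TensorProduct.comm ℂ B B).toLinearMap) key
    have k2 := congrArg (ε ∘ₗ LinearMap.mulLeft ℂ z ∘ₗ LinearMap.mul' ℂ B ∘ₗ
      (S).rTensor B ∘ₗ (TensorProduct.comm ℂ B B).toLinearMap) key
    simp only [map_sum, LinearMap.comp_apply, LinearEquiv.coe_coe, TensorProduct.comm_tmul,
      TensorProduct.map_tmul, LinearMap.rTensor_tmul, LinearMap.mul'_apply,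
      LinearMap.mulLeft_apply, ← mul_assoc] at k1 k2
    rw [k1, k2]
    exact Finset.sum_congr rfl fun i _ => counit_mul_antipode ⟨_, rfl⟩ _
  rw [h3, h4]
  simp only [mul_assoc]
  rw [← map_sum, ← Finset.mul_sum, h2, mul_one]

/-- Left multiplication on `B_s`. -/
def sourceMulLeft (z : source B) : source B →ₗ[ℂ] source B :=
  (LinearMap.mulLeft ℂ (z : B)).restrict fun _ hx => mul_mem_source z.2 hx

lemma trace_sourceMulLeft (z : source B) :
    LinearMap.trace ℂ (source B) (sourceMulLeft z) = ε (z : B) := by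
  obtain ⟨s, hs⟩ := TensorProduct.exists_finset (Δ 1)
  have : sourceMulLeft z = ∑ i ∈ s, ((ε ∘ₗ LinearMap.mulRight ℂ i.2 ∘ₗ
      LinearMap.mulLeft ℂ (z : B) ∘ₗ (source B).subtype).smulRight
        (⟨sourceCounital i.1, i.1, rfl⟩ : source B)) := by
    ext x
    have h := source_rTensor_comul_one (B := B)
    rw [hs] at h
    have h' := congrArg (epsR B B ∘ₗ LinearMap.mulLeft ℂ (1 ⊗ₜ ((z : B) * (x : B)))) h
    have h2 := source_apply hs ((z : B) * (x : B))
    rw [source_apply_self (mul_mem_source z.2 x.2)] at h2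
    simp [map_sum, epsR] at h'
    simp only [LinearMap.sum_apply, LinearMap.smulRight_apply, LinearMap.comp_apply,
      LinearMap.mulRight_apply, LinearMap.mulLeft_apply, Submodule.subtype_apply,
      Submodule.coe_sum, Submodule.coe_smul]
    rw [h', ← h2]
    rfl
  rw [this, map_sum]
  simp only [LinearMap.trace_smulRight]
  rw [← counit_leg_mul_leg (z : B) hs]
  have h := source_rTensor_comul_one (B := B)
  rw [hs] at h
  have h' := congrArg (ε ∘ₗ LinearMap.mulLeft ℂ (z : B) ∘ₗ LinearMap.mul' ℂ B) h
  simpa [map_sum, mul_assoc] using h'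

open Polynomial in
lemma counit_star_mul_self (z : source B) :
    0 ≤ (ε (star (z : B) * z)).re ∧ (ε (star (z : B) * z) = 0 → z = 0) := by
  set y : source B := ⟨star (z : B) * z, mul_mem_source (star_mem_source z.2) z.2⟩ with hy
  have htr : ε (star (z : B) * z) = LinearMap.trace ℂ (source B) (sourceMulLeft y) :=
    (trace_sourceMulLeft y).symm
  set f : Module.End ℂ (source B) := sourceMulLeft y with hf
  have hroots : ∀ μ ∈ f.charpoly.roots, ∃ r : ℝ, 0 ≤ r ∧ μ = r := by
    intro μ hμ
    have h1 : f.HasEigenvalue μ :=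
      (Module.End.hasEigenvalue_iff_isRoot_charpoly f μ).2 (Polynomial.isRoot_of_mem_roots hμ)
    obtain ⟨x, hx⟩ := h1.exists_hasEigenvector
    have h2 : (star (z : B) * z) * (x : B) = μ • (x : B) := congrArg Subtype.val hx.apply_eq_smul
    have h3 : μ ∈ spectrum ℂ (star (z : B) * z) := by
      rw [spectrum.mem_iff]
      intro hu
      obtain ⟨c, hc⟩ := hu
      apply hx.2
      ext
      have : (c : B) * x = 0 := by
        rw [hc, sub_mul, h2, Algebra.algebraMap_eq_smul_one, smul_one_mul, sub_self]
      simpa using this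
    have h4 : IsSelfAdjoint (star (z : B) * z) := IsSelfAdjoint.star_mul_self _
    refine ⟨μ.re, ?_, (h4.mem_spectrum_eq_re h3)⟩
    refine spectrum_star_mul_self_nonneg (b := (z : B)) _ ?_
    rw [h4.mem_spectrum_eq_re h3] at h3
    exact (spectrum.algebraMap_mem_iff ℂ (R := ℝ)).1 h3
  have hsum : LinearMap.trace ℂ (source B) f = f.charpoly.roots.sum := by
    rw [LinearMap.charpoly_def, LinearMap.trace_eq_matrix_trace ℂ (Module.Free.chooseBasis ℂ _) f,
      Matrix.trace_eq_sum_roots_charpoly]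
  have hre : ∀ s : Multiset ℂ, (∀ μ ∈ s, ∃ r : ℝ, 0 ≤ r ∧ μ = r) →
      0 ≤ s.sum.re ∧ (s.sum.re = 0 → ∀ μ ∈ s, μ = 0) := by
    intro s
    induction s using Multiset.induction with
    | empty => simp
    | cons a s ih =>
      intro h
      obtain ⟨r, hr, rfl⟩ := h a (Multiset.mem_cons_self a s)
      obtain ⟨ih1, ih2⟩ := ih fun μ hμ => h μ (Multiset.mem_cons_of_mem hμ)
      rw [Multiset.sum_cons, Complex.add_re, Complex.ofReal_re]
      refine ⟨by positivity, fun h0 μ hμ => ?_⟩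
      have hr0 : r = 0 := by linarith
      rcases Multiset.mem_cons.1 hμ with rfl | hμ
      · simp [hr0]
      · exact ih2 (by linarith) μ hμ
  rw [htr, hsum]
  refine ⟨(hre _ hroots).1, fun h0 => ?_⟩
  have hz := (hre _ hroots).2 (by rw [h0]; rfl)
  have hX : f.charpoly = X ^ Multiset.card f.charpoly.roots := by
    conv_lhs => rw [(IsAlgClosed.splits f.charpoly).eq_prod_roots_of_monic f.charpoly_monic]
    rw [Multiset.eq_replicate_card.2 hz]
    simp
  have hnil : f ^ Multiset.card f.charpoly.roots = 0 := by
    have := f.aeval_self_charpoly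
    rw [hX] at this
    simpa using this
  set n := Multiset.card f.charpoly.roots
  have hpow : ∀ k : ℕ, (((f ^ k) ⟨1, one_mem_source⟩ : source B) : B) = (star (z : B) * z) ^ k := by
    intro k
    induction k with
    | zero => simp
    | succ k ih =>
      rw [pow_succ', Module.End.mul_apply, pow_succ', ← ih]
      rfl
  have h1 : (star (z : B) * z) ^ n = 0 := by rw [← hpow, hnil]; rfl
  have h2 : (star (z : B) * z) ^ (2 ^ n) = 0 :=
    pow_eq_zero_of_le Nat.lt_two_pow_self.le h1
  have h3 := (IsSelfAdjoint.star_mul_self (z : B)).nnnorm_pow_two_pow n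
  rw [h2, nnnorm_zero, eq_comm, pow_eq_zero_iff (by positivity), nnnorm_eq_zero,
    CStarRing.star_mul_self_eq_zero_iff] at h3
  exact Subtype.ext h3

end Regular

end WeakHopfCStarAlgebra

open WeakHopfCStarAlgebra

section Comodule

variable {B : Type u} [CStarAlgebra B] [WeakHopfCStarAlgebra B]
variable {H K L : Type u} [NormedAddCommGroup H] [InnerProductSpace ℂ H]
  [NormedAddCommGroup K] [InnerProductSpace ℂ K] [NormedAddCommGroup L] [InnerProductSpace ℂ L]

local notation "Δ" => (CoalgebraStruct.comul : B →ₗ[ℂ] B ⊗[ℂ] B)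
local notation "ε" => (CoalgebraStruct.counit : B →ₗ[ℂ] ℂ)
local notation "S" => (antipode : B →ₗ[ℂ] B)

/-- The slice map `v ⊗ b ↦ ⟨v, w⟩ b` (the scalar product being linear in `v`). -/
def innerSlice (w : H) : H ⊗[ℂ] B →ₗ[ℂ] B :=
  (TensorProduct.lid ℂ B).toLinearMap ∘ₗ (innerₛₗ ℂ w).rTensor B

@[simp] lemma innerSlice_tmul (w v : H) (b : B) :
    innerSlice w (v ⊗ₜ[ℂ] b) = inner ℂ w v • b := by
  simp [innerSlice]

/-- Coassociativity `(δ ⊗ id)δ = (id ⊗ Δ)δ` together with the unitarity condition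
`⟨v¹, w⟩ v² = ⟨v, w¹⟩ S(w²)*`. -/
structure IsUnitaryCoaction (δ : H →ₗ[ℂ] H ⊗[ℂ] B) : Prop where
  coassoc (v : H) : TensorProduct.assoc ℂ H B B (δ.rTensor B (δ v)) = (Δ).lTensor H (δ v)
  unitary (v w : H) : innerSlice w (δ v) = star (S (innerSlice v (δ w)))

/-- `(v ⊗ b, w ⊗ c) ↦ (v ⊗ w) ⊗ bc` -/
def legMul (C : Type*) [Ring C] [Algebra ℂ C] (H K : Type*) [AddCommGroup H] [Module ℂ H]
    [AddCommGroup K] [Module ℂ K] :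
    H ⊗[ℂ] C →ₗ[ℂ] K ⊗[ℂ] C →ₗ[ℂ] (H ⊗[ℂ] K) ⊗[ℂ] C :=
  TensorProduct.map₂ (TensorProduct.mk ℂ H K) (LinearMap.mul ℂ C)

@[simp] lemma legMul_tmul (C : Type*) [Ring C] [Algebra ℂ C] {H K : Type*} [AddCommGroup H]
    [Module ℂ H] [AddCommGroup K] [Module ℂ K] (v : H) (w : K) (b c : C) :
    legMul C H K (v ⊗ₜ b) (w ⊗ₜ c) = (v ⊗ₜ w) ⊗ₜ (b * c) := rfl

/-- `v ⊗ w ↦ v¹ ⊗ w¹ ⊗ v²w²` on the full tensor product. -/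
def tensorCoact (δ : H →ₗ[ℂ] H ⊗[ℂ] B) (δ' : K →ₗ[ℂ] K ⊗[ℂ] B) :
    H ⊗[ℂ] K →ₗ[ℂ] (H ⊗[ℂ] K) ⊗[ℂ] B :=
  TensorProduct.lift ((legMul B H K).compl₁₂ δ δ')

@[simp] lemma tensorCoact_tmul (δ : H →ₗ[ℂ] H ⊗[ℂ] B) (δ' : K →ₗ[ℂ] K ⊗[ℂ] B) (v : H) (w : K) :
    tensorCoact δ δ' (v ⊗ₜ w) = legMul B H K (δ v) (δ' w) := rfl

lemma lTensor_legMul (t : H ⊗[ℂ] B) (r : K ⊗[ℂ] B) :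
    (Δ).lTensor (H ⊗[ℂ] K) (legMul B H K t r) =
      legMul (B ⊗[ℂ] B) H K ((Δ).lTensor H t) ((Δ).lTensor K r) := by
  induction t with
  | zero => simp only [LinearMap.map_zero, LinearEquiv.map_zero, LinearMap.zero_apply, zero_tmul]
  | add x y hx hy => simp only [LinearMap.map_add, LinearEquiv.map_add, LinearMap.add_apply, hx, hy]
  | tmul x b =>
    induction r with
    | zero => simp only [LinearMap.map_zero, LinearEquiv.map_zero, LinearMap.zero_apply, zero_tmul]
    | add x y hx hy => simp only [LinearMap.map_add, LinearEquiv.map_add, hx, hy]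
    | tmul y c => simp [comul_mul]

lemma assoc_rTensor_legMul (δ : H →ₗ[ℂ] H ⊗[ℂ] B) (δ' : K →ₗ[ℂ] K ⊗[ℂ] B)
    (t : H ⊗[ℂ] B) (r : K ⊗[ℂ] B) :
    TensorProduct.assoc ℂ _ B B ((tensorCoact δ δ').rTensor B (legMul B H K t r)) =
      legMul (B ⊗[ℂ] B) H K (TensorProduct.assoc ℂ _ B B (δ.rTensor B t))
        (TensorProduct.assoc ℂ _ B B (δ'.rTensor B r)) := by
  induction t with
  | zero => simp only [LinearMap.map_zero, LinearEquiv.map_zero, LinearMap.zero_apply, zero_tmul]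
  | add x y hx hy => simp only [LinearMap.map_add, LinearEquiv.map_add, LinearMap.add_apply, hx, hy]
  | tmul x b =>
    induction r with
    | zero => simp only [LinearMap.map_zero, LinearEquiv.map_zero, LinearMap.zero_apply, zero_tmul]
    | add x y hx hy => simp only [LinearMap.map_add, LinearEquiv.map_add, hx, hy]
    | tmul y c =>
      simp only [legMul_tmul, LinearMap.rTensor_tmul, tensorCoact_tmul]
      generalize δ x = p
      generalize δ' y = q
      induction p with
      | zero => simp only [LinearMap.map_zero, LinearEquiv.map_zero, LinearMap.zero_apply, zero_tmul]
      | add x y hx hy => simp only [LinearMap.map_add, LinearEquiv.map_add, LinearMap.add_apply, add_tmul, hx, hy]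
      | tmul x b' =>
        induction q with
        | zero => simp only [LinearMap.map_zero, LinearEquiv.map_zero, LinearMap.zero_apply, zero_tmul]
        | add x y hx hy => simp only [LinearMap.map_add, LinearEquiv.map_add, add_tmul, hx, hy]
        | tmul y c' => simp

lemma innerSlice_legMul (v : H) (w : K) (t : H ⊗[ℂ] B) (r : K ⊗[ℂ] B) :
    innerSlice (v ⊗ₜ[ℂ] w) (legMul B H K t r) = innerSlice v t * innerSlice w r := by
  induction t with
  | zero => simp
  | add x y hx hy => simp only [LinearMap.map_add, LinearEquiv.map_add, LinearMap.add_apply, hx, hy, add_mul]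
  | tmul x b =>
    induction r with
    | zero => simp
    | add x y hx hy => simp only [LinearMap.map_add, LinearEquiv.map_add, hx, hy, mul_add]
    | tmul y c => simp [smul_smul, mul_comm]

lemma innerSlice_add (v w : H) (t : H ⊗[ℂ] B) :
    innerSlice (v + w) t = innerSlice v t + innerSlice w t := by
  simp [innerSlice, LinearMap.rTensor_add]

lemma innerSlice_zero (t : H ⊗[ℂ] B) : innerSlice (0 : H) t = 0 := by
  simp [innerSlice]

lemma IsUnitaryCoaction.tensor {δ : H →ₗ[ℂ] H ⊗[ℂ] B} {δ' : K →ₗ[ℂ] K ⊗[ℂ] B}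
    (h : IsUnitaryCoaction δ) (h' : IsUnitaryCoaction δ') :
    IsUnitaryCoaction (tensorCoact δ δ') where
  coassoc v := by
    induction v with
    | zero => simp only [LinearMap.map_zero, LinearEquiv.map_zero, LinearMap.zero_apply, zero_tmul]
    | add x y hx hy => simp only [LinearMap.map_add, LinearEquiv.map_add, hx, hy]
    | tmul x y => rw [tensorCoact_tmul, assoc_rTensor_legMul, lTensor_legMul, h.coassoc, h'.coassoc]
  unitary v w := by
    induction v with
    | zero => simp [innerSlice_zero]
    | add x y hx hy => simp only [LinearMap.map_add, LinearEquiv.map_add, innerSlice_add, star_add, hx, hy]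
    | tmul x y =>
      induction w with
      | zero => simp [innerSlice_zero]
      | add x y hx hy => simp only [LinearMap.map_add, LinearEquiv.map_add, innerSlice_add, star_add, hx, hy]
      | tmul x' y' =>
        simp only [tensorCoact_tmul, innerSlice_legMul, antipode_mul, star_mul, h.unitary x x',
          h'.unitary y y']

/-- `P = (id ⊗ ε)δ` -/
def coactProj (δ : H →ₗ[ℂ] H ⊗[ℂ] B) : H →ₗ[ℂ] H := epsR B H ∘ₗ δ

lemma epsR_rTensor {H K : Type*} [AddCommGroup H] [Module ℂ H] [AddCommGroup K] [Module ℂ K]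
    (f : H →ₗ[ℂ] K) (t : H ⊗[ℂ] B) : epsR B K (f.rTensor B t) = f (epsR B H t) := by
  induction t with
  | zero => simp only [LinearMap.map_zero, LinearEquiv.map_zero, LinearMap.zero_apply, zero_tmul]
  | add x y hx hy => simp only [LinearMap.map_add, LinearEquiv.map_add, hx, hy]
  | tmul x b => simp

lemma epsR_assoc (t : (H ⊗[ℂ] B) ⊗[ℂ] B) :
    (epsR B B).lTensor H (TensorProduct.assoc ℂ H B B t) = epsR B (H ⊗[ℂ] B) t := by
  induction t with
  | zero => simp only [LinearMap.map_zero, LinearEquiv.map_zero, LinearMap.zero_apply, zero_tmul]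
  | add x y hx hy => simp only [LinearMap.map_add, LinearEquiv.map_add, hx, hy]
  | tmul x b =>
    induction x with
    | zero => simp only [LinearMap.map_zero, LinearEquiv.map_zero, LinearMap.zero_apply, zero_tmul]
    | add x y hx hy => simp only [add_tmul, LinearMap.map_add, LinearEquiv.map_add, hx, hy]
    | tmul x c => simp

lemma epsR_lTensor_comul (t : H ⊗[ℂ] B) : (epsR B B).lTensor H ((Δ).lTensor H t) = t := by
  induction t with
  | zero => simp only [LinearMap.map_zero, LinearEquiv.map_zero, LinearMap.zero_apply, zero_tmul]
  | add x y hx hy => simp only [LinearMap.map_add, LinearEquiv.map_add, hx, hy]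
  | tmul x b => simp only [LinearMap.lTensor_tmul, epsR_comul]

lemma epsR_rTensor_assoc (t : (H ⊗[ℂ] B) ⊗[ℂ] B) :
    ((TensorProduct.lid ℂ B).toLinearMap ∘ₗ (ε).rTensor B).lTensor H
      (TensorProduct.assoc ℂ H B B t) = (epsR B H).rTensor B t := by
  induction t with
  | zero => simp only [LinearMap.map_zero, LinearEquiv.map_zero, LinearMap.zero_apply, zero_tmul]
  | add x y hx hy => simp only [LinearMap.map_add, LinearEquiv.map_add, hx, hy]
  | tmul x b =>
    induction x with
    | zero => simp only [LinearMap.map_zero, LinearEquiv.map_zero, LinearMap.zero_apply, zero_tmul]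
    | add x y hx hy => simp only [add_tmul, LinearMap.map_add, LinearEquiv.map_add, hx, hy]
    | tmul x c => simp [tmul_smul, smul_tmul']

lemma epsL_lTensor_comul (t : H ⊗[ℂ] B) :
    ((TensorProduct.lid ℂ B).toLinearMap ∘ₗ (ε).rTensor B).lTensor H ((Δ).lTensor H t) = t := by
  induction t with
  | zero => simp only [LinearMap.map_zero, LinearEquiv.map_zero, LinearMap.zero_apply, zero_tmul]
  | add x y hx hy => simp only [LinearMap.map_add, LinearEquiv.map_add, hx, hy]
  | tmul x b => simp

namespace IsUnitaryCoaction

variable {δ : H →ₗ[ℂ] H ⊗[ℂ] B} {δ' : K →ₗ[ℂ] K ⊗[ℂ] B}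

lemma coact_proj (h : IsUnitaryCoaction δ) (v : H) : δ (coactProj δ v) = δ v := by
  have := congrArg ((epsR B B).lTensor H) (h.coassoc v)
  rw [epsR_assoc, epsR_lTensor_comul, epsR_rTensor] at this
  exact this

lemma proj_coact (h : IsUnitaryCoaction δ) (v : H) : (coactProj δ).rTensor B (δ v) = δ v := by
  have := congrArg (((TensorProduct.lid ℂ B).toLinearMap ∘ₗ (ε).rTensor B).lTensor H) (h.coassoc v)
  rw [epsR_rTensor_assoc, epsL_lTensor_comul, ← LinearMap.comp_apply, ← LinearMap.rTensor_comp]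
    at this
  exact this

lemma proj_proj (h : IsUnitaryCoaction δ) (v : H) :
    coactProj δ (coactProj δ v) = coactProj δ v := by
  rw [coactProj, LinearMap.comp_apply, ← coactProj, h.coact_proj]
  rfl

end IsUnitaryCoaction

lemma proj_comm {δ : H →ₗ[ℂ] H ⊗[ℂ] B} {δ' : K →ₗ[ℂ] K ⊗[ℂ] B} {f : H →ₗ[ℂ] K}
    (hf : ∀ v, δ' (f v) = f.rTensor B (δ v)) (v : H) :
    coactProj δ' (f v) = f (coactProj δ v) := by
  simp only [coactProj, LinearMap.comp_apply (f := epsR B K), LinearMap.comp_apply (f := epsR B H),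
    hf, epsR_rTensor]

/-- The coaction restricted to the range of `P`. -/
def rangeCoact (δ : H →ₗ[ℂ] H ⊗[ℂ] B) :
    LinearMap.range (coactProj δ) →ₗ[ℂ] LinearMap.range (coactProj δ) ⊗[ℂ] B :=
  (coactProj δ).rangeRestrict.rTensor B ∘ₗ δ ∘ₗ (LinearMap.range (coactProj δ)).subtype

lemma innerSlice_rTensor {f : H →ₗ[ℂ] K} {v : H} {w : K} (hf : ∀ x, inner ℂ w (f x) = inner ℂ v x)
    (t : H ⊗[ℂ] B) : innerSlice w (f.rTensor B t) = innerSlice v t := by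
  induction t with
  | zero => simp only [LinearMap.map_zero, LinearEquiv.map_zero, LinearMap.zero_apply, zero_tmul]
  | add x y hx hy => simp only [LinearMap.map_add, LinearEquiv.map_add, hx, hy]
  | tmul x b => simp [hf]

lemma coassoc_of_surjective {δ : H →ₗ[ℂ] H ⊗[ℂ] B} {δ' : K →ₗ[ℂ] K ⊗[ℂ] B} {f : H →ₗ[ℂ] K}
    (hf : ∀ v, δ' (f v) = f.rTensor B (δ v)) {v : H}
    (h : TensorProduct.assoc ℂ H B B (δ.rTensor B (δ v)) = (Δ).lTensor H (δ v)) :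
    TensorProduct.assoc ℂ K B B (δ'.rTensor B (δ' (f v))) = (Δ).lTensor K (δ' (f v)) := by
  have h1 : ∀ t : H ⊗[ℂ] B, TensorProduct.assoc ℂ K B B (δ'.rTensor B (f.rTensor B t)) =
      f.rTensor (B ⊗[ℂ] B) (TensorProduct.assoc ℂ H B B (δ.rTensor B t)) := by
    intro t
    induction t with
    | zero => simp only [LinearMap.map_zero, LinearEquiv.map_zero, LinearMap.zero_apply, zero_tmul]
    | add x y hx hy => simp only [LinearMap.map_add, LinearEquiv.map_add, hx, hy]
    | tmul x b =>
      simp only [LinearMap.rTensor_tmul, hf]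
      generalize δ x = p
      induction p with
      | zero => simp only [LinearMap.map_zero, LinearEquiv.map_zero, LinearMap.zero_apply, zero_tmul]
      | add x y hx hy => simp only [LinearMap.map_add, LinearEquiv.map_add, add_tmul, hx, hy]
      | tmul x c => simp
  rw [hf, h1, h, ← LinearMap.comp_apply (LinearMap.rTensor _ _),
    ← LinearMap.comp_apply (LinearMap.lTensor _ _), LinearMap.lTensor_comp_rTensor,
    LinearMap.rTensor_comp_lTensor]

namespace IsUnitaryCoaction

variable {δ : H →ₗ[ℂ] H ⊗[ℂ] B}

lemma rangeRestrict_coe (h : IsUnitaryCoaction δ) (z : LinearMap.range (coactProj δ)) :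
    (coactProj δ).rangeRestrict (z : H) = z := by
  obtain ⟨_, v, rfl⟩ := z
  exact Subtype.ext (h.proj_proj v)

lemma proj_coe (h : IsUnitaryCoaction δ) (z : LinearMap.range (coactProj δ)) :
    coactProj δ (z : H) = z := congrArg Subtype.val (h.rangeRestrict_coe z)

lemma subtype_rangeCoact (h : IsUnitaryCoaction δ) (z : LinearMap.range (coactProj δ)) :
    (LinearMap.range (coactProj δ)).subtype.rTensor B (rangeCoact δ z) = δ (z : H) := by
  rw [rangeCoact, LinearMap.comp_apply, ← LinearMap.comp_apply, ← LinearMap.rTensor_comp]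
  exact h.proj_coact z

lemma rangeCoact_rangeRestrict (h : IsUnitaryCoaction δ) (v : H) :
    rangeCoact δ ((coactProj δ).rangeRestrict v) = (coactProj δ).rangeRestrict.rTensor B (δ v) := by
  rw [rangeCoact, LinearMap.comp_apply]
  exact congrArg _ (h.coact_proj v)

lemma rangeCoact_isUnitary (h : IsUnitaryCoaction δ) : IsUnitaryCoaction (rangeCoact δ) where
  coassoc z := by
    rw [← h.rangeRestrict_coe z]
    exact coassoc_of_surjective h.rangeCoact_rangeRestrict (h.coassoc _)
  unitary v w := by
    have key (v w : LinearMap.range (coactProj δ)) :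
        innerSlice w (rangeCoact δ v) = innerSlice (w : H) (δ (v : H)) := by
      rw [← h.subtype_rangeCoact v]
      exact (innerSlice_rTensor (fun x => rfl) _).symm
    rw [key, key, h.unitary]

lemma epsR_rangeCoact (h : IsUnitaryCoaction δ) (z : LinearMap.range (coactProj δ)) :
    epsR B _ (rangeCoact δ z) = z := by
  change epsR B _ ((coactProj δ).rangeRestrict.rTensor B (δ (z : H))) = z
  rw [epsR_rTensor]
  conv_rhs => rw [← h.rangeRestrict_coe z]
  exact Subtype.ext (h.proj_proj _)

end IsUnitaryCoaction

end Comodule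

/-- A finite dimensional right unitary comodule of the finite quantum groupoid `B`, that is, the
data of a unitary corepresentation `U` on `H_U`; `coact v = U(v ⊗ 1)`. -/
structure UCorep (B : Type u) [CStarAlgebra B] [WeakHopfCStarAlgebra B] where
  /-- The Hilbert space `H_U`. -/
  carrier : Type u
  [normedAddCommGroup : NormedAddCommGroup carrier]
  [innerProductSpace : InnerProductSpace ℂ carrier]
  [finiteDimensional : FiniteDimensional ℂ carrier]
  /-- The coaction `v ↦ v¹ ⊗ v²`. -/
  coact : carrier →ₗ[ℂ] carrier ⊗[ℂ] B
  isUnitary : IsUnitaryCoaction coact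
  counit (v : carrier) : epsR B carrier (coact v) = v

namespace UCorep

attribute [instance] normedAddCommGroup innerProductSpace finiteDimensional

variable {B : Type u} [CStarAlgebra B] [WeakHopfCStarAlgebra B]

/-- The space `Mor(U, V)` of `B`-colinear maps. -/
def mor (U V : UCorep B) : Submodule ℂ (U.carrier →ₗ[ℂ] V.carrier) where
  carrier := {f | ∀ v, V.coact (f v) = f.rTensor B (U.coact v)}
  add_mem' hf hg v := by simp [LinearMap.rTensor_add, hf v, hg v]
  zero_mem' v := by simp
  smul_mem' c f hf v := by simp [LinearMap.rTensor_smul, hf v]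

instance : Category (UCorep B) where
  Hom U V := mor U V
  id U := ⟨LinearMap.id, fun v => by simp⟩
  comp f g := ⟨g.1 ∘ₗ f.1, fun v => by
    rw [LinearMap.comp_apply, g.2, f.2, LinearMap.rTensor_comp, LinearMap.comp_apply]⟩

/-- The linear map underlying a morphism. -/
def lin {U V : UCorep B} (f : U ⟶ V) : U.carrier →ₗ[ℂ] V.carrier := Subtype.val f

/-- A colinear map as a morphism. -/
def homMk {U V : UCorep B} (f : U.carrier →ₗ[ℂ] V.carrier)
    (hf : ∀ v, V.coact (f v) = f.rTensor B (U.coact v)) : U ⟶ V := ⟨f, hf⟩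

@[simp] lemma lin_homMk {U V : UCorep B} (f : U.carrier →ₗ[ℂ] V.carrier)
    (hf : ∀ v, V.coact (f v) = f.rTensor B (U.coact v)) : lin (homMk f hf) = f := rfl

lemma colin {U V : UCorep B} (f : U ⟶ V) (v : U.carrier) :
    V.coact (lin f v) = (lin f).rTensor B (U.coact v) := f.2 v

lemma hom_ext {U V : UCorep B} {f g : U ⟶ V} (h : lin f = lin g) : f = g := Subtype.ext h

@[simp] lemma lin_id (U : UCorep B) : lin (𝟙 U) = LinearMap.id := rfl

@[simp] lemma lin_comp {U V W : UCorep B} (f : U ⟶ V) (g : V ⟶ W) :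
    lin (f ≫ g) = lin g ∘ₗ lin f := rfl

instance : Preadditive (UCorep B) where
  homGroup U V := inferInstanceAs (AddCommGroup (mor U V))
  add_comp _ _ _ f f' g := hom_ext (LinearMap.comp_add (lin f) (lin f') (lin g))
  comp_add _ _ _ f g g' := hom_ext (LinearMap.add_comp (lin f) (lin g') (lin g))

instance : Linear ℂ (UCorep B) where
  homModule U V := inferInstanceAs (Module ℂ (mor U V))
  smul_comp _ _ _ r f g := hom_ext (LinearMap.comp_smul (lin g) r (lin f))
  comp_smul _ _ _ f r g := hom_ext (LinearMap.smul_comp r (lin g) (lin f))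

lemma innerSlice_separates {H : Type u} [NormedAddCommGroup H] [InnerProductSpace ℂ H]
    [FiniteDimensional ℂ H] {t t' : H ⊗[ℂ] B} (h : ∀ w : H, innerSlice w t = innerSlice w t') :
    t = t' := by
  have key (t : H ⊗[ℂ] B) : t = ∑ i, stdOrthonormalBasis ℂ H i ⊗ₜ[ℂ]
      innerSlice (stdOrthonormalBasis ℂ H i) t := by
    induction t with
    | zero => simp
    | add x y hx hy =>
      simp only [LinearMap.map_add, LinearEquiv.map_add, tmul_add, Finset.sum_add_distrib]
      rw [← hx, ← hy]
    | tmul x b =>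
      simp only [innerSlice_tmul, tmul_smul, smul_tmul', ← sum_tmul]
      rw [OrthonormalBasis.sum_repr' (stdOrthonormalBasis ℂ H) x]
  rw [key t, key t']
  simp only [h]

/-- The adjoint of a morphism, which is again colinear. -/
def adj {U V : UCorep B} (f : U ⟶ V) : V ⟶ U :=
  homMk (LinearMap.adjoint (lin f)) fun v => by
    refine innerSlice_separates fun w => ?_
    have h1 : innerSlice w ((LinearMap.adjoint (lin f)).rTensor B (V.coact v)) =
        innerSlice (lin f w) (V.coact v) :=
      innerSlice_rTensor (fun x => LinearMap.adjoint_inner_right (lin f) w x) _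
    have h2 : innerSlice v ((lin f).rTensor B (U.coact w)) =
        innerSlice (LinearMap.adjoint (lin f) v) (U.coact w) :=
      innerSlice_rTensor (fun x => (LinearMap.adjoint_inner_left (lin f) x v).symm) _
    rw [h1, U.isUnitary.unitary, V.isUnitary.unitary, colin, h2]

@[simp] lemma lin_adj {U V : UCorep B} (f : U ⟶ V) : lin (adj f) = LinearMap.adjoint (lin f) := rfl

/-! ### Tensor products -/

/-- The tensor product corepresentation on `H_U ⊗_{B_s} H_V = P(H_U ⊗ H_V)`,
`P(v ⊗ w) = v¹ ⊗ w¹ ε(v²w²)`, with the coaction `v ⊗ w ↦ v¹ ⊗ w¹ ⊗ v²w²`. -/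
def tensor (U V : UCorep B) : UCorep B where
  carrier := LinearMap.range (coactProj (tensorCoact U.coact V.coact))
  normedAddCommGroup := Submodule.normedAddCommGroup _
  innerProductSpace := Submodule.innerProductSpace _
  finiteDimensional := FiniteDimensional.finiteDimensional_submodule _
  coact := rangeCoact (tensorCoact U.coact V.coact)
  isUnitary := (U.isUnitary.tensor V.isUnitary).rangeCoact_isUnitary
  counit := (U.isUnitary.tensor V.isUnitary).epsR_rangeCoact

/-- The inclusion of `H_U ⊗_{B_s} H_V` into `H_U ⊗ H_V`. -/
def incl (U V : UCorep B) : (tensor U V).carrier →ₗ[ℂ] U.carrier ⊗[ℂ] V.carrier :=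
  (LinearMap.range (coactProj (tensorCoact U.coact V.coact))).subtype

/-- The projection `v ⊗ w ↦ v ⊗_{B_s} w`. -/
def proj (U V : UCorep B) : U.carrier ⊗[ℂ] V.carrier →ₗ[ℂ] (tensor U V).carrier :=
  (coactProj (tensorCoact U.coact V.coact)).rangeRestrict

lemma incl_injective (U V : UCorep B) : Function.Injective (incl U V) := Subtype.val_injective

lemma proj_incl (U V : UCorep B) (z : (tensor U V).carrier) : proj U V (incl U V z) = z :=
  (U.isUnitary.tensor V.isUnitary).rangeRestrict_coe z

lemma incl_proj (U V : UCorep B) (t : U.carrier ⊗[ℂ] V.carrier) :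
    incl U V (proj U V t) = coactProj (tensorCoact U.coact V.coact) t := rfl

lemma coact_proj (U V : UCorep B) (t : U.carrier ⊗[ℂ] V.carrier) :
    (tensor U V).coact (proj U V t) = (proj U V).rTensor B (tensorCoact U.coact V.coact t) :=
  (U.isUnitary.tensor V.isUnitary).rangeCoact_rangeRestrict t

lemma incl_coact (U V : UCorep B) (z : (tensor U V).carrier) :
    tensorCoact U.coact V.coact (incl U V z) = (incl U V).rTensor B ((tensor U V).coact z) :=
  ((U.isUnitary.tensor V.isUnitary).subtype_rangeCoact z).symm

lemma proj_eq (U : UCorep B) (v : U.carrier) : coactProj U.coact v = v := U.counit v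

end UCorep

namespace UCorep

variable {B : Type u} [CStarAlgebra B] [WeakHopfCStarAlgebra B]

local notation "Δ" => (CoalgebraStruct.comul : B →ₗ[ℂ] B ⊗[ℂ] B)
local notation "ε" => (CoalgebraStruct.counit : B →ₗ[ℂ] ℂ)

section Colin

variable {H K L H' K' : Type u} [NormedAddCommGroup H] [InnerProductSpace ℂ H]
  [NormedAddCommGroup K] [InnerProductSpace ℂ K] [NormedAddCommGroup L] [InnerProductSpace ℂ L]
  [NormedAddCommGroup H'] [InnerProductSpace ℂ H'] [NormedAddCommGroup K']
  [InnerProductSpace ℂ K']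

/-- Colinear maps. -/
def Colin (δ : H →ₗ[ℂ] H ⊗[ℂ] B) (δ' : K →ₗ[ℂ] K ⊗[ℂ] B) (f : H →ₗ[ℂ] K) : Prop :=
  ∀ v, δ' (f v) = f.rTensor B (δ v)

variable {δH : H →ₗ[ℂ] H ⊗[ℂ] B} {δK : K →ₗ[ℂ] K ⊗[ℂ] B} {δL : L →ₗ[ℂ] L ⊗[ℂ] B}
  {δH' : H' →ₗ[ℂ] H' ⊗[ℂ] B} {δK' : K' →ₗ[ℂ] K' ⊗[ℂ] B}

lemma Colin.id : Colin δH δH LinearMap.id := fun v => by simp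

lemma Colin.comp {f : H →ₗ[ℂ] K} {g : K →ₗ[ℂ] L} (hg : Colin δK δL g) (hf : Colin δH δK f) :
    Colin δH δL (g ∘ₗ f) := fun v => by
  rw [LinearMap.comp_apply, hg, hf, LinearMap.rTensor_comp, LinearMap.comp_apply]

lemma rTensor_legMul (f : H →ₗ[ℂ] H') (g : K →ₗ[ℂ] K') (t : H ⊗[ℂ] B) (r : K ⊗[ℂ] B) :
    (TensorProduct.map f g).rTensor B (legMul B H K t r) =
      legMul B H' K' (f.rTensor B t) (g.rTensor B r) := by
  induction t with
  | zero => simp only [LinearMap.map_zero, LinearEquiv.map_zero, LinearMap.zero_apply, zero_tmul]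
  | add x y hx hy => simp only [LinearMap.map_add, LinearEquiv.map_add, LinearMap.add_apply, hx, hy]
  | tmul x b =>
    induction r with
    | zero => simp only [LinearMap.map_zero, LinearEquiv.map_zero, LinearMap.zero_apply, zero_tmul]
    | add x y hx hy => simp only [LinearMap.map_add, LinearEquiv.map_add, hx, hy]
    | tmul y c => simp

lemma Colin.map {f : H →ₗ[ℂ] H'} {g : K →ₗ[ℂ] K'} (hf : Colin δH δH' f) (hg : Colin δK δK' g) :
    Colin (tensorCoact δH δK) (tensorCoact δH' δK') (TensorProduct.map f g) := fun v => by
  induction v with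
  | zero => simp only [LinearMap.map_zero, LinearEquiv.map_zero, LinearMap.zero_apply, zero_tmul]
  | add x y hx hy => simp only [LinearMap.map_add, LinearEquiv.map_add, hx, hy]
  | tmul x y =>
    rw [TensorProduct.map_tmul, tensorCoact_tmul, tensorCoact_tmul, hf, hg, rTensor_legMul]

lemma assoc_legMul (t : H ⊗[ℂ] B) (r : K ⊗[ℂ] B) (q : L ⊗[ℂ] B) :
    (TensorProduct.assoc ℂ H K L).toLinearMap.rTensor B (legMul B _ L (legMul B H K t r) q) =
      legMul B H _ t (legMul B K L r q) := by
  induction t with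
  | zero => simp only [LinearMap.map_zero, LinearEquiv.map_zero, LinearMap.zero_apply, zero_tmul]
  | add x y hx hy => simp only [LinearMap.map_add, LinearEquiv.map_add, LinearMap.add_apply, hx, hy]
  | tmul x b =>
    induction r with
    | zero => simp only [LinearMap.map_zero, LinearEquiv.map_zero, LinearMap.zero_apply, zero_tmul]
    | add x y hx hy => simp only [LinearMap.map_add, LinearEquiv.map_add, LinearMap.add_apply, hx, hy]
    | tmul y c =>
      induction q with
      | zero => simp only [LinearMap.map_zero, LinearEquiv.map_zero, LinearMap.zero_apply, zero_tmul]
      | add x y hx hy => simp only [LinearMap.map_add, LinearEquiv.map_add, hx, hy]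
      | tmul z d => simp [mul_assoc]

lemma tensorCoact_tmul_right (x : H) (q : K ⊗[ℂ] L) :
    tensorCoact δH (tensorCoact δK δL) (x ⊗ₜ q) = legMul B H _ (δH x) (tensorCoact δK δL q) := rfl

lemma Colin.assoc : Colin (tensorCoact (tensorCoact δH δK) δL) (tensorCoact δH (tensorCoact δK δL))
    (TensorProduct.assoc ℂ H K L).toLinearMap := fun v => by
  induction v with
  | zero => simp only [LinearMap.map_zero, LinearEquiv.map_zero, LinearMap.zero_apply, zero_tmul]
  | add x y hx hy => simp only [LinearMap.map_add, LinearEquiv.map_add, hx, hy]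
  | tmul x y =>
    induction x with
    | zero => simp only [LinearMap.map_zero, LinearEquiv.map_zero, LinearMap.zero_apply, zero_tmul]
    | add x z hx hy => simp only [add_tmul, LinearMap.map_add, LinearEquiv.map_add, hx, hy]
    | tmul x z =>
      rw [LinearEquiv.coe_coe, TensorProduct.assoc_tmul, tensorCoact_tmul, tensorCoact_tmul,
        tensorCoact_tmul, tensorCoact_tmul, assoc_legMul]

lemma Colin.symm {f : H →ₗ[ℂ] K} (hf : Colin δH δK f) {g : K →ₗ[ℂ] H} (h1 : ∀ x, g (f x) = x)
    (h2 : ∀ y, f (g y) = y) : Colin δK δH g := fun y => by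
  have h3 : g ∘ₗ f = LinearMap.id := LinearMap.ext h1
  conv_rhs => rw [← h2 y, hf, ← LinearMap.comp_apply, ← LinearMap.rTensor_comp, h3]
  simp

lemma Colin.proj {f : H →ₗ[ℂ] K} (hf : Colin δH δK f) (v : H) :
    coactProj δK (f v) = f (coactProj δH v) := proj_comm hf v

end Colin

lemma colin' {U V : UCorep B} (f : U ⟶ V) : Colin U.coact V.coact (lin f) := colin f

lemma incl_colin (U V : UCorep B) :
    Colin (tensor U V).coact (tensorCoact U.coact V.coact) (incl U V) := incl_coact U V

lemma proj_colin (U V : UCorep B) :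
    Colin (tensorCoact U.coact V.coact) (tensor U V).coact (proj U V) := coact_proj U V

/-- An isomorphism from mutually inverse linear maps, the first of which is colinear. -/
def isoMk {U V : UCorep B} (f : U.carrier →ₗ[ℂ] V.carrier) (g : V.carrier →ₗ[ℂ] U.carrier)
    (hf : Colin U.coact V.coact f) (h1 : ∀ x, g (f x) = x) (h2 : ∀ y, f (g y) = y) : U ≅ V where
  hom := homMk f hf
  inv := homMk g (hf.symm h1 h2)
  hom_inv_id := hom_ext (LinearMap.ext h1)
  inv_hom_id := hom_ext (LinearMap.ext h2)

/-- The tensor product of morphisms. -/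
def tensorMap {U V U' V' : UCorep B} (f : U ⟶ U') (g : V ⟶ V') : tensor U V ⟶ tensor U' V' :=
  homMk (proj U' V' ∘ₗ TensorProduct.map (lin f) (lin g) ∘ₗ incl U V)
    ((proj_colin U' V').comp (((colin' f).map (colin' g)).comp (incl_colin U V)))

lemma incl_mem (U V : UCorep B) (z : (tensor U V).carrier) :
    coactProj (tensorCoact U.coact V.coact) (incl U V z) = incl U V z := by
  rw [← incl_proj, proj_incl]

lemma incl_tensorMap {U V U' V' : UCorep B} (f : U ⟶ U') (g : V ⟶ V') (z : (tensor U V).carrier) :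
    incl U' V' (lin (tensorMap f g) z) = TensorProduct.map (lin f) (lin g) (incl U V z) := by
  change incl U' V' (proj U' V' (TensorProduct.map (lin f) (lin g) (incl U V z))) = _
  rw [incl_proj, ((colin' f).map (colin' g)).proj, incl_mem]

lemma lin_tensorMap_proj {U V U' V' : UCorep B} (f : U ⟶ U') (g : V ⟶ V')
    (t : U.carrier ⊗[ℂ] V.carrier) :
    lin (tensorMap f g) (proj U V t) = proj U' V' (TensorProduct.map (lin f) (lin g) t) := by
  apply incl_injective
  rw [incl_tensorMap, incl_proj, incl_proj, ((colin' f).map (colin' g)).proj]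

/-- `H_{(UV)W}` inside the full tensor product. -/
def inclL (U V W : UCorep B) :
    (tensor (tensor U V) W).carrier →ₗ[ℂ] (U.carrier ⊗[ℂ] V.carrier) ⊗[ℂ] W.carrier :=
  (incl U V).rTensor W.carrier ∘ₗ incl (tensor U V) W

/-- `H_{U(VW)}` inside the full tensor product. -/
def inclR (U V W : UCorep B) :
    (tensor U (tensor V W)).carrier →ₗ[ℂ] U.carrier ⊗[ℂ] (V.carrier ⊗[ℂ] W.carrier) :=
  (incl V W).lTensor U.carrier ∘ₗ incl U (tensor V W)

/-- The projection onto `H_{(UV)W}`. -/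
def projL (U V W : UCorep B) :
    (U.carrier ⊗[ℂ] V.carrier) ⊗[ℂ] W.carrier →ₗ[ℂ] (tensor (tensor U V) W).carrier :=
  proj (tensor U V) W ∘ₗ (proj U V).rTensor W.carrier

/-- The projection onto `H_{U(VW)}`. -/
def projR (U V W : UCorep B) :
    U.carrier ⊗[ℂ] (V.carrier ⊗[ℂ] W.carrier) →ₗ[ℂ] (tensor U (tensor V W)).carrier :=
  proj U (tensor V W) ∘ₗ (proj V W).lTensor U.carrier

lemma inclL_colin (U V W : UCorep B) : Colin (tensor (tensor U V) W).coact
    (tensorCoact (tensorCoact U.coact V.coact) W.coact) (inclL U V W) :=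
  ((incl_colin U V).map Colin.id).comp (incl_colin (tensor U V) W)

lemma inclR_colin (U V W : UCorep B) : Colin (tensor U (tensor V W)).coact
    (tensorCoact U.coact (tensorCoact V.coact W.coact)) (inclR U V W) :=
  (Colin.id.map (incl_colin V W)).comp (incl_colin U (tensor V W))

lemma projL_colin (U V W : UCorep B) :
    Colin (tensorCoact (tensorCoact U.coact V.coact) W.coact) (tensor (tensor U V) W).coact
      (projL U V W) :=
  (proj_colin (tensor U V) W).comp ((proj_colin U V).map Colin.id)

lemma projR_colin (U V W : UCorep B) :
    Colin (tensorCoact U.coact (tensorCoact V.coact W.coact)) (tensor U (tensor V W)).coact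
      (projR U V W) :=
  (proj_colin U (tensor V W)).comp (Colin.id.map (proj_colin V W))

lemma projL_inclL (U V W : UCorep B) (z) : projL U V W (inclL U V W z) = z := by
  have h : proj U V ∘ₗ incl U V = LinearMap.id := LinearMap.ext (proj_incl U V)
  change proj (tensor U V) W ((proj U V).rTensor W.carrier ((incl U V).rTensor W.carrier
    (incl (tensor U V) W z))) = z
  rw [← LinearMap.comp_apply (LinearMap.rTensor _ _), ← LinearMap.rTensor_comp, h,
    LinearMap.rTensor_id, LinearMap.id_apply, proj_incl]

lemma projR_inclR (U V W : UCorep B) (z) : projR U V W (inclR U V W z) = z := by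
  have h : proj V W ∘ₗ incl V W = LinearMap.id := LinearMap.ext (proj_incl V W)
  change proj U (tensor V W) ((proj V W).lTensor U.carrier ((incl V W).lTensor U.carrier
    (incl U (tensor V W) z))) = z
  rw [← LinearMap.comp_apply (LinearMap.lTensor _ _), ← LinearMap.lTensor_comp, h,
    LinearMap.lTensor_id, LinearMap.id_apply, proj_incl]

lemma inclL_injective (U V W : UCorep B) : Function.Injective (inclL U V W) :=
  Function.LeftInverse.injective (projL_inclL U V W)

lemma inclR_injective (U V W : UCorep B) : Function.Injective (inclR U V W) :=
  Function.LeftInverse.injective (projR_inclR U V W)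

lemma inclL_projL (U V W : UCorep B) (t) : inclL U V W (projL U V W t) =
    coactProj (tensorCoact (tensorCoact U.coact V.coact) W.coact) t := by
  change (incl U V).rTensor W.carrier (incl (tensor U V) W (proj (tensor U V) W
    ((proj U V).rTensor W.carrier t))) = _
  rw [incl_proj]
  have h := ((incl_colin U V).map (Colin.id (δH := W.coact))).proj ((proj U V).rTensor W.carrier t)
  refine h.symm.trans ?_
  clear h
  change coactProj _ ((incl U V).rTensor W.carrier ((proj U V).rTensor W.carrier t)) = _
  rw [← LinearMap.comp_apply (LinearMap.rTensor _ _), ← LinearMap.rTensor_comp]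
  refine congrArg (epsR B _) ?_
  induction t with
  | zero => simp only [LinearMap.map_zero, LinearEquiv.map_zero, LinearMap.zero_apply, zero_tmul]
  | add x y hx hy => simp only [LinearMap.map_add, LinearEquiv.map_add, hx, hy]
  | tmul x y =>
    rw [LinearMap.rTensor_tmul, tensorCoact_tmul, tensorCoact_tmul, LinearMap.comp_apply, incl_proj,
      (U.isUnitary.tensor V.isUnitary).coact_proj]

lemma inclR_projR (U V W : UCorep B) (t) : inclR U V W (projR U V W t) =
    coactProj (tensorCoact U.coact (tensorCoact V.coact W.coact)) t := by
  change (incl V W).lTensor U.carrier (incl U (tensor V W) (proj U (tensor V W)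
    ((proj V W).lTensor U.carrier t))) = _
  rw [incl_proj]
  have h := ((Colin.id (δH := U.coact)).map (incl_colin V W)).proj ((proj V W).lTensor U.carrier t)
  refine h.symm.trans ?_
  clear h
  change coactProj _ ((incl V W).lTensor U.carrier ((proj V W).lTensor U.carrier t)) = _
  rw [← LinearMap.comp_apply (LinearMap.lTensor _ _), ← LinearMap.lTensor_comp]
  refine congrArg (epsR B _) ?_
  induction t with
  | zero => simp only [LinearMap.map_zero, LinearEquiv.map_zero, LinearMap.zero_apply, zero_tmul]
  | add x y hx hy => simp only [LinearMap.map_add, LinearEquiv.map_add, hx, hy]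
  | tmul x y =>
    rw [LinearMap.lTensor_tmul, tensorCoact_tmul, tensorCoact_tmul, LinearMap.comp_apply, incl_proj,
      (V.isUnitary.tensor W.isUnitary).coact_proj]

/-- The underlying linear map of the associator. -/
def assocLin (U V W : UCorep B) :
    (tensor (tensor U V) W).carrier →ₗ[ℂ] (tensor U (tensor V W)).carrier :=
  projR U V W ∘ₗ (TensorProduct.assoc ℂ U.carrier V.carrier W.carrier).toLinearMap ∘ₗ inclL U V W

/-- The underlying linear map of the inverse associator. -/
def assocLinInv (U V W : UCorep B) :
    (tensor U (tensor V W)).carrier →ₗ[ℂ] (tensor (tensor U V) W).carrier :=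
  projL U V W ∘ₗ (TensorProduct.assoc ℂ U.carrier V.carrier W.carrier).symm.toLinearMap ∘ₗ
    inclR U V W

lemma inclR_assocLin (U V W : UCorep B) (z) : inclR U V W (assocLin U V W z) =
    TensorProduct.assoc ℂ U.carrier V.carrier W.carrier (inclL U V W z) := by
  change inclR U V W (projR U V W (TensorProduct.assoc ℂ _ _ _ (inclL U V W z))) = _
  rw [inclR_projR]
  have h := (Colin.assoc (δH := U.coact) (δK := V.coact) (δL := W.coact)).proj (inclL U V W z)
  rw [LinearEquiv.coe_coe] at h
  rw [h, (inclL_colin U V W).proj, proj_eq]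

lemma inclL_assocLinInv (U V W : UCorep B) (z) : inclL U V W (assocLinInv U V W z) =
    (TensorProduct.assoc ℂ U.carrier V.carrier W.carrier).symm (inclR U V W z) := by
  change inclL U V W (projL U V W ((TensorProduct.assoc ℂ _ _ _).symm (inclR U V W z))) = _
  rw [inclL_projL]
  have h := ((Colin.assoc (δH := U.coact) (δK := V.coact) (δL := W.coact)).symm
    (g := (TensorProduct.assoc ℂ U.carrier V.carrier W.carrier).symm.toLinearMap)
    (by simp) (by simp)).proj (inclR U V W z)
  rw [LinearEquiv.coe_coe] at h
  rw [h, (inclR_colin U V W).proj, proj_eq]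

/-- The associator: the restriction of the associator of the full tensor products. -/
def assoc (U V W : UCorep B) : tensor (tensor U V) W ≅ tensor U (tensor V W) :=
  isoMk (assocLin U V W) (assocLinInv U V W)
    ((projR_colin U V W).comp (Colin.assoc.comp (inclL_colin U V W)))
    (fun x => inclL_injective U V W (by rw [inclL_assocLinInv, inclR_assocLin]; simp))
    (fun x => inclR_injective U V W (by rw [inclR_assocLin, inclL_assocLinInv]; simp))

end UCorep

section Unit

variable (B : Type u) [CStarAlgebra B] [WeakHopfCStarAlgebra B]

local notation "Δ" => (CoalgebraStruct.comul : B →ₗ[ℂ] B ⊗[ℂ] B)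
local notation "ε" => (CoalgebraStruct.counit : B →ₗ[ℂ] ℂ)
local notation "S" => (antipode : B →ₗ[ℂ] B)

/-- The source counital subalgebra `B_s` as a vector space; it carries the scalar product
`⟨z, t⟩ = ε(t*z)`, not the norm of `B`. -/
def SourceSpace : Type u := source B

instance : AddCommGroup (SourceSpace B) := inferInstanceAs (AddCommGroup (source B))
instance : Module ℂ (SourceSpace B) := inferInstanceAs (Module ℂ (source B))
instance : FiniteDimensional ℂ (SourceSpace B) :=
  inferInstanceAs (FiniteDimensional ℂ (source B))

namespace SourceSpace

/-- The inclusion of `B_s` into `B`. -/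
def val : SourceSpace B →ₗ[ℂ] B := (source B).subtype

/-- The map `ε_s : B → B_s`. -/
def ofB : B →ₗ[ℂ] SourceSpace B := (sourceCounital : B →ₗ[ℂ] B).rangeRestrict

/-- The unit of `B_s`. -/
def one : SourceSpace B := ⟨1, one_mem_source⟩

variable {B}

lemma val_mem (z : SourceSpace B) : val B z ∈ source B := Subtype.property z

lemma val_injective : Function.Injective (val B) := Subtype.val_injective

lemma val_one : val B (one B) = 1 := rfl

lemma val_ofB (b : B) : val B (ofB B b) = sourceCounital b := rfl

lemma ofB_val (z : SourceSpace B) : ofB B (val B z) = z :=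
  val_injective (source_apply_self z.2)

variable [IsRegularQuantumGroupoid B]

variable (B) in
/-- The scalar product `⟨z, t⟩ = ε(t*z)`, in Mathlib's convention linear in the second variable. -/
abbrev core : InnerProductSpace.Core ℂ (SourceSpace B) where
  inner t z := ε (star (val B t) * val B z)
  conj_inner_symm x y := by rw [← counit_star]; simp
  re_inner_nonneg x := (counit_star_mul_self (x : source B)).1
  add_left x y z := by simp [add_mul]
  smul_left x y r := by simp
  definite x h := (counit_star_mul_self (x : source B)).2 h

instance : NormedAddCommGroup (SourceSpace B) := (core B).toNormedAddCommGroup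
instance : InnerProductSpace ℂ (SourceSpace B) := InnerProductSpace.ofCore (core B).toCore

lemma inner_def (t z : SourceSpace B) : inner ℂ t z = ε (star (val B t) * val B z) := rfl

end SourceSpace

/-- The regular coaction `z ↦ Δ(z)` on `B_s`. -/
def sourceCoact : SourceSpace B →ₗ[ℂ] SourceSpace B ⊗[ℂ] B :=
  (SourceSpace.ofB B).rTensor B ∘ₗ Δ ∘ₗ SourceSpace.val B

variable {B}

lemma val_sourceCoact (z : SourceSpace B) :
    (SourceSpace.val B).rTensor B (sourceCoact B z) = Δ (SourceSpace.val B z) := by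
  rw [sourceCoact, LinearMap.comp_apply, ← LinearMap.comp_apply (LinearMap.rTensor _ _),
    ← LinearMap.rTensor_comp]
  change (sourceCounital).rTensor B (Δ (SourceSpace.val B z)) = _
  rw [comul_of_mem' z.val_mem]
  have (t : B ⊗[ℂ] B) (b : B) : sourceCounital.rTensor B (t * 1 ⊗ₜ b) =
      sourceCounital.rTensor B t * 1 ⊗ₜ b := by
    induction t with
    | zero => simp
    | add x y hx hy => simp only [add_mul, LinearMap.map_add, hx, hy]
    | tmul x y => simp
  rw [this, source_rTensor_comul_one]

lemma epsR_sourceCoact (z : SourceSpace B) : epsR B _ (sourceCoact B z) = z := by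
  apply SourceSpace.val_injective
  rw [← epsR_rTensor, val_sourceCoact, epsR_comul]

lemma rTensor_val_injective (C : Type u) [AddCommGroup C] [Module ℂ C] :
    Function.Injective ((SourceSpace.val B).rTensor C) := by
  refine Function.LeftInverse.injective (g := (SourceSpace.ofB B).rTensor C) fun x => ?_
  have h : SourceSpace.ofB B ∘ₗ SourceSpace.val B = LinearMap.id :=
    LinearMap.ext SourceSpace.ofB_val
  rw [← LinearMap.comp_apply, ← LinearMap.rTensor_comp, h, LinearMap.rTensor_id,
    LinearMap.id_apply]

lemma star_antipode_eq {w : B} (hw : w ∈ source B) {s : Finset (B × B)}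
    (hs : Δ 1 = ∑ i ∈ s, i.1 ⊗ₜ[ℂ] i.2) : star (S w) = ∑ i ∈ s, ε (star w * i.1) • i.2 := by
  have h2 := congrArg (TensorProduct.lid ℂ B ∘
    (ε ∘ₗ LinearMap.mulLeft ℂ (star w)).rTensor B) (hs.symm.trans (star_sum_comul_one hs))
  simp [map_sum] at h2
  rw [← target_eq_antipode hw, target_apply hs, h2, star_sum]
  simp [← counit_star]

lemma antipode_star_antipode {w : B} (hw : w ∈ source B) : S (star (S w)) = star w := by
  obtain ⟨s, hs⟩ := TensorProduct.exists_finset (Δ 1)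
  rw [star_antipode_eq hw hs, map_sum]
  simp only [map_smul]
  exact antipode_leg (star_mem_source hw) hs

lemma mul_star_antipode {v w : B} (hv : v ∈ source B) (hw : w ∈ source B) :
    v * star (S w) = star (S w) * v := by
  obtain ⟨s, hs⟩ := TensorProduct.exists_finset (Δ 1)
  have h := tmul_comm_comul_one hv
  rw [hs] at h
  have h2 := congrArg (TensorProduct.lid ℂ B ∘
    (ε ∘ₗ LinearMap.mulLeft ℂ (star w)).rTensor B) h
  simp [map_sum, Finset.mul_sum, Finset.sum_mul] at h2
  rw [star_antipode_eq hw hs]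
  simpa [Finset.mul_sum, Finset.sum_mul] using h2

lemma innerSlice_sourceCoact [IsRegularQuantumGroupoid B] (v w : SourceSpace B) :
    innerSlice w (sourceCoact B v) =
      SourceSpace.val B v * star (S (SourceSpace.val B w)) := by
  have h1 (t : SourceSpace B ⊗[ℂ] B) : innerSlice w t =
      TensorProduct.lid ℂ B ((ε ∘ₗ LinearMap.mulLeft ℂ (star (SourceSpace.val B w))).rTensor B
        ((SourceSpace.val B).rTensor B t)) := by
    induction t with
    | zero => simp only [LinearMap.map_zero, LinearEquiv.map_zero, LinearMap.zero_apply, zero_tmul]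
    | add x y hx hy => simp only [LinearMap.map_add, LinearEquiv.map_add, hx, hy]
    | tmul x y => simp [SourceSpace.inner_def]
  rw [h1, val_sourceCoact, comul_of_mem v.val_mem]
  obtain ⟨s, hs⟩ := TensorProduct.exists_finset (Δ 1)
  rw [star_antipode_eq w.val_mem hs, hs]
  simp [map_sum, Finset.mul_sum]

lemma sourceCoact_isUnitary [IsRegularQuantumGroupoid B] : IsUnitaryCoaction (sourceCoact B) where
  coassoc z := by
    apply rTensor_val_injective
    have h1 (t : SourceSpace B ⊗[ℂ] B) : (SourceSpace.val B).rTensor (B ⊗[ℂ] B)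
        (TensorProduct.assoc ℂ _ B B ((sourceCoact B).rTensor B t)) =
        TensorProduct.assoc ℂ _ B B ((Δ).rTensor B ((SourceSpace.val B).rTensor B t)) := by
      induction t with
      | zero => simp only [LinearMap.map_zero, LinearEquiv.map_zero, LinearMap.zero_apply, zero_tmul]
      | add x y hx hy => simp only [LinearMap.map_add, LinearEquiv.map_add, hx, hy]
      | tmul x y =>
        simp only [LinearMap.rTensor_tmul]
        rw [← val_sourceCoact]
        generalize sourceCoact B x = q
        induction q with
        | zero => simp only [LinearMap.map_zero, LinearEquiv.map_zero, LinearMap.zero_apply, zero_tmul]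
        | add x y hx hy => simp only [LinearMap.map_add, LinearEquiv.map_add, add_tmul, hx, hy]
        | tmul x y => simp
    have h2 (t : SourceSpace B ⊗[ℂ] B) : (SourceSpace.val B).rTensor (B ⊗[ℂ] B)
        ((Δ).lTensor _ t) = (Δ).lTensor B ((SourceSpace.val B).rTensor B t) := by
      induction t with
      | zero => simp only [LinearMap.map_zero, LinearEquiv.map_zero, LinearMap.zero_apply, zero_tmul]
      | add x y hx hy => simp only [LinearMap.map_add, LinearEquiv.map_add, hx, hy]
      | tmul x y => simp
    rw [h1, h2, val_sourceCoact, Coalgebra.coassoc_apply]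
  unitary v w := by
    rw [innerSlice_sourceCoact, innerSlice_sourceCoact, antipode_mul, star_mul,
      antipode_star_antipode v.val_mem, star_star, mul_star_antipode v.val_mem w.val_mem]

end Unit

namespace UCorep

variable {B : Type u} [CStarAlgebra B] [WeakHopfCStarAlgebra B]

local notation "Δ" => (CoalgebraStruct.comul : B →ₗ[ℂ] B ⊗[ℂ] B)
local notation "ε" => (CoalgebraStruct.counit : B →ₗ[ℂ] ℂ)

variable (B) in
/-- The trivial corepresentation, on `B_s`. -/
def unit [IsRegularQuantumGroupoid B] : UCorep B where
  carrier := SourceSpace B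
  coact := sourceCoact B
  isUnitary := sourceCoact_isUnitary
  counit := epsR_sourceCoact

/-- `v·z = v¹ ε(v² z)` -/
def rAct (U : UCorep B) (v : U.carrier) (z : B) : U.carrier :=
  epsR B _ ((LinearMap.mulRight ℂ z).lTensor _ (U.coact v))

/-- `z·v = v¹ ε(z v²)` -/
def lAct (U : UCorep B) (z : B) (v : U.carrier) : U.carrier :=
  epsR B _ ((LinearMap.mulLeft ℂ z).lTensor _ (U.coact v))

lemma epsR_mulRight {z : B} (hz : z ∈ source B) (b : B) :
    (epsR B B) ((LinearMap.mulRight ℂ z).lTensor B (Δ b)) = b * z := by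
  have h : (LinearMap.mulRight ℂ z).lTensor B (Δ b) = Δ (b * z) := by
    rw [comul_mul, comul_of_mem' hz, ← mul_assoc, comul_mul_one]
    generalize Δ b = t
    induction t with
    | zero => simp
    | add x y hx hy => simp only [LinearMap.map_add, LinearEquiv.map_add, hx, hy, add_mul]
    | tmul x y => simp
  rw [h, epsR_comul]

lemma epsR_mulLeft {z : B} (hz : z ∈ source B) (b : B) :
    (epsR B B) ((LinearMap.mulLeft ℂ z).lTensor B (Δ b)) = z * b := by
  have h : (LinearMap.mulLeft ℂ z).lTensor B (Δ b) = Δ (z * b) := by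
    rw [comul_mul, comul_of_mem hz, mul_assoc, comul_one_mul]
    generalize Δ b = t
    induction t with
    | zero => simp
    | add x y hx hy => simp only [LinearMap.map_add, LinearEquiv.map_add, hx, hy, mul_add]
    | tmul x y => simp
  rw [h, epsR_comul]

lemma coact_act_aux (U : UCorep B) (f g : B →ₗ[ℂ] B)
    (hfg : ∀ b, epsR B B (f.lTensor B (Δ b)) = g b) (v : U.carrier) :
    U.coact (epsR B _ (f.lTensor _ (U.coact v))) = g.lTensor _ (U.coact v) := by
  have h1 (t : U.carrier ⊗[ℂ] B) : U.coact (epsR B _ (f.lTensor _ t)) =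
      (epsR B B ∘ₗ f.lTensor B).lTensor U.carrier
        (TensorProduct.assoc ℂ _ B B (U.coact.rTensor B t)) := by
    induction t with
    | zero => simp only [LinearMap.map_zero, LinearEquiv.map_zero, LinearMap.zero_apply, zero_tmul]
    | add x y hx hy => simp only [LinearMap.map_add, LinearEquiv.map_add, hx, hy]
    | tmul x y =>
      simp only [LinearMap.lTensor_tmul, LinearMap.rTensor_tmul, LinearMap.comp_apply,
        LinearEquiv.coe_coe, TensorProduct.rid_tmul, map_smul]
      generalize U.coact x = q
      induction q with
      | zero => simp
      | add x y hx hy => simp only [LinearMap.map_add, LinearEquiv.map_add, smul_add, add_tmul, hx, hy]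
      | tmul x y => simp
  have h2 : (epsR B B ∘ₗ f.lTensor B) ∘ₗ Δ = g := LinearMap.ext hfg
  rw [h1, U.isUnitary.coassoc, ← LinearMap.comp_apply, ← LinearMap.lTensor_comp, h2]

lemma coact_rAct (U : UCorep B) (v : U.carrier) {z : B} (hz : z ∈ source B) :
    U.coact (rAct U v z) = (LinearMap.mulRight ℂ z).lTensor _ (U.coact v) :=
  coact_act_aux U _ _ (epsR_mulRight hz) v

lemma coact_lAct (U : UCorep B) (v : U.carrier) {z : B} (hz : z ∈ source B) :
    U.coact (lAct U z v) = (LinearMap.mulLeft ℂ z).lTensor _ (U.coact v) :=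
  coact_act_aux U _ _ (epsR_mulLeft hz) v

lemma legMul_balanced {H K : Type u} [AddCommGroup H] [Module ℂ H] [AddCommGroup K] [Module ℂ K]
    (z : B) (t : H ⊗[ℂ] B) (r : K ⊗[ℂ] B) :
    legMul B H K ((LinearMap.mulRight ℂ z).lTensor _ t) r =
      legMul B H K t ((LinearMap.mulLeft ℂ z).lTensor _ r) := by
  induction t with
  | zero => simp only [LinearMap.map_zero, LinearEquiv.map_zero, LinearMap.zero_apply, zero_tmul]
  | add x y hx hy => simp only [LinearMap.map_add, LinearEquiv.map_add, LinearMap.add_apply, hx, hy]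
  | tmul x b =>
    induction r with
    | zero => simp only [LinearMap.map_zero, LinearEquiv.map_zero, LinearMap.zero_apply, zero_tmul]
    | add x y hx hy => simp only [LinearMap.map_add, LinearEquiv.map_add, hx, hy]
    | tmul y c => simp [mul_assoc]

/-- The defining property of `⊗_{B_s}`. -/
lemma proj_balanced (U V : UCorep B) (v : U.carrier) (w : V.carrier) {z : B} (hz : z ∈ source B) :
    proj U V (rAct U v z ⊗ₜ w) = proj U V (v ⊗ₜ lAct V z w) := by
  apply incl_injective
  rw [incl_proj, incl_proj]
  refine congrArg (epsR B _) ?_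
  rw [tensorCoact_tmul, tensorCoact_tmul, coact_rAct U v hz, coact_lAct V w hz, legMul_balanced]

/-- `v ⊗ z ↦ v¹ ε(v² z)` on `H_U ⊗ B_s` -/
def rActLin (U : UCorep B) : U.carrier ⊗[ℂ] SourceSpace B →ₗ[ℂ] U.carrier :=
  TensorProduct.lift (LinearMap.mk₂ ℂ (fun v z => rAct U v (SourceSpace.val B z))
    (fun v v' z => by simp [rAct]) (fun c v z => by simp [rAct])
    (fun v z z' => by
      have : LinearMap.mulRight ℂ (SourceSpace.val B z + SourceSpace.val B z') =
        LinearMap.mulRight ℂ (SourceSpace.val B z) +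
        LinearMap.mulRight ℂ (SourceSpace.val B z') := by ext; simp [mul_add]
      simp only [rAct, map_add, this, LinearMap.lTensor_add, LinearMap.add_apply])
    (fun c v z => by
      have : LinearMap.mulRight ℂ (c • SourceSpace.val B z) =
        c • LinearMap.mulRight ℂ (SourceSpace.val B z) := by ext; simp
      simp only [rAct, map_smul, this, LinearMap.lTensor_smul, LinearMap.smul_apply]))

/-- `z ⊗ v ↦ v¹ ε(z v²)` on `B_s ⊗ H_U` -/
def lActLin (U : UCorep B) : SourceSpace B ⊗[ℂ] U.carrier →ₗ[ℂ] U.carrier :=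
  TensorProduct.lift (LinearMap.mk₂ ℂ (fun z v => lAct U (SourceSpace.val B z) v)
    (fun z z' v => by
      have : LinearMap.mulLeft ℂ (SourceSpace.val B z + SourceSpace.val B z') =
        LinearMap.mulLeft ℂ (SourceSpace.val B z) +
        LinearMap.mulLeft ℂ (SourceSpace.val B z') := by ext; simp [add_mul]
      simp only [lAct, map_add, this, LinearMap.lTensor_add, LinearMap.add_apply])
    (fun c z v => by
      have : LinearMap.mulLeft ℂ (c • SourceSpace.val B z) =
        c • LinearMap.mulLeft ℂ (SourceSpace.val B z) := by ext; simp
      simp only [lAct, map_smul, this, LinearMap.lTensor_smul, LinearMap.smul_apply])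
    (fun z v v' => by simp [lAct]) (fun c v z => by simp [lAct]))

variable [IsRegularQuantumGroupoid B]

lemma rActLin_tmul (U : UCorep B) (v : U.carrier) (z : SourceSpace B) :
    rActLin U (v ⊗ₜ z) = rAct U v (SourceSpace.val B z) := rfl

lemma lActLin_tmul (U : UCorep B) (v : U.carrier) (z : SourceSpace B) :
    lActLin U (z ⊗ₜ v) = lAct U (SourceSpace.val B z) v := rfl

lemma rActLin_legMul (U : UCorep B) (t : U.carrier ⊗[ℂ] B) (r : SourceSpace B ⊗[ℂ] B) :
    (rActLin U).rTensor B (legMul B _ _ t r) =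
      ((TensorProduct.lid ℂ B).toLinearMap ∘ₗ (ε).rTensor B ∘ₗ
        LinearMap.mulRight ℂ ((SourceSpace.val B).rTensor B r)).lTensor _
        (TensorProduct.assoc ℂ _ B B (U.coact.rTensor B t)) := by
  induction t with
  | zero => simp only [LinearMap.map_zero, LinearEquiv.map_zero, LinearMap.zero_apply, zero_tmul]
  | add x y hx hy => simp only [LinearMap.map_add, LinearEquiv.map_add, LinearMap.add_apply, hx, hy]
  | tmul x b =>
    induction r with
    | zero =>
      simp
    | add x y hx hy =>
      have (a b : B ⊗[ℂ] B) : LinearMap.mulRight ℂ (a + b) =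
        LinearMap.mulRight ℂ a + LinearMap.mulRight ℂ b := by ext; simp [mul_add]
      simp only [LinearMap.map_add, LinearEquiv.map_add, hx, hy, this, LinearMap.comp_add, LinearMap.lTensor_add,
        LinearMap.add_apply]
    | tmul z c =>
      simp only [legMul_tmul, LinearMap.rTensor_tmul, rActLin_tmul, rAct]
      generalize U.coact x = q
      induction q with
      | zero => simp only [LinearMap.map_zero, LinearEquiv.map_zero, LinearMap.zero_apply, zero_tmul]
      | add x y hx hy => simp only [LinearMap.map_add, LinearEquiv.map_add, add_tmul, hx, hy]
      | tmul x y => simp [smul_tmul', tmul_smul]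

lemma lActLin_legMul (U : UCorep B) (t : U.carrier ⊗[ℂ] B) (r : SourceSpace B ⊗[ℂ] B) :
    (lActLin U).rTensor B (legMul B _ _ r t) =
      ((TensorProduct.lid ℂ B).toLinearMap ∘ₗ (ε).rTensor B ∘ₗ
        LinearMap.mulLeft ℂ ((SourceSpace.val B).rTensor B r)).lTensor _
        (TensorProduct.assoc ℂ _ B B (U.coact.rTensor B t)) := by
  induction t with
  | zero => simp only [LinearMap.map_zero, LinearEquiv.map_zero, LinearMap.zero_apply, zero_tmul]
  | add x y hx hy => simp only [LinearMap.map_add, LinearEquiv.map_add, hx, hy]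
  | tmul x b =>
    induction r with
    | zero => simp
    | add x y hx hy =>
      have (a b : B ⊗[ℂ] B) : LinearMap.mulLeft ℂ (a + b) =
        LinearMap.mulLeft ℂ a + LinearMap.mulLeft ℂ b := by ext; simp [add_mul]
      simp only [LinearMap.map_add, LinearEquiv.map_add, LinearMap.add_apply, hx, hy, this, LinearMap.comp_add,
        LinearMap.lTensor_add]
    | tmul z c =>
      simp only [legMul_tmul, LinearMap.rTensor_tmul, lActLin_tmul, lAct]
      generalize U.coact x = q
      induction q with
      | zero => simp only [LinearMap.map_zero, LinearEquiv.map_zero, LinearMap.zero_apply, zero_tmul]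
      | add x y hx hy => simp only [LinearMap.map_add, LinearEquiv.map_add, add_tmul, hx, hy]
      | tmul x y => simp [smul_tmul', tmul_smul]

lemma rActLin_colin (U : UCorep B) :
    Colin (tensorCoact U.coact (sourceCoact B)) U.coact (rActLin U) := fun t => by
  induction t with
  | zero => simp only [LinearMap.map_zero, LinearEquiv.map_zero, LinearMap.zero_apply, zero_tmul]
  | add x y hx hy => simp only [LinearMap.map_add, LinearEquiv.map_add, hx, hy]
  | tmul v z =>
    have h : ((TensorProduct.lid ℂ B).toLinearMap ∘ₗ (ε).rTensor B ∘ₗ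
        LinearMap.mulRight ℂ ((SourceSpace.val B).rTensor B (sourceCoact B z))) ∘ₗ Δ =
        LinearMap.mulRight ℂ (SourceSpace.val B z) := LinearMap.ext fun b => by
      simp only [LinearMap.comp_apply, LinearMap.mulRight_apply, val_sourceCoact, ← comul_mul,
        LinearEquiv.coe_coe, epsL_comul]
    rw [rActLin_tmul, tensorCoact_tmul, rActLin_legMul, coact_rAct U v z.val_mem,
      U.isUnitary.coassoc, ← h, LinearMap.lTensor_comp, LinearMap.comp_apply]

lemma lActLin_colin (U : UCorep B) :
    Colin (tensorCoact (sourceCoact B) U.coact) U.coact (lActLin U) := fun t => by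
  induction t with
  | zero => simp only [LinearMap.map_zero, LinearEquiv.map_zero, LinearMap.zero_apply, zero_tmul]
  | add x y hx hy => simp only [LinearMap.map_add, LinearEquiv.map_add, hx, hy]
  | tmul z v =>
    have h : ((TensorProduct.lid ℂ B).toLinearMap ∘ₗ (ε).rTensor B ∘ₗ
        LinearMap.mulLeft ℂ ((SourceSpace.val B).rTensor B (sourceCoact B z))) ∘ₗ Δ =
        LinearMap.mulLeft ℂ (SourceSpace.val B z) := LinearMap.ext fun b => by
      simp only [LinearMap.comp_apply, LinearMap.mulLeft_apply, val_sourceCoact, ← comul_mul,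
        LinearEquiv.coe_coe, epsL_comul]
    rw [lActLin_tmul, tensorCoact_tmul, lActLin_legMul, coact_lAct U v z.val_mem,
      U.isUnitary.coassoc, ← h, LinearMap.lTensor_comp, LinearMap.comp_apply]

lemma rAct_one (U : UCorep B) (v : U.carrier) : rAct U v 1 = v := by
  have : LinearMap.mulRight ℂ (1 : B) = LinearMap.id := by ext; simp
  rw [rAct, this, LinearMap.lTensor_id, LinearMap.id_apply, U.counit]

lemma lAct_one (U : UCorep B) (v : U.carrier) : lAct U 1 v = v := by
  have : LinearMap.mulLeft ℂ (1 : B) = LinearMap.id := by ext; simp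
  rw [lAct, this, LinearMap.lTensor_id, LinearMap.id_apply, U.counit]

lemma rAct_unit (z : SourceSpace B) :
    rAct (unit B) (SourceSpace.one B) (SourceSpace.val B z) = z := by
  apply SourceSpace.val_injective
  change SourceSpace.val B (epsR B _ ((LinearMap.mulRight ℂ (SourceSpace.val B z)).lTensor _
    (sourceCoact B (SourceSpace.one B)))) = _
  rw [← epsR_rTensor, ← LinearMap.comp_apply (LinearMap.rTensor _ _),
    LinearMap.rTensor_comp_lTensor, ← LinearMap.lTensor_comp_rTensor,
    LinearMap.comp_apply (LinearMap.lTensor _ _), val_sourceCoact, epsR_mulRight z.val_mem, SourceSpace.val_one, one_mul]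

lemma lAct_unit (z : SourceSpace B) :
    lAct (unit B) (SourceSpace.val B z) (SourceSpace.one B) = z := by
  apply SourceSpace.val_injective
  change SourceSpace.val B (epsR B _ ((LinearMap.mulLeft ℂ (SourceSpace.val B z)).lTensor _
    (sourceCoact B (SourceSpace.one B)))) = _
  rw [← epsR_rTensor, ← LinearMap.comp_apply (LinearMap.rTensor _ _),
    LinearMap.rTensor_comp_lTensor, ← LinearMap.lTensor_comp_rTensor,
    LinearMap.comp_apply (LinearMap.lTensor _ _), val_sourceCoact, epsR_mulLeft z.val_mem, SourceSpace.val_one, mul_one]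

variable (B) in
/-- The unit element of `B_s` in the space of the trivial corepresentation. -/
def unitOne : (unit B).carrier := SourceSpace.one B

/-- The right action on the space of a corepresentation. -/
def rAct' (U : UCorep B) : U.carrier ⊗[ℂ] (unit B).carrier →ₗ[ℂ] U.carrier := rActLin U

/-- The left action on the space of a corepresentation. -/
def lAct' (U : UCorep B) : (unit B).carrier ⊗[ℂ] U.carrier →ₗ[ℂ] U.carrier := lActLin U

lemma rAct'_colin (U : UCorep B) : Colin (tensorCoact U.coact (unit B).coact) U.coact (rAct' U) :=
  rActLin_colin U

lemma lAct'_colin (U : UCorep B) : Colin (tensorCoact (unit B).coact U.coact) U.coact (lAct' U) :=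
  lActLin_colin U

lemma rAct'_coactProj (U : UCorep B) (t) :
    rAct' U (coactProj (tensorCoact U.coact (unit B).coact) t) = rAct' U t := by
  rw [← (rAct'_colin U).proj t, proj_eq]

lemma lAct'_coactProj (U : UCorep B) (t) :
    lAct' U (coactProj (tensorCoact (unit B).coact U.coact) t) = lAct' U t := by
  rw [← (lAct'_colin U).proj t, proj_eq]

lemma proj_balanced' (U V : UCorep B) (t : (U.carrier ⊗[ℂ] (unit B).carrier) ⊗[ℂ] V.carrier) :
    proj U V ((rAct' U).rTensor _ t) =
      proj U V ((lAct' V).lTensor _ (TensorProduct.assoc ℂ _ _ _ t)) := by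
  induction t with
  | zero => simp only [LinearMap.map_zero, LinearEquiv.map_zero, LinearMap.zero_apply, zero_tmul]
  | add x y hx hy => simp only [LinearMap.map_add, LinearEquiv.map_add, hx, hy]
  | tmul x w =>
    induction x with
    | zero => simp only [LinearMap.map_zero, LinearEquiv.map_zero, LinearMap.zero_apply, zero_tmul]
    | add x y hx hy => simp only [LinearMap.map_add, LinearEquiv.map_add, add_tmul, hx, hy]
    | tmul v z => exact proj_balanced U V v w (SourceSpace.val_mem z)

lemma lAct'_one (z : (unit B).carrier) : lAct' (unit B) (z ⊗ₜ unitOne B) = z := lAct_unit z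

lemma rAct'_one (z : (unit B).carrier) : rAct' (unit B) (unitOne B ⊗ₜ z) = z := rAct_unit z

lemma proj_rAct' (U : UCorep B) (t : U.carrier ⊗[ℂ] (unit B).carrier) :
    proj U (unit B) (rAct' U t ⊗ₜ unitOne B) = proj U (unit B) t := by
  have h := proj_balanced' U (unit B) (t ⊗ₜ unitOne B)
  rw [LinearMap.rTensor_tmul] at h
  rw [h]
  congr 1
  induction t with
  | zero => simp only [LinearMap.map_zero, LinearEquiv.map_zero, LinearMap.zero_apply, zero_tmul]
  | add x y hx hy =>
    rw [add_tmul, map_add, map_add, hx (by simpa using proj_balanced' U (unit B) (x ⊗ₜ unitOne B)),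
      hy (by simpa using proj_balanced' U (unit B) (y ⊗ₜ unitOne B))]
  | tmul v z => rw [TensorProduct.assoc_tmul, LinearMap.lTensor_tmul, lAct'_one]

lemma proj_lAct' (U : UCorep B) (t : (unit B).carrier ⊗[ℂ] U.carrier) :
    proj (unit B) U (unitOne B ⊗ₜ lAct' U t) = proj (unit B) U t := by
  have h := proj_balanced' (unit B) U ((TensorProduct.assoc ℂ _ _ _).symm (unitOne B ⊗ₜ t))
  rw [LinearEquiv.apply_symm_apply, LinearMap.lTensor_tmul] at h
  rw [← h]
  clear h
  congr 1
  induction t with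
  | zero => simp
  | add x y hx hy => rw [tmul_add, map_add, map_add, hx, hy]
  | tmul z v => rw [TensorProduct.assoc_symm_tmul, LinearMap.rTensor_tmul, rAct'_one]

/-- The right unitor `v ⊗ z ↦ v¹ ε(v² z)`. -/
def rightUnit (U : UCorep B) : tensor U (unit B) ≅ U :=
  isoMk (rAct' U ∘ₗ incl U (unit B))
    (proj U (unit B) ∘ₗ (TensorProduct.mk ℂ U.carrier (unit B).carrier).flip (unitOne B))
    ((rAct'_colin U).comp (incl_colin U (unit B)))
    (fun x => (proj_rAct' U (incl U (unit B) x)).trans (proj_incl U (unit B) x))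
    (fun v => by
      change rAct' U (incl U (unit B) (proj U (unit B) (v ⊗ₜ unitOne B))) = v
      rw [incl_proj, rAct'_coactProj]
      exact rAct_one U v)

/-- The left unitor `z ⊗ v ↦ v¹ ε(z v²)`. -/
def leftUnit (U : UCorep B) : tensor (unit B) U ≅ U :=
  isoMk (lAct' U ∘ₗ incl (unit B) U)
    (proj (unit B) U ∘ₗ TensorProduct.mk ℂ (unit B).carrier U.carrier (unitOne B))
    ((lAct'_colin U).comp (incl_colin (unit B) U))
    (fun x => (proj_lAct' U (incl (unit B) U x)).trans (proj_incl (unit B) U x))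
    (fun v => by
      change lAct' U (incl (unit B) U (proj (unit B) U (unitOne B ⊗ₜ v))) = v
      rw [incl_proj, lAct'_coactProj]
      exact lAct_one U v)

lemma lin_rightUnit (U : UCorep B) (x) :
    lin (rightUnit U).hom x = rAct' U (incl U (unit B) x) := rfl

lemma lin_leftUnit (U : UCorep B) (x) :
    lin (leftUnit U).hom x = lAct' U (incl (unit B) U x) := rfl

lemma rAct'_nat {U V : UCorep B} (f : U ⟶ V) (t : U.carrier ⊗[ℂ] (unit B).carrier) :
    rAct' V (TensorProduct.map (lin f) LinearMap.id t) = lin f (rAct' U t) := by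
  induction t with
  | zero => simp only [LinearMap.map_zero, LinearEquiv.map_zero, LinearMap.zero_apply, zero_tmul]
  | add x y hx hy => simp only [LinearMap.map_add, LinearEquiv.map_add, hx, hy]
  | tmul v z =>
    change epsR B _ ((LinearMap.mulRight ℂ (SourceSpace.val B z)).lTensor _ (V.coact (lin f v))) =
      lin f (epsR B _ ((LinearMap.mulRight ℂ (SourceSpace.val B z)).lTensor _ (U.coact v)))
    rw [colin, ← epsR_rTensor, ← LinearMap.comp_apply (LinearMap.lTensor _ _),
      ← LinearMap.comp_apply (LinearMap.rTensor _ _), LinearMap.lTensor_comp_rTensor,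
      LinearMap.rTensor_comp_lTensor]

lemma lAct'_nat {U V : UCorep B} (f : U ⟶ V) (t : (unit B).carrier ⊗[ℂ] U.carrier) :
    lAct' V (TensorProduct.map LinearMap.id (lin f) t) = lin f (lAct' U t) := by
  induction t with
  | zero => simp only [LinearMap.map_zero, LinearEquiv.map_zero, LinearMap.zero_apply, zero_tmul]
  | add x y hx hy => simp only [LinearMap.map_add, LinearEquiv.map_add, hx, hy]
  | tmul z v =>
    change epsR B _ ((LinearMap.mulLeft ℂ (SourceSpace.val B z)).lTensor _ (V.coact (lin f v))) =
      lin f (epsR B _ ((LinearMap.mulLeft ℂ (SourceSpace.val B z)).lTensor _ (U.coact v)))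
    rw [colin, ← epsR_rTensor, ← LinearMap.comp_apply (LinearMap.lTensor _ _),
      ← LinearMap.comp_apply (LinearMap.rTensor _ _), LinearMap.lTensor_comp_rTensor,
      LinearMap.rTensor_comp_lTensor]

end UCorep

namespace UCorep

variable {B : Type u} [CStarAlgebra B] [WeakHopfCStarAlgebra B]

lemma inclR_assoc (U V W : UCorep B) (z) : inclR U V W (lin (assoc U V W).hom z) =
    TensorProduct.assoc ℂ U.carrier V.carrier W.carrier (inclL U V W z) := inclR_assocLin U V W z

lemma inclL_eq (U V W : UCorep B) (z) : inclL U V W z =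
    (incl U V).rTensor W.carrier (incl (tensor U V) W z) := rfl

lemma inclR_eq (U V W : UCorep B) (z) : inclR U V W z =
    (incl V W).lTensor U.carrier (incl U (tensor V W) z) := rfl

lemma incl_comp_tensorMap {U V U' V' : UCorep B} (f : U ⟶ U') (g : V ⟶ V') :
    incl U' V' ∘ₗ lin (tensorMap f g) = TensorProduct.map (lin f) (lin g) ∘ₗ incl U V :=
  LinearMap.ext (incl_tensorMap f g)

lemma inclL_nat {U V W U' V' W' : UCorep B} (f : U ⟶ U') (g : V ⟶ V') (h : W ⟶ W') (z) :
    inclL U' V' W' (lin (tensorMap (tensorMap f g) h) z) =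
      TensorProduct.map (TensorProduct.map (lin f) (lin g)) (lin h) (inclL U V W z) := by
  rw [inclL_eq, inclL_eq, incl_tensorMap, LinearMap.rTensor, LinearMap.rTensor,
    ← LinearMap.comp_apply (TensorProduct.map _ _), ← LinearMap.comp_apply (TensorProduct.map _ _),
    ← TensorProduct.map_comp, ← TensorProduct.map_comp, incl_comp_tensorMap, LinearMap.id_comp,
    LinearMap.comp_id]

lemma inclR_nat {U V W U' V' W' : UCorep B} (f : U ⟶ U') (g : V ⟶ V') (h : W ⟶ W') (z) :
    inclR U' V' W' (lin (tensorMap f (tensorMap g h)) z) =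
      TensorProduct.map (lin f) (TensorProduct.map (lin g) (lin h)) (inclR U V W z) := by
  rw [inclR_eq, inclR_eq, incl_tensorMap, LinearMap.lTensor, LinearMap.lTensor,
    ← LinearMap.comp_apply (TensorProduct.map _ _), ← LinearMap.comp_apply (TensorProduct.map _ _),
    ← TensorProduct.map_comp, ← TensorProduct.map_comp, incl_comp_tensorMap, LinearMap.id_comp,
    LinearMap.comp_id]

lemma assoc_nat {U V W U' V' W' : UCorep B} (f : U ⟶ U') (g : V ⟶ V') (h : W ⟶ W') :
    tensorMap (tensorMap f g) h ≫ (assoc U' V' W').hom =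
      (assoc U V W).hom ≫ tensorMap f (tensorMap g h) := by
  refine hom_ext (LinearMap.ext fun z => inclR_injective _ _ _ ?_)
  rw [lin_comp, lin_comp, LinearMap.comp_apply, LinearMap.comp_apply, inclR_assoc, inclL_nat,
    inclR_nat, inclR_assoc]
  generalize inclL U V W z = t
  induction t with
  | zero => simp only [LinearMap.map_zero, LinearEquiv.map_zero, LinearMap.zero_apply, zero_tmul]
  | add x y hx hy => simp only [LinearMap.map_add, LinearEquiv.map_add, hx, hy]
  | tmul x y =>
    induction x with
    | zero => simp only [LinearMap.map_zero, LinearEquiv.map_zero, LinearMap.zero_apply, zero_tmul]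
    | add x y hx hy => simp only [LinearMap.map_add, LinearEquiv.map_add, add_tmul, hx, hy]
    | tmul x y => simp

lemma tensorMap_id (U V : UCorep B) : tensorMap (𝟙 U) (𝟙 V) = 𝟙 (tensor U V) := by
  refine hom_ext (LinearMap.ext fun z => incl_injective _ _ ?_)
  rw [incl_tensorMap, lin_id, lin_id, TensorProduct.map_id, lin_id, LinearMap.id_apply,
    LinearMap.id_apply]

lemma tensorMap_comp {U V U' V' U'' V'' : UCorep B} (f : U ⟶ U') (g : V ⟶ V') (f' : U' ⟶ U'')
    (g' : V' ⟶ V'') : tensorMap (f ≫ f') (g ≫ g') = tensorMap f g ≫ tensorMap f' g' := by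
  refine hom_ext (LinearMap.ext fun z => incl_injective _ _ ?_)
  rw [incl_tensorMap, lin_comp, lin_comp, TensorProduct.map_comp, lin_comp, LinearMap.comp_apply,
    LinearMap.comp_apply, incl_tensorMap, incl_tensorMap]

/-- `H_{U(V(WX))}` inside the full tensor product. -/
def inclRR (U V W X : UCorep B) : (tensor U (tensor V (tensor W X))).carrier →ₗ[ℂ]
    U.carrier ⊗[ℂ] (V.carrier ⊗[ℂ] (W.carrier ⊗[ℂ] X.carrier)) :=
  (inclR V W X).lTensor U.carrier ∘ₗ incl U (tensor V (tensor W X))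

lemma inclRR_injective (U V W X : UCorep B) : Function.Injective (inclRR U V W X) := by
  refine Function.Injective.comp (f := incl U (tensor V (tensor W X))) ?_ (incl_injective _ _)
  refine Function.LeftInverse.injective (g := (projR V W X).lTensor U.carrier) fun x => ?_
  have h : projR V W X ∘ₗ inclR V W X = LinearMap.id := LinearMap.ext (projR_inclR V W X)
  change (projR V W X).lTensor U.carrier ((inclR V W X).lTensor U.carrier x) = x
  rw [← LinearMap.lTensor_comp_apply, h, LinearMap.lTensor_id, LinearMap.id_apply]

lemma inclRR_eq (U V W X : UCorep B) (z) : inclRR U V W X z =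
    ((incl W X).lTensor V.carrier).lTensor U.carrier (inclR U V (tensor W X) z) := by
  rw [inclR_eq, ← LinearMap.comp_apply (LinearMap.lTensor _ _), ← LinearMap.lTensor_comp]
  rfl

lemma inclRR_tensorMap (U V W X : UCorep B) (z) :
    inclRR U V W X (lin (tensorMap (𝟙 U) (assoc V W X).hom) z) =
      (TensorProduct.assoc ℂ V.carrier W.carrier X.carrier).toLinearMap.lTensor U.carrier
        ((inclL V W X).lTensor U.carrier (incl U (tensor (tensor V W) X) z)) := by
  have h : inclR V W X ∘ₗ lin (assoc V W X).hom =
      (TensorProduct.assoc ℂ V.carrier W.carrier X.carrier).toLinearMap ∘ₗ inclL V W X :=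
    LinearMap.ext (inclR_assoc V W X)
  change (inclR V W X).lTensor U.carrier (incl U _ _) = _
  rw [incl_tensorMap, lin_id, ← LinearMap.lTensor, ← LinearMap.comp_apply (LinearMap.lTensor _ _),
    ← LinearMap.lTensor_comp, h, LinearMap.lTensor_comp, LinearMap.comp_apply]

lemma pentagon' (U V W X : UCorep B) :
    tensorMap (assoc U V W).hom (𝟙 X) ≫ (assoc U (tensor V W) X).hom ≫
      tensorMap (𝟙 U) (assoc V W X).hom =
    (assoc (tensor U V) W X).hom ≫ (assoc U V (tensor W X)).hom := by
  refine hom_ext (LinearMap.ext fun z => inclRR_injective _ _ _ _ ?_)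
  simp only [lin_comp, LinearMap.comp_apply]
  rw [inclRR_tensorMap, inclRR_eq, inclR_assoc]
  -- both sides in terms of the inclusion of `((UV)W)X`
  have e1 (y) : (inclL V W X).lTensor U.carrier (incl U (tensor (tensor V W) X) y) =
      ((incl V W).rTensor X.carrier).lTensor U.carrier (inclR U (tensor V W) X y) := by
    rw [inclR_eq, ← LinearMap.lTensor_comp_apply]
    rfl
  have e2 (y) : (TensorProduct.assoc ℂ U.carrier V.carrier W.carrier).toLinearMap.rTensor X.carrier
      ((inclL U V W).rTensor X.carrier (incl _ _ y)) =
      ((incl V W).lTensor U.carrier).rTensor X.carrier (inclL U (tensor V W) X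
        (lin (tensorMap (assoc U V W).hom (𝟙 X)) y)) := by
    have h : inclR U V W ∘ₗ lin (assoc U V W).hom =
        (TensorProduct.assoc ℂ U.carrier V.carrier W.carrier).toLinearMap ∘ₗ inclL U V W :=
      LinearMap.ext (inclR_assoc U V W)
    rw [inclL_eq, incl_tensorMap, lin_id, ← LinearMap.rTensor, ← LinearMap.rTensor_comp_apply,
      ← LinearMap.rTensor_comp_apply, ← LinearMap.rTensor_comp_apply, ← h]
    rfl
  have e3 (y) : (incl U V).rTensor _ (inclR (tensor U V) W X y) =
      (incl W X).lTensor _ (inclL U V (tensor W X) y) := by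
    rw [inclR_eq, inclL_eq, ← LinearMap.comp_apply (LinearMap.rTensor _ _),
      ← LinearMap.comp_apply (LinearMap.lTensor _ _), LinearMap.rTensor_comp_lTensor,
      LinearMap.lTensor_comp_rTensor]
  have e4 (y) : ((incl U V).rTensor W.carrier).rTensor X.carrier (inclL (tensor U V) W X y) =
      (inclL U V W).rTensor X.carrier (incl _ _ y) := by
    rw [inclL_eq, ← LinearMap.comp_apply (LinearMap.rTensor _ _), ← LinearMap.rTensor_comp]
    rfl
  have n1 (t) : ((incl W X).lTensor V.carrier).lTensor U.carrier
      (TensorProduct.assoc ℂ U.carrier V.carrier (tensor W X).carrier t) =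
      TensorProduct.assoc ℂ _ _ _ ((incl W X).lTensor _ t) := by
    induction t with
    | zero => simp only [LinearMap.map_zero, LinearEquiv.map_zero, LinearMap.zero_apply, zero_tmul]
    | add x y hx hy => simp only [LinearMap.map_add, LinearEquiv.map_add, hx, hy]
    | tmul x y =>
      induction x with
      | zero => simp only [LinearMap.map_zero, LinearEquiv.map_zero, LinearMap.zero_apply, zero_tmul]
      | add x y hx hy => simp only [LinearMap.map_add, LinearEquiv.map_add, add_tmul, hx, hy]
      | tmul x y => simp
  have n2 (t) : (incl U V).rTensor _
      (TensorProduct.assoc ℂ (tensor U V).carrier W.carrier X.carrier t) =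
      TensorProduct.assoc ℂ _ _ _ (((incl U V).rTensor _).rTensor _ t) := by
    induction t with
    | zero => simp only [LinearMap.map_zero, LinearEquiv.map_zero, LinearMap.zero_apply, zero_tmul]
    | add x y hx hy => simp only [LinearMap.map_add, LinearEquiv.map_add, hx, hy]
    | tmul x y =>
      induction x with
      | zero => simp only [LinearMap.map_zero, LinearEquiv.map_zero, LinearMap.zero_apply, zero_tmul]
      | add x y hx hy => simp only [LinearMap.map_add, LinearEquiv.map_add, add_tmul, hx, hy]
      | tmul x y => simp
  have n3 (t) : ((incl V W).rTensor X.carrier).lTensor U.carrier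
      (TensorProduct.assoc ℂ U.carrier (tensor V W).carrier X.carrier t) =
      TensorProduct.assoc ℂ _ _ _ (((incl V W).lTensor _).rTensor _ t) := by
    induction t with
    | zero => simp only [LinearMap.map_zero, LinearEquiv.map_zero, LinearMap.zero_apply, zero_tmul]
    | add x y hx hy => simp only [LinearMap.map_add, LinearEquiv.map_add, hx, hy]
    | tmul x y =>
      induction x with
      | zero => simp only [LinearMap.map_zero, LinearEquiv.map_zero, LinearMap.zero_apply, zero_tmul]
      | add x y hx hy => simp only [LinearMap.map_add, LinearEquiv.map_add, add_tmul, hx, hy]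
      | tmul x y => simp
  rw [n1, ← e3, inclR_assoc, n2, e4, e1, inclR_assoc, n3, ← e2]
  generalize (inclL U V W).rTensor X.carrier (incl _ _ z) = t
  induction t with
  | zero => simp only [LinearMap.map_zero, LinearEquiv.map_zero, LinearMap.zero_apply, zero_tmul]
  | add x y hx hy => simp only [LinearMap.map_add, LinearEquiv.map_add, hx, hy]
  | tmul x y =>
    induction x with
    | zero => simp only [LinearMap.map_zero, LinearEquiv.map_zero, LinearMap.zero_apply, zero_tmul]
    | add x y hx hy => simp only [LinearMap.map_add, LinearEquiv.map_add, add_tmul, hx, hy]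
    | tmul x y =>
      induction x with
      | zero => simp only [LinearMap.map_zero, LinearEquiv.map_zero, LinearMap.zero_apply, zero_tmul]
      | add x y hx hy => simp only [LinearMap.map_add, LinearEquiv.map_add, add_tmul, hx, hy]
      | tmul x y => simp

variable [IsRegularQuantumGroupoid B]

lemma triangle' (U V : UCorep B) :
    (assoc U (unit B) V).hom ≫ tensorMap (𝟙 U) (leftUnit V).hom =
      tensorMap (rightUnit U).hom (𝟙 V) := by
  refine hom_ext (LinearMap.ext fun z => ?_)
  rw [← proj_incl U V (lin (tensorMap (rightUnit U).hom (𝟙 V)) z),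
    ← proj_incl U V (lin ((assoc U (unit B) V).hom ≫ tensorMap (𝟙 U) (leftUnit V).hom) z),
    incl_tensorMap, lin_comp, LinearMap.comp_apply, incl_tensorMap]
  have h1 : TensorProduct.map (lin (rightUnit U).hom) (lin (𝟙 V)) (incl (tensor U (unit B)) V z) =
      (rAct' U).rTensor _ (inclL U (unit B) V z) := by
    rw [inclL_eq, ← LinearMap.rTensor_comp_apply]
    rfl
  have h2 (y) : TensorProduct.map (lin (𝟙 U)) (lin (leftUnit V).hom)
      (incl U (tensor (unit B) V) y) = (lAct' V).lTensor _ (inclR U (unit B) V y) := by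
    rw [inclR_eq, ← LinearMap.lTensor_comp_apply]
    rfl
  rw [h1, h2, proj_balanced', inclR_assoc]

lemma rightUnit_nat {U V : UCorep B} (f : U ⟶ V) :
    tensorMap f (𝟙 (unit B)) ≫ (rightUnit V).hom = (rightUnit U).hom ≫ f := by
  refine hom_ext (LinearMap.ext fun z => ?_)
  rw [lin_comp, lin_comp, LinearMap.comp_apply, LinearMap.comp_apply, lin_rightUnit,
    lin_rightUnit, incl_tensorMap, lin_id, rAct'_nat]

lemma leftUnit_nat {U V : UCorep B} (f : U ⟶ V) :
    tensorMap (𝟙 (unit B)) f ≫ (leftUnit V).hom = (leftUnit U).hom ≫ f := by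
  refine hom_ext (LinearMap.ext fun z => ?_)
  rw [lin_comp, lin_comp, LinearMap.comp_apply, LinearMap.comp_apply, lin_leftUnit,
    lin_leftUnit, incl_tensorMap, lin_id, lAct'_nat]

/-- The monoidal category `UCorep(𝔊)`. -/
instance : MonoidalCategory (UCorep B) where
  tensorObj := tensor
  whiskerLeft U _ _ f := tensorMap (𝟙 U) f
  whiskerRight f V := tensorMap f (𝟙 V)
  tensorHom f g := tensorMap f g
  tensorUnit := unit B
  associator := assoc
  leftUnitor := leftUnit
  rightUnitor := rightUnit
  tensorHom_def f g := by rw [← tensorMap_comp, Category.comp_id, Category.id_comp]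
  id_tensorHom_id := tensorMap_id
  tensorHom_comp_tensorHom f g f' g' := (tensorMap_comp f g f' g').symm
  whiskerLeft_id U V := tensorMap_id U V
  id_whiskerRight U V := tensorMap_id U V
  associator_naturality f g h := assoc_nat f g h
  leftUnitor_naturality f := leftUnit_nat f
  rightUnitor_naturality f := rightUnit_nat f
  pentagon := pentagon'
  triangle := triangle'

end UCorep

/-! ### C*-categories and module categories -/

/-- C*-categories. Composition is written in diagrammatic order, so `f ≫ dagger f` is `f* ∘ f`. -/
class CStarCategory (M : Type w) [Category.{v} M] [Preadditive M] [Linear ℂ M] where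
  /-- The involution `f ↦ f*`. -/
  dagger {X Y : M} (f : X ⟶ Y) : Y ⟶ X
  dagger_dagger {X Y : M} (f : X ⟶ Y) : dagger (dagger f) = f
  dagger_add {X Y : M} (f g : X ⟶ Y) : dagger (f + g) = dagger f + dagger g
  dagger_smul {X Y : M} (c : ℂ) (f : X ⟶ Y) : dagger (c • f) = conj c • dagger f
  dagger_comp {X Y Z : M} (f : X ⟶ Y) (g : Y ⟶ Z) : dagger (f ≫ g) = dagger g ≫ dagger f
  /-- The norm on the spaces of morphisms, which makes them Banach spaces. -/
  homNorm {X Y : M} (f : X ⟶ Y) : ℝ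
  homNorm_add_le {X Y : M} (f g : X ⟶ Y) : homNorm (f + g) ≤ homNorm f + homNorm g
  homNorm_smul {X Y : M} (c : ℂ) (f : X ⟶ Y) : homNorm (c • f) = ‖c‖ * homNorm f
  eq_zero_of_homNorm {X Y : M} (f : X ⟶ Y) : homNorm f = 0 → f = 0
  complete {X Y : M} (f : ℕ → (X ⟶ Y))
    (hf : ∀ r : ℝ, 0 < r → ∃ N : ℕ, ∀ m n : ℕ, N ≤ m → N ≤ n → homNorm (f m - f n) < r) :
    ∃ g : X ⟶ Y, ∀ r : ℝ, 0 < r → ∃ N : ℕ, ∀ n : ℕ, N ≤ n → homNorm (f n - g) < r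
  homNorm_comp_le {X Y Z : M} (f : X ⟶ Y) (g : Y ⟶ Z) : homNorm (f ≫ g) ≤ homNorm f * homNorm g
  homNorm_comp_dagger {X Y : M} (f : X ⟶ Y) : homNorm (f ≫ dagger f) = homNorm f ^ 2
  /-- `f* ∘ f` is a positive element of the C*-algebra `End(X)`. -/
  exists_comp_dagger_eq {X Y : M} (f : X ⟶ Y) : ∃ g : X ⟶ X, f ≫ dagger f = g ≫ dagger g

section ModuleCategory

open MonoidalLeftAction CStarCategory

variable (B : Type u) [CStarAlgebra B] [WeakHopfCStarAlgebra B] [IsRegularQuantumGroupoid B]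
  (M : Type w) [Category.{v} M] [Preadditive M] [Linear ℂ M] [CStarCategory M]

/-- A left `UCorep(𝔊)`-module category is a module C*-category if the action is a bilinear
`*`-functor and the associativity and unit isomorphisms are unitary. -/
class IsModuleCStarCategory [MonoidalLeftAction (UCorep B) M] : Prop where
  add_actionHomLeft {U V : UCorep B} (f g : U ⟶ V) (X : M) :
    (f + g) ⊵ₗ X = f ⊵ₗ X + g ⊵ₗ X
  smul_actionHomLeft {U V : UCorep B} (c : ℂ) (f : U ⟶ V) (X : M) :
    (c • f) ⊵ₗ X = c • f ⊵ₗ X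
  actionHomRight_add (U : UCorep B) {X Y : M} (f g : X ⟶ Y) :
    U ⊴ₗ (f + g) = U ⊴ₗ f + U ⊴ₗ g
  actionHomRight_smul (U : UCorep B) {X Y : M} (c : ℂ) (f : X ⟶ Y) :
    U ⊴ₗ (c • f) = c • U ⊴ₗ f
  dagger_actionHomLeft {U V : UCorep B} (f : U ⟶ V) (X : M) :
    dagger (f ⊵ₗ X) = UCorep.adj f ⊵ₗ X
  dagger_actionHomRight (U : UCorep B) {X Y : M} (f : X ⟶ Y) :
    dagger (U ⊴ₗ f) = U ⊴ₗ dagger f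
  dagger_actionAssocIso (U V : UCorep B) (X : M) : dagger (αₗ U V X).hom = (αₗ U V X).inv
  dagger_actionUnitIso (X : M) :
    dagger (actionUnitIso (C := UCorep B) X).hom = (actionUnitIso (C := UCorep B) X).inv

variable {M}

/-- `M₀` generates the module category if every object is isomorphic to a subobject of some
`U ⊠ M₀`, that is, admits an isometry into it. -/
def IsGenerator [MonoidalLeftAction (UCorep B) M] (M₀ : M) : Prop :=
  ∀ N : M, ∃ (U : UCorep B) (f : N ⟶ U ⊙ₗ M₀), f ≫ dagger f = 𝟙 N

end ModuleCategory

/-! ### `*`-algebras and coactions -/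

/-- A bilinear product, a unit and an antilinear involution on a complex vector space. -/
structure StarAlgebraData (A : Type w) [AddCommGroup A] [Module ℂ A] where
  /-- The product. -/
  mul : A →ₗ[ℂ] A →ₗ[ℂ] A
  /-- The unit. -/
  one : A
  /-- The involution. -/
  star : A →ₗ⋆[ℂ] A

namespace StarAlgebraData

/-- The `*`-algebra underlying a C*-algebra. -/
def ofCStarAlgebra (A : Type w) [CStarAlgebra A] : StarAlgebraData A where
  mul := LinearMap.mul ℂ A
  one := 1
  star := (starLinearEquiv ℂ : A ≃ₗ⋆[ℂ] A).toLinearMap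

variable {A : Type w} [AddCommGroup A] [Module ℂ A]

/-- The axioms of a unital associative `*`-algebra. -/
structure IsUnitalStarAlgebra (s : StarAlgebraData A) : Prop where
  mul_assoc (a b c : A) : s.mul (s.mul a b) c = s.mul a (s.mul b c)
  one_mul (a : A) : s.mul s.one a = a
  mul_one (a : A) : s.mul a s.one = a
  star_star (a : A) : s.star (s.star a) = a
  star_mul (a b : A) : s.star (s.mul a b) = s.mul (s.star b) (s.star a)

variable {B : Type u} [CStarAlgebra B] [WeakHopfCStarAlgebra B]

/-- A right coaction of `𝔊` on a unital `*`-algebra: a `*`-homomorphism `𝔞 : A → A ⊗ B` such that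
`(𝔞 ⊗ id)𝔞 = (id ⊗ Δ)𝔞`, `(id ⊗ ε)𝔞 = id` and `𝔞(1) ∈ A ⊗ B_t`. -/
structure IsRightCoaction (s : StarAlgebraData A) (𝔞 : A →ₗ[ℂ] A ⊗[ℂ] B) : Prop where
  map_mul (a b : A) :
    𝔞 (s.mul a b) = TensorProduct.map₂ s.mul (LinearMap.mul ℂ B) (𝔞 a) (𝔞 b)
  map_star (a : A) :
    𝔞 (s.star a) =
      TensorProduct.map s.star (starLinearEquiv ℂ : B ≃ₗ⋆[ℂ] B).toLinearMap (𝔞 a)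
  coassoc (a : A) : TensorProduct.assoc ℂ A B B (𝔞.rTensor B (𝔞 a)) =
    (CoalgebraStruct.comul : B →ₗ[ℂ] B ⊗[ℂ] B).lTensor A (𝔞 a)
  counit (a : A) : epsR B A (𝔞 a) = a
  map_one : 𝔞 s.one ∈ LinearMap.range ((target B).subtype.lTensor A)

/-- A C*-completion of a `*`-algebra `A` with a right coaction `𝔞`, together with an extension of
`𝔞` to a continuous coaction. As `B` is finite dimensional, the C*-algebra `Ā ⊗ B` is the algebraic
tensor product, and a linear map `c : Ā → Ā ⊗ B` is continuous if and only if all the maps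
`(id ⊗ f)c` are continuous. -/
structure CStarCompletion (s : StarAlgebraData A) (𝔞 : A →ₗ[ℂ] A ⊗[ℂ] B) (C : Type w')
    [CStarAlgebra C] where
  /-- The embedding of `A` into the completion. -/
  incl : A →ₗ[ℂ] C
  incl_injective : Function.Injective incl
  incl_dense : DenseRange incl
  incl_mul (a b : A) : incl (s.mul a b) = incl a * incl b
  incl_one : incl s.one = 1
  incl_star (a : A) : incl (s.star a) = Star.star (incl a)
  /-- The extended coaction. -/
  coact : C →ₗ[ℂ] C ⊗[ℂ] B
  coact_isRightCoaction : (ofCStarAlgebra C).IsRightCoaction coact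
  coact_continuous (f : B →ₗ[ℂ] ℂ) :
    Continuous fun c : C => TensorProduct.rid ℂ C (f.lTensor C (coact c))
  coact_incl (a : A) : coact (incl a) = incl.rTensor B (𝔞 a)

end StarAlgebraData

/-! ### The reconstruction -/

section Irreducibles

variable {B : Type u} [CStarAlgebra B] [WeakHopfCStarAlgebra B] {Ω : Type t}

/-- An exhaustive family of representatives of the classes of irreducible corepresentations. -/
structure IsIrrFamily (Ux : Ω → UCorep B) : Prop where
  simple (x : Ω) : Simple (Ux x)
  eq_of_iso (x y : Ω) : Nonempty (Ux x ≅ Ux y) → x = y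
  exhaustive (U : UCorep B) : Simple U → ∃ x, Nonempty (U ≅ Ux x)

/-- A decomposition of `U` into irreducibles: isometries `w_i : H_{x_i} → H_U` with
`∑ w_i w_i* = 1`. -/
structure IrrDecomposition (Ux : Ω → UCorep B) (U : UCorep B) where
  /-- The number of summands. -/
  n : ℕ
  /-- The classes of the summands. -/
  idx : Fin n → Ω
  /-- The isometries. -/
  w (i : Fin n) : Ux (idx i) ⟶ U
  isometry (i : Fin n) : w i ≫ UCorep.adj (w i) = 𝟙 (Ux (idx i))
  sum_eq : ∑ i, UCorep.adj (w i) ≫ w i = 𝟙 U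

/-- The choices entering the construction of the `*`-algebra `A`: decompositions of all the
corepresentations into irreducibles, and conjugates of the irreducibles, that is, `Ū` with
morphisms `R̄ : 1 → U ⊗ Ū` (the coevaluation) and `R* : Ū ⊗ U → 1` (the evaluation) satisfying the
conjugate equations. -/
structure ReconstructionChoice [IsRegularQuantumGroupoid B] (Ux : Ω → UCorep B) where
  /-- The decompositions into irreducibles. -/
  decomp (U : UCorep B) : IrrDecomposition Ux U
  /-- The conjugates of the irreducibles. -/
  dual (x : Ω) : UCorep B
  /-- The solutions of the conjugate equations. -/
  pairing (x : Ω) : ExactPairing (Ux x) (dual x)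

end Irreducibles

namespace Reconstruction

open MonoidalLeftAction CStarCategory

/-- The vector `ξ̄` of the conjugate `H̄` of `H`, which is realized as the dual space. -/
abbrev bar {H : Type u} [NormedAddCommGroup H] [InnerProductSpace ℂ H] (ξ : H) :
    Module.Dual ℂ H := innerₛₗ ℂ ξ

variable {B : Type u} [CStarAlgebra B] [WeakHopfCStarAlgebra B]

/-- The matrix coefficients of `U` with respect to an orthonormal basis:
`U(e_i ⊗ 1) = ∑_j e_j ⊗ U_{j,i}`. -/
def matrixCoeff (U : UCorep B) {J : Type*} [Fintype J] (e : OrthonormalBasis J ℂ U.carrier)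
    (j i : J) : B := innerSlice (e j) (U.coact (e i))

/-- The coaction `ē_i ↦ ∑_j ē_j ⊗ (U_{j,i})*` on `H̄_U`. -/
def dualCoact (U : UCorep B) :
    Module.Dual ℂ U.carrier →ₗ[ℂ] Module.Dual ℂ U.carrier ⊗[ℂ] B :=
  ∑ i, ∑ j, (Module.Dual.eval ℂ U.carrier (stdOrthonormalBasis ℂ U.carrier i)).smulRight
    (bar (stdOrthonormalBasis ℂ U.carrier j) ⊗ₜ[ℂ]
      star (matrixCoeff U (stdOrthonormalBasis ℂ U.carrier) j i))

variable [IsRegularQuantumGroupoid B]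
  {M : Type w} [Category.{v} M] [Preadditive M] [Linear ℂ M] [CStarCategory M]
  [MonoidalLeftAction (UCorep B) M]

/-- `A_U = F(U) ⊗ H̄_U`, where `F(U) = Hom(M₀, U ⊠ M₀)`. -/
abbrev Comp (M₀ : M) (U : UCorep B) : Type (max u v) :=
  (M₀ ⟶ U ⊙ₗ M₀) ⊗[ℂ] Module.Dual ℂ U.carrier

/-- The vector space `A = ⊕_x F(U^x) ⊗ H̄_x`. -/
abbrev Alg {Ω : Type t} (M₀ : M) (Ux : Ω → UCorep B) : Type (max t u v) :=
  DirectSum Ω fun x => Comp M₀ (Ux x)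

/-- `ξ̄ ⊗ η̄ ↦ ξ̄ ⊗_{B_s} η̄`, the functional dual to `ξ ⊗_{B_s} η`. -/
def dualMul (U V : UCorep B) : Module.Dual ℂ U.carrier →ₗ[ℂ] Module.Dual ℂ V.carrier →ₗ[ℂ]
    Module.Dual ℂ (U ⊗ V : UCorep B).carrier :=
  TensorProduct.curry ((UCorep.incl U V).dualMap ∘ₗ
    TensorProduct.dualDistrib ℂ U.carrier V.carrier)

/-- `φ ↦ \overline{ξ^•}` for `φ = ξ̄`, where `ξ^• = (ξ̄ ⊗ id)R̄(1)`. -/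
def dualBullet (U V : UCorep B) [ExactPairing U V] :
    Module.Dual ℂ U.carrier →ₗ⋆[ℂ] Module.Dual ℂ V.carrier :=
  (innerₛₗ ℂ : V.carrier →ₗ⋆[ℂ] V.carrier →ₗ[ℂ] ℂ).comp
    ((TensorProduct.lid ℂ V.carrier).toLinearMap ∘ₗ
      LinearMap.applyₗ (UCorep.incl U V (UCorep.lin (η_ U V) (UCorep.unitOne B))) ∘ₗ
      LinearMap.rTensorHom V.carrier)

section

variable (M₀ : M) {Ω : Type t} (Ux : Ω → UCorep B)

open Classical in
/-- The projection `p(X ⊗ ξ̄) = ∑_i F(w_i*)X ⊗ \overline{w_i* ξ}` on `A_U`. -/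
def proj {U : UCorep B} (D : IrrDecomposition Ux U) : Comp M₀ U →ₗ[ℂ] Alg M₀ Ux :=
  ∑ i, DirectSum.lof ℂ Ω (fun x => Comp M₀ (Ux x)) (D.idx i) ∘ₗ
    TensorProduct.map (Linear.rightComp ℂ M₀ (UCorep.adj (D.w i) ⊵ₗ M₀))
      (UCorep.lin (D.w i)).dualMap

end

variable [IsModuleCStarCategory B M]

/-- `X ⊗ Y ↦ (id ⊗ Y)X`, `F(U) × F(V) → F(U ⊗ V)` -/
def homMul (M₀ : M) (U V : UCorep B) :
    (M₀ ⟶ U ⊙ₗ M₀) →ₗ[ℂ] (M₀ ⟶ V ⊙ₗ M₀) →ₗ[ℂ] (M₀ ⟶ (U ⊗ V : UCorep B) ⊙ₗ M₀) :=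
  LinearMap.mk₂ ℂ (fun X Y => X ≫ U ⊴ₗ Y ≫ (αₗ U V M₀).inv)
    (fun X X' Y => by simp) (fun c X Y => by simp)
    (fun X Y Y' => by simp [IsModuleCStarCategory.actionHomRight_add])
    (fun c X Y => by simp [IsModuleCStarCategory.actionHomRight_smul])

/-- The product `(X ⊗ ξ̄)(Y ⊗ η̄) = (id ⊗ Y)X ⊗ (ξ̄ ⊗_{B_s} η̄)` from `A_U × A_V` to
`A_{U ⊗ V}`. -/
def compMul (M₀ : M) (U V : UCorep B) :
    Comp M₀ U →ₗ[ℂ] Comp M₀ V →ₗ[ℂ] Comp M₀ (U ⊗ V : UCorep B) :=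
  TensorProduct.map₂ (homMul M₀ U V) (dualMul U V)

/-- `X^• = (id ⊗ X*)R` -/
def homBullet (M₀ : M) (U V : UCorep B) [ExactPairing U V] :
    (M₀ ⟶ U ⊙ₗ M₀) →ₗ⋆[ℂ] (M₀ ⟶ V ⊙ₗ M₀) where
  toFun X := (λₗ M₀).inv ≫ UCorep.adj (ε_ U V) ⊵ₗ M₀ ≫ (αₗ V U M₀).hom ≫ V ⊴ₗ dagger X
  map_add' X Y := by simp [dagger_add, IsModuleCStarCategory.actionHomRight_add]
  map_smul' c X := by simp [dagger_smul, IsModuleCStarCategory.actionHomRight_smul]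

/-- `(X ⊗ ξ̄)^• = X^• ⊗ \overline{ξ^•}` -/
def compBullet (M₀ : M) (U V : UCorep B) [ExactPairing U V] : Comp M₀ U →ₗ⋆[ℂ] Comp M₀ V :=
  TensorProduct.map (homBullet M₀ U V) (dualBullet U V)

variable (M₀ : M) {Ω : Type t} {Ux : Ω → UCorep B} (c : ReconstructionChoice Ux)

open Classical in
/-- The product `a · b = p(ba)` on `A`, that is,
`(X ⊗ ξ̄) · (Y ⊗ η̄) = p((id ⊗ X)Y ⊗ (η̄ ⊗_{B_s} ξ̄))`. -/
def mulMap : Alg M₀ Ux →ₗ[ℂ] Alg M₀ Ux →ₗ[ℂ] Alg M₀ Ux :=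
  DirectSum.toModule ℂ Ω _ fun x => (DirectSum.toModule ℂ Ω _ fun y =>
    (compMul M₀ (Ux y) (Ux x)).compr₂ (proj M₀ Ux (c.decomp (Ux y ⊗ Ux x)))).flip

/-- The unit `p(id ⊗ \overline{1_B})` of `A`. -/
def unitElt : Alg M₀ Ux :=
  proj M₀ Ux (c.decomp (𝟙_ (UCorep B))) ((λₗ M₀).inv ⊗ₜ bar (UCorep.unitOne B))

open Classical in
/-- The involution `a* = p(a^•)` on `A`. -/
def starMap : Alg M₀ Ux →ₗ⋆[ℂ] Alg M₀ Ux where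
  __ := DirectSum.toAddMonoid fun x =>
    letI := c.pairing x
    ((proj M₀ Ux (c.decomp (c.dual x))).comp (compBullet M₀ (Ux x) (c.dual x))).toAddMonoidHom
  map_smul' r a := by
    induction a using DirectSum.induction_on with
    | zero => simp
    | add a b ha hb => 
      simp only [smul_add, ZeroHom.toFun_eq_coe, AddMonoidHom.toZeroHom_coe, map_add] at *
      rw [ha, hb]
    | of x a =>
      let _ := c.pairing x
      simp [← DirectSum.of_smul]

/-- The `*`-algebra `A`. -/
def starAlgebra : StarAlgebraData (Alg M₀ Ux) where
  mul := mulMap M₀ c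
  one := unitElt M₀ c
  star := starMap M₀ c

variable (Ux)

open Classical in
/-- The element `X ⊗ φ` of the summand `F(U^x) ⊗ H̄_x` of `A`. -/
def elem (x : Ω) (X : M₀ ⟶ Ux x ⊙ₗ M₀) (φ : Module.Dual ℂ (Ux x).carrier) : Alg M₀ Ux :=
  DirectSum.lof ℂ Ω (fun x => Comp M₀ (Ux x)) x (X ⊗ₜ[ℂ] φ)

open Classical in
/-- The coaction `X ⊗ ξ̄_i ↦ X ⊗ ∑_j ξ̄_j ⊗ (U^x_{j,i})*` of `𝔊` on `A`. -/
def coaction : Alg M₀ Ux →ₗ[ℂ] Alg M₀ Ux ⊗[ℂ] B :=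
  DirectSum.toModule ℂ Ω _ fun x =>
    (DirectSum.lof ℂ Ω (fun x => Comp M₀ (Ux x)) x).rTensor B ∘ₗ
      (TensorProduct.assoc ℂ _ _ _).symm.toLinearMap ∘ₗ (dualCoact (Ux x)).lTensor _

end Reconstruction

end

/-! Everything is concentrated in one object, the regular corepresentation. The coaction Δ on B is
unitary for a scalar product built from a faithful positive invariant functional (`exists_haar`), so
B becomes an object `reg B` of the category; its product and the inclusion of B_s turn it into an
algebra object. A functional φ on H_U defines the colinear map v ↦ φ(v¹)v² into `reg B`, and every
colinear map from U to `reg B` has this form for a unique φ. Hence X ⊗ φ ↦ (φ̂ ⊠ id)X makes sense on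
every F(U) ⊗ H̄_U and does not see decompositions into irreducibles, and with Schur's lemma it
identifies A with the single space F(`reg B`) (`algRegEquiv`).

An element z of F(`reg B`) extends to the endomorphism (m ⊠ id)(id ⊠ z) of `reg B` ⊠ M₀, the Kleisli
extension for the monad of the algebra `reg B`. The resulting map `rep` from A to End(`reg B` ⊠ M₀)
is injective, since restriction along the unit of `reg B` recovers z. It carries the product of A to
composition because matrix coefficients multiply under tensor products, and the unit to the
identity. The serious point is the involution (`rep_starMap`): it corresponds to the adjoint because
the adjoint of right multiplication by the coefficients of U is right multiplication by those of a
conjugate of U, bent by the evaluation (`adj_mulCoef`). This rests on the conjugate equations and on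
`coef_pairForm`, by which a morphism U ⊗ V → 1 matches the coefficients of U with S applied to those
of V. All axioms of a `*`-algebra are then inherited from the C*-algebra End(`reg B` ⊠ M₀).

The norm of `rep` is a C*-norm on A. It is equivalent to the norm of the Banach space F(`reg B`),
because U ⊠ - is contractive and `rep` is undone by a fixed composition. So A is already complete
and is its own completion. Uniqueness follows because an injective `*`-homomorphism of C*-algebras
is isometric, hence has closed range. The coaction lives on the conjugate spaces alone, where its
properties are those of `dualCoact`; its slices act on F(`reg B`) by composition with endomorphisms
of `reg B`, which gives continuity.

For the existence of the choices, the conjugate is the dual space with the contragredient coaction,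
made unitary by embedding it into copies of `reg B` through its coefficients; decompositions come
from induction on the dimension. -/

noncomputable section

set_option linter.unusedSectionVars false

namespace WeakHopfCStarAlgebra

/-! ### Counital maps and bijectivity of the antipode -/

section Identities

variable {B : Type u} [CStarAlgebra B] [WeakHopfCStarAlgebra B]

local notation "Δ" => (CoalgebraStruct.comul : B →ₗ[ℂ] B ⊗[ℂ] B)
local notation "ε" => (CoalgebraStruct.counit : B →ₗ[ℂ] ℂ)
local notation "S" => (antipode : B →ₗ[ℂ] B)

/-- The middle slice `a ⊗ b ⊗ c ↦ ε(b) a ⊗ c`. -/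
def midCounit (B : Type u) [CStarAlgebra B] [WeakHopfCStarAlgebra B] :
    (B ⊗[ℂ] B) ⊗[ℂ] B →ₗ[ℂ] B ⊗[ℂ] B := (epsR B B).rTensor B

/-- With its companion below this is the tool that turns three-leg identities for Δ(1) into two-leg
identities: ε on the middle leg undoes a comultiplication on either side. -/
lemma midCounit_comul (t : B ⊗[ℂ] B) : midCounit B ((Δ).rTensor B t) = t := by
  induction t with
  | zero => simp only [LinearMap.map_zero]
  | add x y hx hy => simp only [LinearMap.map_add, hx, hy]
  | tmul x y => simp only [midCounit, LinearMap.rTensor_tmul, epsR_comul]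

lemma midCounit_comul' (t : B ⊗[ℂ] B) :
    midCounit B ((TensorProduct.assoc ℂ B B B).symm ((Δ).lTensor B t)) = t := by
  induction t with
  | zero => simp only [LinearMap.map_zero, LinearEquiv.map_zero]
  | add x y hx hy => simp only [LinearMap.map_add, LinearEquiv.map_add, hx, hy]
  | tmul x y =>
    have h : ∀ q : B ⊗[ℂ] B, midCounit B ((TensorProduct.assoc ℂ B B B).symm (x ⊗ₜ q)) =
        x ⊗ₜ (TensorProduct.lid ℂ B ((ε).rTensor B q)) := by
      intro q
      induction q with
      | zero => simp only [LinearMap.map_zero, LinearEquiv.map_zero, tmul_zero]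
      | add x y hx hy => simp only [LinearMap.map_add, LinearEquiv.map_add, tmul_add, hx, hy]
      | tmul a b => simp [midCounit, epsR, smul_tmul]
    rw [LinearMap.lTensor_tmul, h, epsL_comul]

lemma rTensor_comul_mul (t s : B ⊗[ℂ] B) :
    (Δ).rTensor B t * (Δ).rTensor B s = (Δ).rTensor B (t * s) := by
  induction t with
  | zero => simp
  | add x y hx hy => simp only [LinearMap.map_add, add_mul, hx, hy]
  | tmul a b =>
    induction s with
    | zero => simp
    | add x y hx hy => simp only [LinearMap.map_add, mul_add, hx, hy]
    | tmul c d => simp [comul_mul]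

lemma assoc_symm_tmul_mul (t s : B ⊗[ℂ] B) (a c : B) :
    (TensorProduct.assoc ℂ B B B).symm (a ⊗ₜ t) * (TensorProduct.assoc ℂ B B B).symm (c ⊗ₜ s) =
      (TensorProduct.assoc ℂ B B B).symm ((a * c) ⊗ₜ (t * s)) := by
  induction t with
  | zero => simp
  | add x y hx hy => simp only [LinearEquiv.map_add, tmul_add, add_mul, hx, hy]
  | tmul a b =>
    induction s with
    | zero => simp
    | add x y hx hy => simp only [LinearEquiv.map_add, tmul_add, mul_add, hx, hy]
    | tmul c d => simp

/-- `b₁ ⊗ ε_t(b₂) = 1₁b ⊗ 1₂` -/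
lemma lTensor_target_comul (b : B) : targetCounital.lTensor B (Δ b) = Δ 1 * (b ⊗ₜ 1) := by
  -- Multiply (1 ⊗ Δ(1))(Δ(1) ⊗ 1) = (Δ ⊗ id)Δ(1) on the right by Δ(b) ⊗ 1. With ε on the middle
  -- leg, the left side becomes b₁ ⊗ ε_t(b₂).
  have h1 : (TensorProduct.assoc ℂ B B B).symm ((1 : B) ⊗ₜ[ℂ] Δ 1) * (Δ b ⊗ₜ (1 : B)) =
      (Δ).rTensor B (Δ 1 * (b ⊗ₜ 1)) := by
    rw [← rTensor_comul_mul, ← comul_one', mul_assoc, LinearMap.rTensor_tmul,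
      Algebra.TensorProduct.tmul_mul_tmul, comul_one_mul, one_mul]
  have h2 := congrArg (midCounit B) h1
  rw [midCounit_comul] at h2
  rw [← h2]
  obtain ⟨s, hs⟩ := TensorProduct.exists_finset (Δ 1)
  have ht := target_apply hs
  rw [hs]
  generalize Δ b = q
  induction q with
  | zero => simp
  | add x y hx hy => simp only [LinearMap.map_add, add_tmul, mul_add, hx, hy]
  | tmul x y =>
    simp only [LinearMap.lTensor_tmul, ht, tmul_sum, map_sum, Finset.sum_mul,
      TensorProduct.assoc_symm_tmul, Algebra.TensorProduct.tmul_mul_tmul, midCounit,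
      LinearMap.rTensor_tmul, epsR, LinearMap.comp_apply, LinearMap.lTensor_tmul, one_mul, mul_one,
      LinearEquiv.coe_coe, TensorProduct.rid_tmul, smul_tmul]

/-- `ε_s(b₁) ⊗ b₂ = 1₁ ⊗ b1₂` -/
lemma rTensor_source_comul (b : B) : sourceCounital.rTensor B (Δ b) = (1 ⊗ₜ b) * Δ 1 := by
  have h0 : (TensorProduct.assoc ℂ B B B).symm ((Δ).lTensor B (Δ 1)) = (Δ).rTensor B (Δ 1) := by
    rw [← Coalgebra.coassoc_apply, LinearEquiv.symm_apply_apply]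
  have hm : ∀ t s : B ⊗[ℂ] B, (TensorProduct.assoc ℂ B B B).symm ((Δ).lTensor B t) *
      (TensorProduct.assoc ℂ B B B).symm ((Δ).lTensor B s) =
      (TensorProduct.assoc ℂ B B B).symm ((Δ).lTensor B (t * s)) := by
    intro t s
    induction t with
    | zero => simp
    | add x y hx hy => simp only [LinearMap.map_add, LinearEquiv.map_add, add_mul, hx, hy]
    | tmul a b =>
      induction s with
      | zero => simp
      | add x y hx hy => simp only [LinearMap.map_add, LinearEquiv.map_add, mul_add, hx, hy]
      | tmul c d =>
        simp only [LinearMap.lTensor_tmul, Algebra.TensorProduct.tmul_mul_tmul, comul_mul,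
          assoc_symm_tmul_mul]
  -- The mirror argument needs (id ⊗ Δ)Δ(1) instead of (Δ ⊗ id)Δ(1); coassociativity (`h0`) allows
  -- the exchange.
  have h1 : (TensorProduct.assoc ℂ B B B).symm ((1 : B) ⊗ₜ[ℂ] Δ b) * (Δ 1 ⊗ₜ (1 : B)) =
      (TensorProduct.assoc ℂ B B B).symm ((Δ).lTensor B ((1 ⊗ₜ b) * Δ 1)) := by
    rw [← hm, h0, ← comul_one', ← mul_assoc, LinearMap.lTensor_tmul, assoc_symm_tmul_mul,
      comul_mul_one, one_mul]
  have h2 := congrArg (midCounit B) h1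
  rw [midCounit_comul'] at h2
  rw [← h2]
  obtain ⟨s, hs⟩ := TensorProduct.exists_finset (Δ 1)
  have ht := source_apply hs
  rw [hs]
  generalize Δ b = q
  induction q with
  | zero => simp
  | add x y hx hy => simp only [LinearMap.map_add, LinearEquiv.map_add, tmul_add, add_mul, hx, hy]
  | tmul x y =>
    simp only [LinearMap.rTensor_tmul, ht, sum_tmul, map_sum, Finset.mul_sum,
      TensorProduct.assoc_symm_tmul, Algebra.TensorProduct.tmul_mul_tmul, midCounit,
      epsR, LinearMap.comp_apply, LinearMap.lTensor_tmul, one_mul, mul_one,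
      LinearEquiv.coe_coe, TensorProduct.rid_tmul]

/-- `ε_s(b) = ε(b1₁) S(1₂)` -/
lemma source_apply_antipode {s : Finset (B × B)} (hs : Δ 1 = ∑ i ∈ s, i.1 ⊗ₜ[ℂ] i.2) (b : B) :
    sourceCounital b = ∑ i ∈ s, ε (b * i.1) • S i.2 := by
  have h := source_apply hs b
  have h2 := congrArg (epsR B B ∘ₗ LinearMap.mulLeft ℂ (1 ⊗ₜ b))
    (hs.symm.trans (antipode_comul_one hs))
  simp [map_sum, epsR] at h2
  rw [h, h2]
  -- After the substitution Δ(1) = S(1₂) ⊗ S(1₁) an antipode remains under ε. It can be dropped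
  -- because the left leg of Δ(1) lies in B_s.
  have key := (source_rTensor_comul_one (B := B)).symm
  conv_lhs at key => rw [hs]
  conv_rhs at key => rw [hs]
  have k1 := congrArg (epsR B B ∘ₗ LinearMap.mulLeft ℂ (1 ⊗ₜ b) ∘ₗ
      TensorProduct.map S S ∘ₗ (TensorProduct.comm ℂ B B).toLinearMap) key
  have k2 := congrArg (epsR B B ∘ₗ LinearMap.mulLeft ℂ (1 ⊗ₜ b) ∘ₗ
      (S).rTensor B ∘ₗ (TensorProduct.comm ℂ B B).toLinearMap) key
  simp [map_sum, epsR] at k1 k2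
  rw [k1, k2]
  exact Finset.sum_congr rfl fun i _ => by rw [counit_mul_antipode ⟨_, rfl⟩]

/-- `b₁ ⊗ ε_s(b₂) = b1₁ ⊗ S(1₂)` -/
lemma lTensor_source_comul (b : B) :
    sourceCounital.lTensor B (Δ b) = (b ⊗ₜ 1) * (S).lTensor B (Δ 1) := by
  have h1 : (Δ b ⊗ₜ (1 : B)) * (TensorProduct.assoc ℂ B B B).symm ((1 : B) ⊗ₜ[ℂ] Δ 1) =
      (Δ).rTensor B ((b ⊗ₜ 1) * Δ 1) := by
    rw [← rTensor_comul_mul, ← comul_one, ← mul_assoc, LinearMap.rTensor_tmul,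
      Algebra.TensorProduct.tmul_mul_tmul, comul_mul_one, one_mul]
  have h2 := congrArg (midCounit B) h1
  rw [midCounit_comul] at h2
  have h3 : (b ⊗ₜ 1) * (S).lTensor B (Δ 1) = (S).lTensor B ((b ⊗ₜ 1) * Δ 1) := by
    generalize Δ 1 = q
    induction q with
    | zero => simp
    | add x y hx hy => simp only [LinearMap.map_add, mul_add, hx, hy]
    | tmul x y => simp
  rw [h3, ← h2]
  obtain ⟨s, hs⟩ := TensorProduct.exists_finset (Δ 1)
  have ht := source_apply_antipode hs
  rw [hs]
  generalize Δ b = q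
  induction q with
  | zero => simp
  | add x y hx hy => simp only [LinearMap.map_add, add_tmul, add_mul, hx, hy]
  | tmul x y =>
    simp only [LinearMap.lTensor_tmul, ht, tmul_sum, map_sum, Finset.mul_sum,
      TensorProduct.assoc_symm_tmul, Algebra.TensorProduct.tmul_mul_tmul, midCounit,
      LinearMap.rTensor_tmul, epsR, LinearMap.comp_apply, one_mul, mul_one,
      LinearEquiv.coe_coe, TensorProduct.rid_tmul, smul_tmul, map_smul]

lemma source_one : sourceCounital (1 : B) = 1 := source_apply_self one_mem_source

/-- `ε(b ε_t(c)) = ε(bc)` -/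
lemma counit_mul_target (b c : B) : ε (b * targetCounital c) = ε (b * c) := by
  obtain ⟨s, hs⟩ := TensorProduct.exists_finset (Δ 1)
  rw [target_apply hs, Finset.mul_sum, map_sum, ← counit_one_mul' b c hs]
  simp [mul_comm]

/-- `ε(ε_s(b) c) = ε(bc)` -/
lemma counit_source_mul (b c : B) : ε (sourceCounital b * c) = ε (b * c) := by
  obtain ⟨s, hs⟩ := TensorProduct.exists_finset (Δ 1)
  rw [source_apply hs, Finset.sum_mul, map_sum, ← counit_one_mul' b c hs]
  simp

/-- `ε_t(bc) = ε_t(b ε_t(c))` -/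
lemma target_mul_target (b c : B) :
    targetCounital (b * targetCounital c) = targetCounital (b * c) := by
  obtain ⟨s, hs⟩ := TensorProduct.exists_finset (Δ 1)
  rw [target_apply hs, target_apply hs (b * c)]
  exact Finset.sum_congr rfl fun i _ => by rw [← mul_assoc, ← mul_assoc, counit_mul_target]

lemma target_target (b : B) : targetCounital (targetCounital b) = targetCounital b := by
  have := target_mul_target 1 b
  rwa [one_mul, one_mul] at this

/-- `Δ(t) = 1₁t ⊗ 1₂` for `t ∈ B_t` -/
lemma comul_target (b : B) : Δ (targetCounital b) = Δ 1 * (targetCounital b ⊗ₜ 1) := by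
  obtain ⟨s, hs⟩ := TensorProduct.exists_finset (Δ 1)
  have h0 : (TensorProduct.assoc ℂ B B B).symm ((Δ).lTensor B (Δ 1)) =
      (TensorProduct.assoc ℂ B B B).symm ((1 : B) ⊗ₜ[ℂ] Δ 1) * (Δ 1 ⊗ₜ[ℂ] (1 : B)) := by
    rw [comul_one', ← Coalgebra.coassoc_apply, LinearEquiv.symm_apply_apply]
  -- Slicing the first leg of (id ⊗ Δ)Δ(1) by ε(· b) produces Δ(ε_t(b)).
  have h1 := congrArg (fun q => ((TensorProduct.lid ℂ _).toLinearMap ∘ₗ (ε).rTensor (B ⊗[ℂ] B) ∘ₗ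
    (TensorProduct.assoc ℂ B B B).toLinearMap) (q * ((b ⊗ₜ 1) ⊗ₜ 1))) h0
  rw [hs] at h1
  rw [target_apply hs, hs]
  simp only [map_sum, LinearMap.lTensor_tmul, Finset.sum_mul, map_smul, sum_tmul, tmul_sum,
    TensorProduct.assoc_symm_tmul, Finset.mul_sum, Algebra.TensorProduct.tmul_mul_tmul,
    LinearMap.comp_apply, LinearEquiv.coe_coe, TensorProduct.assoc_tmul, LinearMap.rTensor_tmul,
    TensorProduct.lid_tmul, one_mul, mul_one, smul_tmul', mul_smul_comm] at h1 ⊢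
  rw [← h1]
  refine Finset.sum_congr rfl fun i _ => ?_
  generalize Δ i.2 = q
  induction q with
  | zero => simp
  | add x y hx hy => simp only [smul_add, tmul_add, LinearEquiv.map_add, add_mul, LinearMap.map_add, ← hx, ← hy]
  | tmul x y => simp [smul_tmul']

/-- `Δ(t) = t1₁ ⊗ 1₂` for `t ∈ B_t` -/
lemma comul_target' (b : B) : Δ (targetCounital b) = (targetCounital b ⊗ₜ 1) * Δ 1 := by
  obtain ⟨s, hs⟩ := TensorProduct.exists_finset (Δ 1)
  have h0 : (TensorProduct.assoc ℂ B B B).symm ((Δ).lTensor B (Δ 1)) =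
      (Δ 1 ⊗ₜ[ℂ] (1 : B)) * (TensorProduct.assoc ℂ B B B).symm ((1 : B) ⊗ₜ[ℂ] Δ 1) := by
    rw [comul_one, ← Coalgebra.coassoc_apply, LinearEquiv.symm_apply_apply]
  have h1 := congrArg (fun q => ((TensorProduct.lid ℂ _).toLinearMap ∘ₗ (ε).rTensor (B ⊗[ℂ] B) ∘ₗ
    (TensorProduct.assoc ℂ B B B).toLinearMap) (q * ((b ⊗ₜ 1) ⊗ₜ 1))) h0
  rw [hs] at h1
  rw [target_apply hs, hs]
  simp only [map_sum, LinearMap.lTensor_tmul, Finset.sum_mul, map_smul, sum_tmul, tmul_sum,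
    TensorProduct.assoc_symm_tmul, Finset.mul_sum, Algebra.TensorProduct.tmul_mul_tmul,
    LinearMap.comp_apply, LinearEquiv.coe_coe, TensorProduct.assoc_tmul, LinearMap.rTensor_tmul,
    TensorProduct.lid_tmul, one_mul, mul_one, smul_tmul', smul_mul_assoc] at h1 ⊢
  rw [← h1]
  refine Finset.sum_congr rfl fun i _ => ?_
  generalize Δ i.2 = q
  induction q with
  | zero => simp
  | add x y hx hy => simp only [smul_add, tmul_add, LinearEquiv.map_add, add_mul, LinearMap.map_add, ← hx, ← hy]
  | tmul x y => simp [smul_tmul']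

lemma antipode_leg_mul_leg : LinearMap.mul' ℂ B ((S).rTensor B (Δ 1)) = 1 := by
  rw [antipode_mul_id, source_one]

lemma leg_mul_antipode_leg : LinearMap.mul' ℂ B ((S).lTensor B (Δ 1)) = 1 := by
  rw [mul_antipode, target_one]

/-- `S(t) = ε_s(t)` for `t ∈ B_t` -/
lemma antipode_target (b : B) : S (targetCounital b) = sourceCounital (targetCounital b) := by
  have h : ∀ (q : B ⊗[ℂ] B) (x : B), LinearMap.mul' ℂ B ((S).rTensor B (q * (x ⊗ₜ 1))) =
      S x * LinearMap.mul' ℂ B ((S).rTensor B q) := by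
    intro q x
    induction q with
    | zero => simp
    | add x y hx hy => simp only [add_mul, LinearMap.map_add, hx, hy, mul_add]
    | tmul x y => simp [antipode_mul, mul_assoc]
  rw [← antipode_mul_id, comul_target, h, antipode_leg_mul_leg, mul_one]

/-- `ε(S(t)b) = ε(tb)` for `t ∈ B_t` -/
lemma counit_antipode_target_mul (t b : B) :
    ε (S (targetCounital t) * b) = ε (targetCounital t * b) := by
  rw [antipode_target, counit_source_mul]

/-- `b₁ ε_s(b₂) = b` -/
lemma mul_source_comul (b : B) : LinearMap.mul' ℂ B (sourceCounital.lTensor B (Δ b)) = b := by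
  have h : ∀ q : B ⊗[ℂ] B, LinearMap.mul' ℂ B ((b ⊗ₜ 1) * q) = b * LinearMap.mul' ℂ B q := by
    intro q
    induction q with
    | zero => simp
    | add x y hx hy => simp only [mul_add, LinearMap.map_add, hx, hy]
    | tmul x y => simp [mul_assoc]
  rw [lTensor_source_comul, h, leg_mul_antipode_leg, mul_one]

/-- `S(b₁) ε_t(b₂) = S(b)` -/
lemma antipode_mul_target_comul (b : B) :
    LinearMap.mul' ℂ B (TensorProduct.map S targetCounital (Δ b)) = S b := by
  have h : ∀ q : B ⊗[ℂ] B, LinearMap.mul' ℂ B ((S).rTensor B (q * (b ⊗ₜ 1))) =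
      S b * LinearMap.mul' ℂ B ((S).rTensor B q) := by
    intro q
    induction q with
    | zero => simp
    | add x y hx hy => simp only [add_mul, LinearMap.map_add, hx, hy, mul_add]
    | tmul x y => simp [antipode_mul, mul_assoc]
  rw [← LinearMap.rTensor_comp_lTensor, LinearMap.comp_apply, lTensor_target_comul, h,
    antipode_leg_mul_leg, mul_one]

/-- `a ε_t(b) = ε(a₁b) a₂` -/
lemma mul_target (a b : B) : a * targetCounital b =
    TensorProduct.lid ℂ B ((ε ∘ₗ LinearMap.mulRight ℂ b).rTensor B (Δ a)) := by
  have h := epsL_comul (a * targetCounital b)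
  rw [comul_mul, comul_target, ← mul_assoc, comul_mul_one] at h
  rw [← h]
  generalize Δ a = q
  induction q with
  | zero => simp
  | add x y hx hy => simp only [add_mul, LinearMap.map_add, LinearEquiv.map_add, hx, hy]
  | tmul x y => simp [counit_mul_target]

/-- The inverse antipode `b ↦ S(b*)*`. -/
def antipodeInv : B →ₗ[ℂ] B where
  toFun b := star (S (star b))
  map_add' a b := by simp
  map_smul' c b := by simp

lemma antipodeInv_apply (b : B) : antipodeInv b = star (S (star b)) := rfl

lemma antipodeInv_mul (a b : B) : (antipodeInv (a * b) : B) = antipodeInv b * antipodeInv a := by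
  simp [antipodeInv_apply, antipode_mul]

/-- Antimultiplicativity gives S(S(x*)*)S(y) = S((S(x*)y*)*), so the left side is S(ε_s(b*)*), and
the symmetry of Δ(1) under star and S turns this into ε_t(b). Thus b ↦ S(S(b*)*) has the same
convolution product with S as the identity has. -/
lemma antipode_antipodeInv_mul_aux (b : B) :
    LinearMap.mul' ℂ B (TensorProduct.map (S ∘ₗ antipodeInv) S (Δ b)) = targetCounital b := by
  have h1 : ∀ q : B ⊗[ℂ] B, LinearMap.mul' ℂ B (TensorProduct.map (S ∘ₗ antipodeInv) S q) =
      S (star (LinearMap.mul' ℂ B ((S).rTensor B (star q)))) := by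
    intro q
    induction q with
    | zero => simp
    | add x y hx hy => simp only [star_add, LinearMap.map_add, hx, hy]
    | tmul x y => simp [antipodeInv_apply, antipode_mul]
  rw [h1, ← comul_star, antipode_mul_id]
  obtain ⟨s, hs⟩ := TensorProduct.exists_finset (Δ 1)
  have h2 : star (sourceCounital (star b)) = ∑ i ∈ s, ε (i.2 * b) • i.1 := by
    have h := congrArg (epsR B B ∘ₗ LinearMap.mulRight ℂ (1 ⊗ₜ b))
      (hs.symm.trans (star_sum_comul_one hs))
    simp [map_sum, epsR] at h
    rw [h, source_apply hs, star_sum]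
    simp [← counit_star]
  rw [h2, target_apply hs]
  have k := congrArg (TensorProduct.lid ℂ B ∘ (ε ∘ₗ LinearMap.mulRight ℂ b).rTensor B)
    (hs.symm.trans (antipode_comul_one hs))
  simp [map_sum] at k
  rw [k]
  have key := (target_lTensor_comul_one (B := B)).symm
  conv_lhs at key => rw [hs]
  conv_rhs at key => rw [hs]
  have k1 := congrArg (TensorProduct.lid ℂ B ∘ (ε ∘ₗ LinearMap.mulRight ℂ b).rTensor B ∘
      TensorProduct.map S S ∘ (TensorProduct.comm ℂ B B)) key
  have k2 := congrArg (TensorProduct.lid ℂ B ∘ (ε ∘ₗ LinearMap.mulRight ℂ b).rTensor B ∘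
      (S).lTensor B ∘ (TensorProduct.comm ℂ B B)) key
  simp [map_sum] at k1 k2
  rw [k1, map_sum]
  simp only [map_smul]
  rw [k2]
  exact Finset.sum_congr rfl fun i _ => by rw [counit_antipode_target_mul]

/-- A convolution argument for the multiplicative map f = S ∘ `antipodeInv`. Since f * S = ε_t = id
* S, one gets f = f * ε_s = f * S * id = id * S * id = id * ε_s = id. In particular S is bijective.
-/
lemma antipode_antipodeInv (b : B) : S (antipodeInv b) = b := by
  set f : B →ₗ[ℂ] B := S ∘ₗ antipodeInv with hf
  have hmul : ∀ a b, f (a * b) = f a * f b := fun a b => by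
    simp [hf, antipodeInv_mul, antipode_mul]
  -- Multiplicativity of f and f(1₁)S(1₂) = 1 give f = f * ε_s.
  have h1 : f b = LinearMap.mul' ℂ B (TensorProduct.map f sourceCounital (Δ b)) := by
    have h : ∀ q : B ⊗[ℂ] B, LinearMap.mul' ℂ B (f.rTensor B ((b ⊗ₜ 1) * q)) =
        f b * LinearMap.mul' ℂ B (f.rTensor B q) := by
      intro q
      induction q with
      | zero => simp
      | add x y hx hy => simp only [mul_add, LinearMap.map_add, hx, hy]
      | tmul x y => simp [hmul, mul_assoc]
    rw [← LinearMap.rTensor_comp_lTensor, LinearMap.comp_apply (LinearMap.rTensor B f),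
      lTensor_source_comul, h, ← LinearMap.comp_apply (LinearMap.rTensor _ _), LinearMap.rTensor_comp_lTensor,
      antipode_antipodeInv_mul_aux, target_one, mul_one]
  have h2 : ∀ q : B ⊗[ℂ] B, LinearMap.mul' ℂ B (TensorProduct.map f sourceCounital q) =
      LinearMap.mul' ℂ B ((LinearMap.mul' ℂ B ∘ₗ TensorProduct.map f S).rTensor B
        ((TensorProduct.assoc ℂ B B B).symm ((Δ).lTensor B q))) := by
    intro q
    induction q with
    | zero => simp
    | add x y hx hy => simp only [LinearMap.map_add, LinearEquiv.map_add, hx, hy]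
    | tmul x y =>
      simp only [LinearMap.lTensor_tmul, TensorProduct.map_tmul, ← antipode_mul_id]
      generalize Δ y = r
      induction r with
      | zero => simp
      | add x y hx hy => simp only [LinearMap.map_add, LinearEquiv.map_add, tmul_add, hx, hy]
      | tmul c d => simp [mul_assoc]
  have h3 : ∀ q : B ⊗[ℂ] B, LinearMap.mul' ℂ B ((LinearMap.mul' ℂ B ∘ₗ TensorProduct.map f S).rTensor B
        ((Δ).rTensor B q)) = LinearMap.mul' ℂ B (targetCounital.rTensor B q) := by
    intro q
    have : (LinearMap.mul' ℂ B ∘ₗ TensorProduct.map f S) ∘ₗ Δ = targetCounital :=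
      LinearMap.ext antipode_antipodeInv_mul_aux
    rw [← LinearMap.rTensor_comp_apply, this]
  have h4 : ∀ q : B ⊗[ℂ] B, LinearMap.mul' ℂ B (targetCounital.rTensor B q) =
      LinearMap.mul' ℂ B ((LinearMap.mul' ℂ B ∘ₗ (S).lTensor B).rTensor B ((Δ).rTensor B q)) := by
    intro q
    have : (LinearMap.mul' ℂ B ∘ₗ (S).lTensor B) ∘ₗ Δ = targetCounital := LinearMap.ext mul_antipode
    rw [← LinearMap.rTensor_comp_apply, this]
  have h5 : ∀ q : B ⊗[ℂ] B, LinearMap.mul' ℂ B (sourceCounital.lTensor B q) =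
      LinearMap.mul' ℂ B ((LinearMap.mul' ℂ B ∘ₗ (S).lTensor B).rTensor B
        ((TensorProduct.assoc ℂ B B B).symm ((Δ).lTensor B q))) := by
    intro q
    induction q with
    | zero => simp
    | add x y hx hy => simp only [LinearMap.map_add, LinearEquiv.map_add, hx, hy]
    | tmul x y =>
      simp only [LinearMap.lTensor_tmul, ← antipode_mul_id]
      generalize Δ y = r
      induction r with
      | zero => simp
      | add x y hx hy => simp only [LinearMap.map_add, LinearEquiv.map_add, tmul_add, hx, hy]
      | tmul c d => simp [mul_assoc]
  have h0 : (TensorProduct.assoc ℂ B B B).symm ((Δ).lTensor B (Δ b)) = (Δ).rTensor B (Δ b) := by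
    rw [← Coalgebra.coassoc_apply, LinearEquiv.symm_apply_apply]
  change f b = b
  rw [h1, h2, h0, h3, h4, ← h0, ← h5, mul_source_comul]

lemma antipode_surjective : Function.Surjective S := fun b => ⟨_, antipode_antipodeInv b⟩

lemma antipode_injective : Function.Injective S :=
  LinearMap.injective_iff_surjective.2 antipode_surjective

/-- `S(S(b)*) = b*` -/
lemma antipode_star_antipode_eq (b : B) : S (star (S b)) = star b := by
  have := antipode_antipodeInv (star b)
  rwa [antipodeInv_apply, star_star] at this

end Identities

end WeakHopfCStarAlgebra

/-! ### Faithful positive functionals -/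

section PositiveFunctional

variable {B : Type u} [CStarAlgebra B]

/-- A faithful positive functional on a C*-algebra. -/
structure IsFaithfulPositive (φ : B →ₗ[ℂ] ℂ) : Prop where
  nonneg (z : B) : ∃ r : ℝ, 0 ≤ r ∧ φ (star z * z) = r
  definite (z : B) : φ (star z * z) = 0 → z = 0

namespace IsFaithfulPositive

variable {φ : B →ₗ[ℂ] ℂ}

/-- Polarization: φ(z*z) is real for z = 1, x, 1 + x and 1 + ix. -/
lemma map_star (h : IsFaithfulPositive φ) (x : B) : φ (star x) = conj (φ x) := by
  have key : ∀ z : B, (φ (star z * z)).im = 0 := fun z => by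
    obtain ⟨r, -, hr⟩ := h.nonneg z
    rw [hr, Complex.ofReal_im]
  have h0 := key 1
  have h1 := key x
  have h2 := key (1 + x)
  have h3 := key (1 + Complex.I • x)
  simp only [star_add, star_one, star_smul, add_mul, mul_add, one_mul, mul_one, smul_mul_assoc,
    mul_smul_comm, map_add, map_smul, Complex.add_im] at h0 h1 h2 h3
  simp at h0 h1 h2 h3
  apply Complex.ext
  · rw [Complex.conj_re]; linarith
  · rw [Complex.conj_im]; linarith

/-- The scalar product `⟨a, b⟩ = φ(a*b)`. -/
abbrev core (h : IsFaithfulPositive φ) : InnerProductSpace.Core ℂ B where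
  inner a b := φ (star a * b)
  conj_inner_symm x y := by rw [← h.map_star]; simp
  re_inner_nonneg x := by
    obtain ⟨r, hr, hr'⟩ := h.nonneg x
    rw [hr']
    simpa using hr
  add_left x y z := by simp [add_mul]
  smul_left x y r := by simp
  definite x hx := h.definite x hx

/-- B already carries its C*-norm, so the Hilbert space structure given by φ is offered on a
separate space with a linear identification. -/
lemma exists_space (h : IsFaithfulPositive φ) :
    ∃ (E : Type u) (_ : NormedAddCommGroup E) (_ : InnerProductSpace ℂ E) (e : B ≃ₗ[ℂ] E),
      ∀ a b, inner ℂ (e a) (e b) = φ (star a * b) :=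
  ⟨B, @InnerProductSpace.Core.toNormedAddCommGroup ℂ B _ _ _ h.core,
    @InnerProductSpace.ofCore ℂ B _ _ _ h.core.toCore, LinearEquiv.refl ℂ B, fun _ _ => rfl⟩

/-- Identifies φ ⊗ φ with the scalar product of the tensor square, so that φ ⊗ φ is again positive
and faithful. -/
lemma inner_congr {E : Type u} [NormedAddCommGroup E] [InnerProductSpace ℂ E] {e : B ≃ₗ[ℂ] E}
    (he : ∀ a b, inner ℂ (e a) (e b) = φ (star a * b)) (s t : B ⊗[ℂ] B) :
    inner ℂ (TensorProduct.congr e e s) (TensorProduct.congr e e t) =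
      LinearMap.mul' ℂ ℂ (TensorProduct.map φ φ (star s * t)) := by
  induction s with
  | zero => simp
  | add x y hx hy => simp only [map_add, star_add, add_mul, inner_add_left, hx, hy]
  | tmul a b =>
    induction t with
    | zero => simp
    | add x y hx hy => simp only [map_add, mul_add, inner_add_right, hx, hy]
    | tmul c d => simp [TensorProduct.inner_tmul, he]

lemma tensor_nonneg (h : IsFaithfulPositive φ) (t : B ⊗[ℂ] B) :
    ∃ r : ℝ, 0 ≤ r ∧ LinearMap.mul' ℂ ℂ (TensorProduct.map φ φ (star t * t)) = r := by
  obtain ⟨E, _, _, e, he⟩ := h.exists_space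
  refine ⟨_, sq_nonneg ‖TensorProduct.congr e e t‖, ?_⟩
  rw [← inner_congr he]
  refine (inner_self_eq_norm_sq_to_K (𝕜 := ℂ) (TensorProduct.congr e e t)).trans ?_
  push_cast
  rfl

lemma tensor_definite (h : IsFaithfulPositive φ) {t : B ⊗[ℂ] B}
    (ht : LinearMap.mul' ℂ ℂ (TensorProduct.map φ φ (star t * t)) = 0) : t = 0 := by
  obtain ⟨E, _, _, e, he⟩ := h.exists_space
  rw [← inner_congr he] at ht
  exact (TensorProduct.congr e e).map_eq_zero_iff.1 ((inner_self_eq_zero (𝕜 := ℂ)).1 ht)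

lemma separates (h : IsFaithfulPositive φ) {b : B} (hb : ∀ a, φ (a * b) = 0) : b = 0 :=
  h.definite b (hb _)

end IsFaithfulPositive

end PositiveFunctional

/-! ### The trace of the regular representations -/

section Trace

open Polynomial in
-- The trace is the sum of the roots of the characteristic polynomial. If nonnegative roots have sum
-- zero they all vanish, the polynomial is a power of X, and Cayley–Hamilton gives nilpotency.
lemma trace_of_nonneg_eigenvalues {V : Type*} [AddCommGroup V] [Module ℂ V] [FiniteDimensional ℂ V]
    (f : Module.End ℂ V) (hf : ∀ μ, f.HasEigenvalue μ → ∃ r : ℝ, 0 ≤ r ∧ μ = r) :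
    (∃ r : ℝ, 0 ≤ r ∧ LinearMap.trace ℂ V f = r) ∧
      (LinearMap.trace ℂ V f = 0 → IsNilpotent f) := by
  have hroots : ∀ μ ∈ f.charpoly.roots, ∃ r : ℝ, 0 ≤ r ∧ μ = r := fun μ hμ =>
    hf μ ((Module.End.hasEigenvalue_iff_isRoot_charpoly f μ).2 (isRoot_of_mem_roots hμ))
  have hsum : LinearMap.trace ℂ V f = f.charpoly.roots.sum := by
    rw [LinearMap.charpoly_def, LinearMap.trace_eq_matrix_trace ℂ (Module.Free.chooseBasis ℂ _) f,
      Matrix.trace_eq_sum_roots_charpoly]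
  have hre : ∀ s : Multiset ℂ, (∀ μ ∈ s, ∃ r : ℝ, 0 ≤ r ∧ μ = r) →
      ∃ r : ℝ, 0 ≤ r ∧ s.sum = r ∧ (r = 0 → ∀ μ ∈ s, μ = 0) := by
    intro s
    induction s using Multiset.induction with
    | empty => exact fun _ => ⟨0, le_rfl, by simp, by simp⟩
    | cons a s ih =>
      intro h
      obtain ⟨r, hr, rfl⟩ := h a (Multiset.mem_cons_self a s)
      obtain ⟨q, hq, hq', ih2⟩ := ih fun μ hμ => h μ (Multiset.mem_cons_of_mem hμ)
      refine ⟨r + q, by positivity, by rw [Multiset.sum_cons, hq']; push_cast; rfl, ?_⟩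
      intro h0 μ hμ
      have hr0 : r = 0 := by linarith
      rcases Multiset.mem_cons.1 hμ with rfl | hμ
      · simp [hr0]
      · exact ih2 (by linarith) μ hμ
  obtain ⟨r, hr, hr', h0⟩ := hre _ hroots
  rw [hsum, hr']
  refine ⟨⟨r, hr, rfl⟩, fun hr0 => ⟨Multiset.card f.charpoly.roots, ?_⟩⟩
  have hz := h0 (by exact_mod_cast hr0)
  have hX : f.charpoly = X ^ Multiset.card f.charpoly.roots := by
    conv_lhs => rw [(IsAlgClosed.splits f.charpoly).eq_prod_roots_of_monic f.charpoly_monic]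
    rw [Multiset.eq_replicate_card.2 hz]
    simp
  have := f.aeval_self_charpoly
  rw [hX] at this
  simpa using this

variable {B : Type u} [CStarAlgebra B]

lemma exists_real_of_not_isUnit (z : B) {μ : ℂ}
    (h : ¬ IsUnit (algebraMap ℂ B μ - star z * z)) : ∃ r : ℝ, 0 ≤ r ∧ μ = r := by
  have h3 : μ ∈ spectrum ℂ (star z * z) := h
  have h4 : IsSelfAdjoint (star z * z) := IsSelfAdjoint.star_mul_self _
  refine ⟨μ.re, ?_, (h4.mem_spectrum_eq_re h3)⟩
  refine spectrum_star_mul_self_nonneg (b := z) _ ?_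
  rw [h4.mem_spectrum_eq_re h3] at h3
  exact (spectrum.algebraMap_mem_iff ℂ (R := ℝ)).1 h3

variable (B) in
/-- The trace `b ↦ Tr(L_b) + Tr(R_b)`. -/
def regTrace : B →ₗ[ℂ] ℂ :=
  LinearMap.trace ℂ B ∘ₗ LinearMap.mul ℂ B + LinearMap.trace ℂ B ∘ₗ (LinearMap.mul ℂ B).flip

lemma regTrace_apply (b : B) : regTrace B b =
    LinearMap.trace ℂ B (LinearMap.mulLeft ℂ b) + LinearMap.trace ℂ B (LinearMap.mulRight ℂ b) :=
  rfl

lemma regTrace_mul_comm (a b : B) : regTrace B (a * b) = regTrace B (b * a) := by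
  rw [regTrace_apply, regTrace_apply, LinearMap.mulLeft_mul, LinearMap.mulLeft_mul,
    LinearMap.mulRight_mul, LinearMap.mulRight_mul]
  congr 1
  · exact LinearMap.trace_mul_comm ℂ (LinearMap.mulLeft ℂ a) (LinearMap.mulLeft ℂ b)
  · exact LinearMap.trace_mul_comm ℂ (LinearMap.mulRight ℂ b) (LinearMap.mulRight ℂ a)

/-- Eigenvalues of multiplication by z*z lie in the spectrum of z*z and are therefore nonnegative.
If the trace vanishes, z*z is nilpotent, and a nilpotent self-adjoint element is zero. -/
lemma regTrace_isFaithfulPositive [FiniteDimensional ℂ B] : IsFaithfulPositive (regTrace B) := by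
  have hL (z : B) := trace_of_nonneg_eigenvalues (LinearMap.mulLeft ℂ (star z * z)) fun μ hμ => by
    refine exists_real_of_not_isUnit z fun hu => ?_
    obtain ⟨x, hx⟩ := hμ.exists_hasEigenvector
    have h2 : (star z * z) * x = μ • x := hx.apply_eq_smul
    refine hx.2 ((hu.mul_right_eq_zero).1 ?_)
    rw [sub_mul, h2, Algebra.algebraMap_eq_smul_one, smul_one_mul, sub_self]
  have hR (z : B) := trace_of_nonneg_eigenvalues (LinearMap.mulRight ℂ (star z * z)) fun μ hμ => by
    refine exists_real_of_not_isUnit z fun hu => ?_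
    obtain ⟨x, hx⟩ := hμ.exists_hasEigenvector
    have h2 : x * (star z * z) = μ • x := hx.apply_eq_smul
    refine hx.2 ((hu.mul_left_eq_zero).1 ?_)
    rw [mul_sub, h2, Algebra.algebraMap_eq_smul_one, mul_smul_one, sub_self]
  refine ⟨fun z => ?_, fun z hz => ?_⟩
  · obtain ⟨⟨r, hr, hr'⟩, -⟩ := hL z
    obtain ⟨⟨q, hq, hq'⟩, -⟩ := hR z
    exact ⟨r + q, by positivity, by rw [regTrace_apply, hr', hq']; push_cast; rfl⟩
  · obtain ⟨⟨r, hr, hr'⟩, hn⟩ := hL z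
    obtain ⟨⟨q, hq, hq'⟩, -⟩ := hR z
    rw [regTrace_apply, hr', hq'] at hz
    have hz' : r + q = 0 := by exact_mod_cast hz
    have hr0 : r = 0 := by linarith
    obtain ⟨n, h1⟩ := hn (by rw [hr', hr0]; simp)
    have h1 : (star z * z) ^ n = 0 := by
      have := congrArg (fun f : Module.End ℂ B => f 1) h1
      simpa only [LinearMap.pow_mulLeft, LinearMap.mulLeft_apply, mul_one, LinearMap.zero_apply]
        using this
    -- The exponent is enlarged to a power of two, for which the norm of a power of a self-adjoint
    -- element is the power of its norm.
    have h2 : (star z * z) ^ (2 ^ n) = 0 := pow_eq_zero_of_le Nat.lt_two_pow_self.le h1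
    have h3 := (IsSelfAdjoint.star_mul_self z).nnnorm_pow_two_pow n
    rw [h2, nnnorm_zero, eq_comm, pow_eq_zero_iff (by positivity), nnnorm_eq_zero,
      CStarRing.star_mul_self_eq_zero_iff] at h3
    exact h3

end Trace

namespace WeakHopfCStarAlgebra

/-! ### A projection integral and an invariant functional -/

section Haar

variable {B : Type u} [CStarAlgebra B] [WeakHopfCStarAlgebra B]

local notation "Δ" => (CoalgebraStruct.comul : B →ₗ[ℂ] B ⊗[ℂ] B)
local notation "ε" => (CoalgebraStruct.counit : B →ₗ[ℂ] ℂ)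
local notation "S" => (antipode : B →ₗ[ℂ] B)

/-- The antihomomorphism S conjugates right multiplication by b into left multiplication by S(b) and
conversely; this is why `regTrace` adds the two traces. -/
lemma regTrace_antipode (b : B) : regTrace B (S b) = regTrace B b := by
  let e : B ≃ₗ[ℂ] B := LinearEquiv.ofBijective S ⟨antipode_injective, antipode_surjective⟩
  have he : ∀ x, e x = S x := fun x => rfl
  have h1 : LinearMap.mulLeft ℂ (S b) = e.conj (LinearMap.mulRight ℂ b) := by
    ext x
    obtain ⟨y, rfl⟩ := e.surjective x
    rw [LinearEquiv.conj_apply_apply, LinearEquiv.symm_apply_apply, LinearMap.mulLeft_apply,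
      LinearMap.mulRight_apply, he, he, antipode_mul]
  have h2 : LinearMap.mulRight ℂ (S b) = e.conj (LinearMap.mulLeft ℂ b) := by
    ext x
    obtain ⟨y, rfl⟩ := e.surjective x
    rw [LinearEquiv.conj_apply_apply, LinearEquiv.symm_apply_apply, LinearMap.mulLeft_apply,
      LinearMap.mulRight_apply, he, he, antipode_mul]
  rw [regTrace_apply, regTrace_apply, h1, h2, LinearMap.trace_conj', LinearMap.trace_conj',
    add_comm]

variable (B) in
/-- There is a normalized left integral which is a projection. -/
lemma exists_integral : ∃ l : B, star l = l ∧ l * l = l ∧ targetCounital l = 1 ∧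
    ∀ x, x * l = targetCounital x * l := by
  have hτ := regTrace_isFaithfulPositive (B := B)
  obtain ⟨E, _, _, E₀, hE⟩ := hτ.exists_space
  have hfd : FiniteDimensional ℂ E := Module.Finite.equiv E₀
  let N : Submodule ℂ E := LinearMap.ker ((targetCounital : B →ₗ[ℂ] B) ∘ₗ E₀.symm.toLinearMap)
  have hN : ∀ b : B, E₀ b ∈ N ↔ targetCounital b = 0 := fun b => by simp [N]
  -- The integral is the component of 1 orthogonal to ker ε_t for the trace scalar product. By
  -- ε_t(bε_t(c)) = ε_t(bc) this kernel is a left ideal.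
  obtain ⟨e, he, l, hl, h1⟩ := N.exists_add_mem_mem_orthogonal (E₀ 1)
  obtain ⟨e, rfl⟩ := E₀.surjective e
  obtain ⟨l, rfl⟩ := E₀.surjective l
  rw [← map_add] at h1
  have h1 := E₀.injective h1
  rw [hN] at he
  have hl : ∀ n, targetCounital n = 0 → regTrace B (star n * l) = 0 := fun n hn => by
    rw [← hE]
    exact (Submodule.mem_orthogonal N _).1 hl _ ((hN n).2 hn)
  have hid : ∀ x n : B, targetCounital n = 0 → targetCounital (x * n) = 0 := fun x n hn => by
    rw [← target_mul_target, hn, mul_zero, map_zero]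
  -- As nl = n - ne stays in the left ideal, so does n*(nl). It is therefore orthogonal to l, which
  -- says that τ((nl)*(nl)) = 0.
  have hnl : ∀ n, targetCounital n = 0 → n * l = 0 := by
    intro n hn
    have h2 : targetCounital (n * l) = 0 := by
      have h3 : n * l = n - n * e := by
        rw [eq_sub_iff_add_eq, add_comm, ← mul_add, ← h1, mul_one]
      rw [h3, map_sub, hn, hid n e he, sub_zero]
    apply hτ.definite
    have h4 := hl (star n * (n * l)) (hid _ _ h2)
    rwa [star_mul, star_star, mul_assoc] at h4
  have hel : e * l = 0 := hnl e he
  have hll : l * l = l := by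
    conv_rhs => rw [← one_mul l, h1, add_mul, hel, zero_add]
  -- Here the trace property enters: τ(a l e*) = τ(e* a l), and a*e lies in the left ideal. Then l =
  -- l(e + l)* = ll* is self-adjoint.
  have hle : l * star e = 0 := by
    refine hτ.separates fun a => ?_
    have h4 := hl (star a * e) (hid _ _ he)
    rw [star_mul, star_star] at h4
    rw [← mul_assoc, regTrace_mul_comm, ← mul_assoc]
    exact h4
  have hls : l = l * star l := by
    conv_lhs => rw [← mul_one l, ← star_one B, h1, star_add, mul_add, hle, zero_add]
  refine ⟨l, by rw [hls, star_mul, star_star], hll, ?_, fun x => ?_⟩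
  · have := congrArg targetCounital h1
    rw [map_add, he, zero_add, target_one] at this
    exact this.symm
  · have := hnl (x - targetCounital x) (by rw [map_sub, target_target, sub_self])
    rwa [sub_mul, sub_eq_zero] at this

/-- `(1 ⊗ c)Δ(l) = (S(c) ⊗ 1)Δ(l)` for a left integral `l` -/
lemma integral_comul {l : B} (hl : ∀ x, x * l = targetCounital x * l) (c : B) :
    ((1 : B) ⊗ₜ[ℂ] c) * Δ l = (S c ⊗ₜ 1) * Δ l := by
  -- The map a ⊗ b ↦ (S(a) ⊗ 1)Δ(bl) is evaluated at Δ(c) in two ways: with bl = ε_t(b)l and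
  -- S(c₁)ε_t(c₂) = S(c), and with coassociativity and S(c₁)c₂ ⊗ c₃ = ε_s(c₁) ⊗ c₂.
  let Φ : B ⊗[ℂ] B →ₗ[ℂ] B ⊗[ℂ] B := TensorProduct.lift
    ((LinearMap.mul ℂ (B ⊗[ℂ] B)).compl₁₂ ((TensorProduct.mk ℂ B B).flip 1 ∘ₗ S)
      (Δ ∘ₗ LinearMap.mulRight ℂ l))
  have hΦ : ∀ a b, Φ (a ⊗ₜ b) = (S a ⊗ₜ 1) * Δ (b * l) := fun a b => rfl
  have h1 : Φ (Δ c) = (S c ⊗ₜ 1) * Δ l := by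
    rw [← antipode_mul_target_comul]
    generalize Δ c = q
    induction q with
    | zero => simp
    | add x y hx hy => simp only [LinearMap.map_add, add_tmul, add_mul, hx, hy]
    | tmul a b =>
      rw [hΦ, hl, comul_mul, comul_target', mul_assoc, comul_one_mul, ← mul_assoc]
      simp
  have h2 : Φ (Δ c) = ((1 : B) ⊗ₜ[ℂ] c) * Δ l := by
    have h3 : ∀ q : B ⊗[ℂ] B, Φ q = (LinearMap.mul' ℂ B ∘ₗ (S).rTensor B).rTensor B
        ((TensorProduct.assoc ℂ B B B).symm ((Δ).lTensor B q)) * Δ l := by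
      intro q
      induction q with
      | zero => simp
      | add x y hx hy => simp only [LinearMap.map_add, LinearEquiv.map_add, add_mul, hx, hy]
      | tmul a b =>
        rw [hΦ, comul_mul, ← mul_assoc, LinearMap.lTensor_tmul]
        congr 1
        generalize Δ b = r
        induction r with
        | zero => simp
        | add x y hx hy => simp only [LinearMap.map_add, LinearEquiv.map_add, tmul_add, mul_add, hx, hy]
        | tmul x y => simp
    have h4 : (LinearMap.mul' ℂ B ∘ₗ (S).rTensor B) ∘ₗ Δ = sourceCounital :=
      LinearMap.ext antipode_mul_id
    rw [h3, ← Coalgebra.coassoc_apply, LinearEquiv.symm_apply_apply, ← LinearMap.rTensor_comp_apply,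
      h4, rTensor_source_comul, mul_assoc, comul_one_mul]
  rw [← h1, h2]

variable (B) in
/-- The existence of a faithful positive invariant functional:
`d₁ h(z d₂) = S(z₁) h(z₂ d)`. -/
theorem exists_haar : ∃ h : B →ₗ[ℂ] ℂ, IsFaithfulPositive h ∧ ∀ z d : B,
    TensorProduct.rid ℂ B ((h ∘ₗ LinearMap.mulLeft ℂ z).lTensor B (Δ d)) =
      TensorProduct.rid ℂ B (TensorProduct.map S (h ∘ₗ LinearMap.mulRight ℂ d) (Δ z)) := by
  obtain ⟨l, hls, hll, hlt, hl⟩ := exists_integral B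
  have hτ := regTrace_isFaithfulPositive (B := B)
  set τ := regTrace B with hτd
  -- The integral identity read on slices: multiplying the first leg of Δ(l) by S(x) amounts to
  -- multiplying the slice by x.
  have hslice : ∀ (χ : B →ₗ[ℂ] ℂ) (x : B),
      TensorProduct.lid ℂ B ((χ ∘ₗ LinearMap.mulLeft ℂ (S x)).rTensor B (Δ l)) =
        x * TensorProduct.lid ℂ B (χ.rTensor B (Δ l)) := by
    intro χ x
    have h1 : ∀ q : B ⊗[ℂ] B,
        TensorProduct.lid ℂ B ((χ ∘ₗ LinearMap.mulLeft ℂ (S x)).rTensor B q) =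
          TensorProduct.lid ℂ B (χ.rTensor B ((S x ⊗ₜ 1) * q)) := by
      intro q
      induction q with
      | zero => simp
      | add x y hx hy => simp only [LinearMap.map_add, LinearEquiv.map_add, mul_add, hx, hy]
      | tmul a b => simp
    have h2 : ∀ q : B ⊗[ℂ] B,
        x * TensorProduct.lid ℂ B (χ.rTensor B q) =
          TensorProduct.lid ℂ B (χ.rTensor B ((1 ⊗ₜ x) * q)) := by
      intro q
      induction q with
      | zero => simp
      | add x y hx hy => simp only [LinearMap.map_add, LinearEquiv.map_add, mul_add, hx, hy]
      | tmul a b => simp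
    rw [h1, h2, integral_comul hl]
  set k := TensorProduct.lid ℂ B (τ.rTensor B (Δ l)) with hk
  have hΔl : Δ l * Δ l = Δ l := by rw [← comul_mul, hll]
  have hΔs : star (Δ l) = Δ l := by rw [← comul_star, hls]
  -- Since Δ(l) is a projection, τ(ckc*) is the value of τ ⊗ τ at t*t with t = Δ(l)(1 ⊗ c*), hence
  -- nonnegative.
  have hF : ∀ c : B, τ (c * k * star c) = LinearMap.mul' ℂ ℂ (TensorProduct.map τ τ
      (star (Δ l * (1 ⊗ₜ star c)) * (Δ l * (1 ⊗ₜ star c)))) := by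
    intro c
    have h1 : star (Δ l * (1 ⊗ₜ star c)) * (Δ l * (1 ⊗ₜ star c)) =
        (1 ⊗ₜ c) * Δ l * (1 ⊗ₜ star c) := by
      rw [star_mul, hΔs, TensorProduct.star_tmul, star_one, star_star, mul_assoc,
        ← mul_assoc (Δ l), hΔl, mul_assoc]
    rw [h1, hk]
    generalize Δ l = q
    induction q with
    | zero => simp
    | add x y hx hy => simp only [LinearMap.map_add, LinearEquiv.map_add, mul_add, add_mul, hx, hy]
    | tmul a b => simp
  -- Vanishing forces (1 ⊗ c)Δ(l) = (S(c) ⊗ 1)Δ(l) = 0. Applying id ⊗ S and multiplying the legs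
  -- gives S(c)ε_t(l) = S(c), so c = 0.
  have hFdef : ∀ c : B, τ (c * k * star c) = 0 → c = 0 := by
    intro c hc
    rw [hF] at hc
    have h1 := congrArg star (hτ.tensor_definite hc)
    rw [star_mul, hΔs, TensorProduct.star_tmul, star_one, star_star, star_zero,
      integral_comul hl] at h1
    have h2 : ∀ q : B ⊗[ℂ] B, LinearMap.mul' ℂ B ((S).lTensor B ((S c ⊗ₜ 1) * q)) =
        S c * LinearMap.mul' ℂ B ((S).lTensor B q) := by
      intro q
      induction q with
      | zero => simp
      | add x y hx hy => simp only [LinearMap.map_add, mul_add, hx, hy]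
      | tmul a b => simp [mul_assoc]
    have h3 := h2 (Δ l)
    rw [h1, mul_antipode, hlt, mul_one, map_zero, map_zero] at h3
    exact antipode_injective (h3.symm.trans (map_zero _).symm)
  have hinj : Function.Injective (LinearMap.mulRight ℂ k) := by
    rw [injective_iff_map_eq_zero]
    intro y hy
    refine hFdef y ?_
    rw [LinearMap.mulRight_apply] at hy
    rw [hy, zero_mul, map_zero]
  have hsurj := LinearMap.injective_iff_surjective.1 hinj
  -- By finite dimension, injectivity of right multiplication by k makes k invertible, with inverse
  -- y.
  obtain ⟨y, hy⟩ := hsurj 1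
  rw [LinearMap.mulRight_apply] at hy
  have hky : k * y = 1 := by
    apply hinj
    simp only [LinearMap.mulRight_apply, mul_assoc, hy, mul_one, one_mul]
  have hks : star k = k := by
    conv_rhs => rw [hk, ← hΔs]
    rw [hk]
    generalize Δ l = q
    induction q with
    | zero => simp
    | add x y hx hy => simp only [LinearMap.map_add, LinearEquiv.map_add, star_add, hx, hy]
    | tmul a b => simp [hτ.map_star]
  -- The factor S(y) normalizes the slice of Δ(l) to 1. The invariant functional is h = lam ∘ S,
  -- that is, b ↦ τ(by).
  let lam : B →ₗ[ℂ] ℂ := τ ∘ₗ LinearMap.mulLeft ℂ (S y)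
  have hlam1 : TensorProduct.lid ℂ B (lam.rTensor B (Δ l)) = 1 := by rw [hslice, ← hk, hy]
  let h : B →ₗ[ℂ] ℂ := τ ∘ₗ LinearMap.mulRight ℂ y
  have hlam : ∀ b, lam (S b) = h b := fun b => by
    simp only [lam, h, LinearMap.comp_apply, LinearMap.mulLeft_apply, LinearMap.mulRight_apply,
      ← antipode_mul]
    exact regTrace_antipode _
  -- Every element has the form ck, and for these h(z*z) reduces to τ(ckc*), already known to be
  -- positive and definite.
  have hform : ∀ c : B, h (star (c * k) * (c * k)) = τ (c * k * star c) := fun c => by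
    simp only [h, LinearMap.comp_apply, LinearMap.mulRight_apply, star_mul, hks]
    rw [mul_assoc (k * star c), mul_assoc c, hky, mul_one, hτd, regTrace_mul_comm, ← mul_assoc]
  refine ⟨h, ⟨fun z => ?_, fun z hz => ?_⟩, ?_⟩
  · obtain ⟨c, rfl⟩ := hsurj z
    rw [LinearMap.mulRight_apply, hform, hF]
    exact hτ.tensor_nonneg _
  · obtain ⟨c, rfl⟩ := hsurj z
    rw [LinearMap.mulRight_apply, hform] at hz
    rw [LinearMap.mulRight_apply, hFdef c hz, zero_mul]
  -- the invariance, first for the functional `lam`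
  have hT : Function.Surjective fun b : B =>
      TensorProduct.rid ℂ B ((τ ∘ₗ LinearMap.mulRight ℂ b).lTensor B (Δ l)) := by
    let T' : B →ₗ[ℂ] B := (TensorProduct.rid ℂ B).toLinearMap ∘ₗ
      LinearMap.applyₗ (Δ l) ∘ₗ LinearMap.lTensorHom B ∘ₗ
        LinearMap.llcomp ℂ B B ℂ τ ∘ₗ (LinearMap.mul ℂ B).flip
    have hT' : ∀ b, T' b = TensorProduct.rid ℂ B ((τ ∘ₗ LinearMap.mulRight ℂ b).lTensor B (Δ l)) :=
      fun b => rfl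
    suffices h0 : Function.Surjective T' from h0
    rw [← LinearMap.injective_iff_surjective, injective_iff_map_eq_zero]
    intro b hb
    have h1 : ∀ a, τ (a * T' b) =
        τ (TensorProduct.lid ℂ B ((τ ∘ₗ LinearMap.mulLeft ℂ a).rTensor B (Δ l)) * b) := by
      intro a
      rw [hT']
      generalize Δ l = q
      induction q with
      | zero => simp
      | add x y hx hy => simp only [LinearMap.map_add, LinearEquiv.map_add, mul_add, add_mul, hx, hy]
      | tmul x y => simp [mul_comm]
    refine hτ.separates fun a => ?_
    obtain ⟨c, rfl⟩ := hsurj a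
    have h2 := h1 (S c)
    rw [hb, hslice, mul_zero, map_zero, ← hk] at h2
    exact h2.symm
  -- Invariance of lam. For x a slice of Δ(l), coassociativity moves Δ to the other leg, where
  -- `hslice` and the normalization replace the inner slice by d.
  have hinv : ∀ d x : B, TensorProduct.lid ℂ B ((lam ∘ₗ LinearMap.mulLeft ℂ (S d)).rTensor B (Δ x)) =
      TensorProduct.rid ℂ B ((lam ∘ₗ LinearMap.mulRight ℂ x ∘ₗ S).lTensor B (Δ d)) := by
    intro d x
    obtain ⟨b, rfl⟩ := hT x
    set ψ : B →ₗ[ℂ] ℂ := τ ∘ₗ LinearMap.mulRight ℂ b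
    set G : B ⊗[ℂ] B →ₗ[ℂ] B := (TensorProduct.rid ℂ B).toLinearMap ∘ₗ ψ.lTensor B with hG
    have hr : lam ∘ₗ LinearMap.mulRight ℂ (TensorProduct.rid ℂ B (ψ.lTensor B (Δ l))) ∘ₗ S = ψ := by
      ext e
      have : ∀ q : B ⊗[ℂ] B, lam (S e * TensorProduct.rid ℂ B (ψ.lTensor B q)) =
          ψ (TensorProduct.lid ℂ B ((lam ∘ₗ LinearMap.mulLeft ℂ (S e)).rTensor B q)) := by
        intro q
        induction q with
        | zero => simp
        | add x y hx hy => simp only [LinearMap.map_add, LinearEquiv.map_add, mul_add, hx, hy]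
        | tmul x y => simp [mul_comm]
      simp only [LinearMap.comp_apply, LinearMap.mulRight_apply]
      rw [this, hslice, hlam1, mul_one]
    have hl1 : ∀ q : B ⊗[ℂ] B, TensorProduct.lid ℂ B ((lam ∘ₗ LinearMap.mulLeft ℂ (S d)).rTensor B
        (Δ (TensorProduct.rid ℂ B (ψ.lTensor B q)))) =
        TensorProduct.lid ℂ B (TensorProduct.map (lam ∘ₗ LinearMap.mulLeft ℂ (S d)) G
          (TensorProduct.assoc ℂ B B B ((Δ).rTensor B q))) := by
      intro q
      induction q with
      | zero => simp
      | add x y hx hy => simp only [LinearMap.map_add, LinearEquiv.map_add, hx, hy]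
      | tmul x y =>
        simp only [LinearMap.lTensor_tmul, TensorProduct.rid_tmul, map_smul, LinearMap.rTensor_tmul]
        generalize Δ x = r
        induction r with
        | zero => simp
        | add x y hx hy => simp only [LinearMap.map_add, LinearEquiv.map_add, add_tmul, smul_add, hx, hy]
        | tmul x z => simp [hG, smul_smul]
    have hl2 : ∀ q : B ⊗[ℂ] B, TensorProduct.lid ℂ B
        (TensorProduct.map (lam ∘ₗ LinearMap.mulLeft ℂ (S d)) G ((Δ).lTensor B q)) =
        G (Δ (TensorProduct.lid ℂ B ((lam ∘ₗ LinearMap.mulLeft ℂ (S d)).rTensor B q))) := by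
      intro q
      induction q with
      | zero => simp
      | add x y hx hy => simp only [LinearMap.map_add, LinearEquiv.map_add, hx, hy]
      | tmul x y => simp
    rw [hr]
    change TensorProduct.lid ℂ B ((lam ∘ₗ LinearMap.mulLeft ℂ (S d)).rTensor B
        (Δ (TensorProduct.rid ℂ B (ψ.lTensor B (Δ l))))) = _
    rw [hl1, Coalgebra.coassoc_apply, hl2, hslice, hlam1, mul_one]
    rfl
  intro z d
  -- Taking x = S(z) passes from lam to h = lam ∘ S; the flip in Δ(S(z)) produces the stated order
  -- of the legs.
  have h1 := hinv d (S z)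
  rw [comul_antipode] at h1
  have h2 : lam ∘ₗ LinearMap.mulRight ℂ (S z) ∘ₗ S = h ∘ₗ LinearMap.mulLeft ℂ z := by
    ext e
    simp only [LinearMap.comp_apply, LinearMap.mulRight_apply, LinearMap.mulLeft_apply,
      ← antipode_mul, hlam]
  have h3 : ∀ q : B ⊗[ℂ] B, TensorProduct.lid ℂ B ((lam ∘ₗ LinearMap.mulLeft ℂ (S d)).rTensor B
      (TensorProduct.map S S (TensorProduct.comm ℂ B B q))) =
      TensorProduct.rid ℂ B (TensorProduct.map S (h ∘ₗ LinearMap.mulRight ℂ d) q) := by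
    intro q
    induction q with
    | zero => simp
    | add x y hx hy => simp only [LinearMap.map_add, LinearEquiv.map_add, hx, hy]
    | tmul x y =>
      simp [← antipode_mul, hlam]
  rw [h2, h3] at h1
  exact h1.symm

end Haar

end WeakHopfCStarAlgebra

open WeakHopfCStarAlgebra

/-! ### Matrix coefficients -/

section Coefficients

variable {B : Type u} [CStarAlgebra B] [WeakHopfCStarAlgebra B]

local notation "Δ" => (CoalgebraStruct.comul : B →ₗ[ℂ] B ⊗[ℂ] B)
local notation "ε" => (CoalgebraStruct.counit : B →ₗ[ℂ] ℂ)
local notation "S" => (antipode : B →ₗ[ℂ] B)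

/-- Stated for a bare linear map with coassociativity at one vector, because `unitarize` needs it
before a unitary structure is available. -/
lemma comul_slice {H : Type*} [AddCommGroup H] [Module ℂ H] {δ : H →ₗ[ℂ] H ⊗[ℂ] B} {v : H}
    (h : TensorProduct.assoc ℂ H B B (δ.rTensor B (δ v)) = (Δ).lTensor H (δ v))
    (φ : Module.Dual ℂ H) : Δ (TensorProduct.lid ℂ B (φ.rTensor B (δ v))) =
      ((TensorProduct.lid ℂ B).toLinearMap ∘ₗ φ.rTensor B ∘ₗ δ).rTensor B (δ v) := by
  have h1 (t : H ⊗[ℂ] B) : Δ (TensorProduct.lid ℂ B (φ.rTensor B t)) =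
      TensorProduct.lid ℂ (B ⊗[ℂ] B) (φ.rTensor (B ⊗[ℂ] B) ((Δ).lTensor _ t)) := by
    induction t with
    | zero => simp
    | add x y hx hy => simp only [map_add, hx, hy]
    | tmul x y => simp
  have h2 (t : (H ⊗[ℂ] B) ⊗[ℂ] B) : TensorProduct.lid ℂ (B ⊗[ℂ] B)
      (φ.rTensor (B ⊗[ℂ] B) (TensorProduct.assoc ℂ _ B B t)) =
      ((TensorProduct.lid ℂ B).toLinearMap ∘ₗ φ.rTensor B).rTensor B t := by
    induction t with
    | zero => simp
    | add x y hx hy => simp only [map_add, hx, hy]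
    | tmul x y =>
      induction x with
      | zero => simp
      | add x y hx hy => simp only [map_add, add_tmul, hx, hy]
      | tmul x z => simp [smul_tmul']
  rw [h1, ← h, h2, ← LinearMap.rTensor_comp_apply]
  rfl

lemma counit_slice {H : Type*} [AddCommGroup H] [Module ℂ H] (φ : Module.Dual ℂ H)
    (t : H ⊗[ℂ] B) : ε (TensorProduct.lid ℂ B (φ.rTensor B t)) = φ (epsR B _ t) := by
  induction t with
  | zero => simp
  | add x y hx hy => simp only [map_add, hx, hy]
  | tmul x y => simp [mul_comm]

lemma exists_eq_bar {H : Type u} [NormedAddCommGroup H] [InnerProductSpace ℂ H]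
    [FiniteDimensional ℂ H] (φ : Module.Dual ℂ H) : ∃ ξ : H, φ = Reconstruction.bar ξ := by
  have := FiniteDimensional.complete ℂ H
  obtain ⟨ξ, hξ⟩ := (InnerProductSpace.toDual ℂ H).surjective (LinearMap.toContinuousLinearMap φ)
  exact ⟨ξ, LinearMap.ext fun v => (DFunLike.congr_fun hξ v).symm⟩

namespace UCorep

open Reconstruction (bar)

/-- The matrix coefficient `φ(v¹) v²`. -/
def coef (U : UCorep B) : Module.Dual ℂ U.carrier →ₗ[ℂ] U.carrier →ₗ[ℂ] B where
  toFun φ := (TensorProduct.lid ℂ B).toLinearMap ∘ₗ φ.rTensor B ∘ₗ U.coact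
  map_add' φ ψ := by ext; simp [LinearMap.rTensor_add]
  map_smul' c φ := by ext; simp [LinearMap.rTensor_smul]

lemma coef_apply (U : UCorep B) (φ : Module.Dual ℂ U.carrier) (v : U.carrier) :
    coef U φ v = TensorProduct.lid ℂ B (φ.rTensor B (U.coact v)) := rfl

lemma coef_bar (U : UCorep B) (w v : U.carrier) :
    coef U (bar w) v = innerSlice w (U.coact v) := rfl

lemma coef_bar_eq (U : UCorep B) (w v : U.carrier) :
    coef U (bar w) v = star (S (coef U (bar v) w)) := U.isUnitary.unitary v w

lemma comul_coef (U : UCorep B) (φ : Module.Dual ℂ U.carrier) (v : U.carrier) :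
    Δ (coef U φ v) = (coef U φ).rTensor B (U.coact v) := comul_slice (U.isUnitary.coassoc v) φ

lemma counit_coef (U : UCorep B) (φ : Module.Dual ℂ U.carrier) (v : U.carrier) :
    ε (coef U φ v) = φ v := by
  rw [coef_apply, counit_slice, U.counit]

lemma coef_lin {U V : UCorep B} (f : U ⟶ V) (φ : Module.Dual ℂ V.carrier) (v : U.carrier) :
    coef V φ (lin f v) = coef U (φ ∘ₗ lin f) v := by
  rw [coef_apply, coef_apply, colin, ← LinearMap.rTensor_comp_apply]

lemma coact_eq_sum (U : UCorep B) {J : Type*} [Fintype J] (e : OrthonormalBasis J ℂ U.carrier)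
    (v : U.carrier) : U.coact v = ∑ k, e k ⊗ₜ[ℂ] coef U (bar (e k)) v := by
  have key (t : U.carrier ⊗[ℂ] B) : t = ∑ i, e i ⊗ₜ[ℂ] innerSlice (e i) t := by
    induction t with
    | zero => simp
    | add x y hx hy =>
      simp only [map_add, tmul_add, Finset.sum_add_distrib]
      rw [← hx, ← hy]
    | tmul x b =>
      simp only [innerSlice_tmul, tmul_smul, smul_tmul', ← sum_tmul]
      rw [OrthonormalBasis.sum_repr' e x]
  exact key _

lemma comul_coef_eq_sum (U : UCorep B) {J : Type*} [Fintype J]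
    (e : OrthonormalBasis J ℂ U.carrier) (φ : Module.Dual ℂ U.carrier) (v : U.carrier) :
    Δ (coef U φ v) = ∑ k, coef U φ (e k) ⊗ₜ[ℂ] coef U (bar (e k)) v := by
  rw [comul_coef, coact_eq_sum U e, map_sum]
  rfl

lemma rAct_eq_sum (U : UCorep B) {J : Type*} [Fintype J] (e : OrthonormalBasis J ℂ U.carrier)
    (v : U.carrier) (z : B) : rAct U v z = ∑ k, ε (coef U (bar (e k)) v * z) • e k := by
  rw [rAct, coact_eq_sum U e, map_sum, map_sum]
  simp

lemma lAct_eq_sum (U : UCorep B) {J : Type*} [Fintype J] (e : OrthonormalBasis J ℂ U.carrier)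
    (v : U.carrier) (z : B) : lAct U z v = ∑ k, ε (z * coef U (bar (e k)) v) • e k := by
  rw [lAct, coact_eq_sum U e, map_sum, map_sum]
  simp

/-- The coefficient of the tensor product of two functionals. -/
lemma lid_rTensor_legMul {H K : Type*} [AddCommGroup H] [Module ℂ H] [AddCommGroup K]
    [Module ℂ K] (φ : Module.Dual ℂ H) (ψ : Module.Dual ℂ K) (t : H ⊗[ℂ] B) (r : K ⊗[ℂ] B) :
    TensorProduct.lid ℂ B ((TensorProduct.dualDistrib ℂ H K (φ ⊗ₜ ψ)).rTensor B
      (legMul B H K t r)) =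
      TensorProduct.lid ℂ B (φ.rTensor B t) * TensorProduct.lid ℂ B (ψ.rTensor B r) := by
  induction t with
  | zero => simp
  | add x y hx hy => simp only [map_add, LinearMap.add_apply, hx, hy, add_mul]
  | tmul x b =>
    induction r with
    | zero => simp
    | add x y hx hy => simp only [map_add, hx, hy, mul_add]
    | tmul y c => simp [smul_smul, mul_comm]

lemma tensorCoact_coef (U V : UCorep B) (φ : Module.Dual ℂ U.carrier)
    (ψ : Module.Dual ℂ V.carrier) (t : U.carrier ⊗[ℂ] V.carrier) :
    TensorProduct.lid ℂ B ((TensorProduct.dualDistrib ℂ _ _ (φ ⊗ₜ ψ)).rTensor B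
      (tensorCoact U.coact V.coact t)) =
      LinearMap.mul' ℂ B (TensorProduct.map (coef U φ) (coef V ψ) t) := by
  induction t with
  | zero => simp
  | add x y hx hy => simp only [map_add, hx, hy]
  | tmul x y =>
    rw [tensorCoact_tmul, lid_rTensor_legMul]
    rfl

/-- The coaction of a tensor product multiplies the B-legs, so coefficients multiply. This is the
origin of the product of A. -/
lemma coef_tensor (U V : UCorep B) (φ : Module.Dual ℂ U.carrier)
    (ψ : Module.Dual ℂ V.carrier) (z : (tensor U V).carrier) :
    coef (tensor U V) (TensorProduct.dualDistrib ℂ _ _ (φ ⊗ₜ ψ) ∘ₗ incl U V) z =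
      LinearMap.mul' ℂ B (TensorProduct.map (coef U φ) (coef V ψ) (incl U V z)) := by
  rw [coef_apply, LinearMap.rTensor_comp_apply, ← incl_coact, tensorCoact_coef]

end UCorep

/-- The projection associated with a unitary coaction is self-adjoint. -/
lemma IsUnitaryCoaction.inner_coactProj {H : Type u} [NormedAddCommGroup H]
    [InnerProductSpace ℂ H] {δ : H →ₗ[ℂ] H ⊗[ℂ] B} (h : IsUnitaryCoaction δ) (v w : H) :
    inner ℂ w (coactProj δ v) = inner ℂ (coactProj δ w) v := by
  have key (v w : H) : ε (innerSlice w (δ v)) = inner ℂ w (coactProj δ v) := by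
    rw [coactProj, LinearMap.comp_apply]
    generalize δ v = t
    induction t with
    | zero => simp
    | add x y hx hy => simp only [map_add, inner_add_right, hx, hy]
    | tmul x b => simp [mul_comm]
  rw [← key, h.unitary, counit_star, counit_antipode, key, inner_conj_symm]

namespace UCorep

/-- P is a self-adjoint idempotent, so the projection onto its range is adjoint to the inclusion. -/
lemma inner_proj (U V : UCorep B) (z : (tensor U V).carrier) (t : U.carrier ⊗[ℂ] V.carrier) :
    inner ℂ z (proj U V t) = inner ℂ (incl U V z) t := by
  change inner ℂ (incl U V z) (coactProj (tensorCoact U.coact V.coact) t) = _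
  rw [(U.isUnitary.tensor V.isUnitary).inner_coactProj, incl_mem]

end UCorep

end Coefficients

/-! ### The regular corepresentation -/

section Regular

variable (B : Type u) [CStarAlgebra B] [WeakHopfCStarAlgebra B]

local notation "Δ" => (CoalgebraStruct.comul : B →ₗ[ℂ] B ⊗[ℂ] B)
local notation "ε" => (CoalgebraStruct.counit : B →ₗ[ℂ] ℂ)
local notation "S" => (antipode : B →ₗ[ℂ] B)

/-- A faithful positive invariant functional on `B`. -/
def haar : B →ₗ[ℂ] ℂ := (exists_haar B).choose

lemma haar_isFaithfulPositive : IsFaithfulPositive (haar B) := (exists_haar B).choose_spec.1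

lemma haar_invariant (z d : B) :
    TensorProduct.rid ℂ B ((haar B ∘ₗ LinearMap.mulLeft ℂ z).lTensor B (Δ d)) =
      TensorProduct.rid ℂ B (TensorProduct.map S (haar B ∘ₗ LinearMap.mulRight ℂ d) (Δ z)) :=
  (exists_haar B).choose_spec.2 z d

/-- `B` as a Hilbert space, with the scalar product `⟨c, b⟩ = h(S(b)*S(c))`. -/
def RegSpace : Type u := B

instance : AddCommGroup (RegSpace B) := inferInstanceAs (AddCommGroup B)
instance : Module ℂ (RegSpace B) := inferInstanceAs (Module ℂ B)
instance : FiniteDimensional ℂ (RegSpace B) := inferInstanceAs (FiniteDimensional ℂ B)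

namespace RegSpace

/-- The identification with `B`. -/
def toB : RegSpace B ≃ₗ[ℂ] B := LinearEquiv.refl ℂ B

/-- The scalar product of the regular corepresentation. -/
abbrev core : InnerProductSpace.Core ℂ (RegSpace B) where
  inner b c := haar B (star (S (toB B b)) * S (toB B c))
  conj_inner_symm x y := by rw [← (haar_isFaithfulPositive B).map_star]; simp
  re_inner_nonneg x := by
    obtain ⟨r, hr, hr'⟩ := (haar_isFaithfulPositive B).nonneg (S (toB B x))
    rw [hr']
    simpa using hr
  add_left x y z := by simp [add_mul]
  smul_left x y r := by simp
  definite x hx := by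
    have := (haar_isFaithfulPositive B).definite _ hx
    exact (toB B).map_eq_zero_iff.1 (antipode_injective (this.trans (map_zero _).symm))

instance : NormedAddCommGroup (RegSpace B) := (core B).toNormedAddCommGroup
instance : InnerProductSpace ℂ (RegSpace B) := InnerProductSpace.ofCore (core B).toCore

lemma inner_def (b c : RegSpace B) :
    inner ℂ b c = haar B (star (S (toB B b)) * S (toB B c)) := rfl

end RegSpace

open RegSpace

/-- The regular coaction. -/
def regCoact : RegSpace B →ₗ[ℂ] RegSpace B ⊗[ℂ] B :=
  (toB B).symm.toLinearMap.rTensor B ∘ₗ Δ ∘ₗ (toB B).toLinearMap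

variable {B}

lemma regCoact_apply (b : RegSpace B) :
    regCoact B b = (toB B).symm.toLinearMap.rTensor B (Δ (toB B b)) := rfl

lemma innerSlice_regCoact (v w : RegSpace B) : innerSlice w (regCoact B v) =
    TensorProduct.lid ℂ B ((haar B ∘ₗ LinearMap.mulLeft ℂ (star (S (toB B w))) ∘ₗ S).rTensor B
      (Δ (toB B v))) := by
  rw [regCoact_apply]
  generalize Δ (toB B v) = t
  induction t with
  | zero => simp
  | add x y hx hy => simp only [map_add, hx, hy]
  | tmul x y => simp [inner_def]

/-- Unitarity is the invariance of the functional at z = S(w)* and d = S(v). The antipodes in the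
scalar product interchange the legs of Δ and so adapt the invariance to a right coaction. -/
lemma regCoact_isUnitary : IsUnitaryCoaction (regCoact B) where
  coassoc v := by
    have h1 (t : B ⊗[ℂ] B) : TensorProduct.assoc ℂ _ B B ((regCoact B).rTensor B
        ((toB B).symm.toLinearMap.rTensor B t)) = (toB B).symm.toLinearMap.rTensor (B ⊗[ℂ] B)
          (TensorProduct.assoc ℂ _ B B ((Δ).rTensor B t)) := by
      induction t with
      | zero => simp
      | add x y hx hy => simp only [map_add, hx, hy]
      | tmul x y =>
        simp only [LinearMap.rTensor_tmul, regCoact_apply, LinearEquiv.coe_coe,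
          LinearEquiv.apply_symm_apply]
        generalize Δ x = q
        induction q with
        | zero => simp
        | add x y hx hy => simp only [map_add, add_tmul, hx, hy]
        | tmul x y => simp
    rw [regCoact_apply, h1, Coalgebra.coassoc_apply, ← LinearMap.comp_apply,
      LinearMap.rTensor_comp_lTensor, ← LinearMap.lTensor_comp_rTensor, LinearMap.comp_apply]
  unitary v w := by
    -- The invariance formula yields the desired identity with S applied to both sides.
    apply antipode_injective
    rw [antipode_star_antipode_eq]
    have h := haar_invariant B (star (S (toB B w))) (S (toB B v))
    rw [comul_star, comul_antipode, comul_antipode] at h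
    rw [innerSlice_regCoact, innerSlice_regCoact]
    have h1 (t : B ⊗[ℂ] B) : TensorProduct.rid ℂ B
        ((haar B ∘ₗ LinearMap.mulLeft ℂ (star (S (toB B w)))).lTensor B
          (TensorProduct.map S S (TensorProduct.comm ℂ B B t))) =
        S (TensorProduct.lid ℂ B ((haar B ∘ₗ LinearMap.mulLeft ℂ (star (S (toB B w))) ∘ₗ
          S).rTensor B t)) := by
      induction t with
      | zero => simp
      | add x y hx hy => simp only [map_add, hx, hy]
      | tmul x y => simp
    have h2 (t : B ⊗[ℂ] B) : TensorProduct.rid ℂ B (TensorProduct.map S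
        (haar B ∘ₗ LinearMap.mulRight ℂ (S (toB B v)))
          (star (TensorProduct.map S S (TensorProduct.comm ℂ B B t)))) =
        star (TensorProduct.lid ℂ B ((haar B ∘ₗ LinearMap.mulLeft ℂ (star (S (toB B v))) ∘ₗ
          S).rTensor B t)) := by
      induction t with
      | zero => simp
      | add x y hx hy => simp only [map_add, star_add, hx, hy]
      | tmul x y =>
        simp [antipode_star_antipode_eq, ← (haar_isFaithfulPositive B).map_star]
    rw [h1, h2] at h
    exact h

namespace UCorep

variable (B) in
/-- The regular corepresentation. -/
def reg : UCorep B where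
  carrier := RegSpace B
  coact := regCoact B
  isUnitary := regCoact_isUnitary
  counit v := by rw [regCoact_apply, epsR_rTensor, epsR_comul]; simp

/-- The identification of the space of the regular corepresentation with `B`. -/
def regB : (reg B).carrier ≃ₗ[ℂ] B := RegSpace.toB B

lemma reg_coact (b : (reg B).carrier) :
    (regB (B := B)).toLinearMap.rTensor B ((reg B).coact b) = Δ (regB b) := by
  change (regB (B := B)).toLinearMap.rTensor B (((regB (B := B)).symm.toLinearMap).rTensor B
    (Δ (regB b))) = _
  rw [← LinearMap.rTensor_comp_apply]
  simp

lemma reg_coact_symm (b : B) :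
    (reg B).coact (regB.symm b) = (regB (B := B)).symm.toLinearMap.rTensor B (Δ b) := rfl

lemma inner_reg (b c : (reg B).carrier) :
    inner ℂ b c = haar B (star (S (regB b)) * S (regB c)) := rfl

/-- A linear map to `B` intertwining the coactions, as a morphism to the regular
corepresentation. -/
def toReg {U : UCorep B} (f : U.carrier →ₗ[ℂ] B)
    (hf : ∀ v, Δ (f v) = f.rTensor B (U.coact v)) : U ⟶ reg B :=
  homMk ((regB (B := B)).symm.toLinearMap ∘ₗ f) fun v => by
    rw [LinearMap.comp_apply, LinearEquiv.coe_coe, reg_coact_symm, hf,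
      LinearMap.rTensor_comp_apply]

@[simp] lemma regB_lin_toReg {U : UCorep B} (f : U.carrier →ₗ[ℂ] B)
    (hf : ∀ v, Δ (f v) = f.rTensor B (U.coact v)) (v : U.carrier) :
    regB (lin (toReg f hf) v) = f v := rfl

lemma regB_ext {U : UCorep B} {f g : U ⟶ reg B} (h : ∀ v, regB (lin f v) = regB (lin g v)) :
    f = g := hom_ext (LinearMap.ext fun v => regB.injective (h v))

/-- The matrix coefficients as a morphism to the regular corepresentation. -/
def coefHom (U : UCorep B) (φ : Module.Dual ℂ U.carrier) : U ⟶ reg B :=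
  toReg (coef U φ) (comul_coef U φ)

@[simp] lemma regB_coefHom (U : UCorep B) (φ : Module.Dual ℂ U.carrier) (v : U.carrier) :
    regB (lin (coefHom U φ) v) = coef U φ v := rfl

lemma coefHom_add (U : UCorep B) (φ ψ : Module.Dual ℂ U.carrier) :
    coefHom U (φ + ψ) = coefHom U φ + coefHom U ψ :=
  hom_ext (by rw [coefHom, toReg, lin_homMk, map_add, LinearMap.comp_add]; rfl)

lemma coefHom_smul (U : UCorep B) (c : ℂ) (φ : Module.Dual ℂ U.carrier) :
    coefHom U (c • φ) = c • coefHom U φ :=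
  hom_ext (by rw [coefHom, toReg, lin_homMk, map_smul, LinearMap.comp_smul]; rfl)

lemma comp_coefHom {U V : UCorep B} (f : U ⟶ V) (φ : Module.Dual ℂ V.carrier) :
    f ≫ coefHom V φ = coefHom U (φ ∘ₗ lin f) := regB_ext fun v => coef_lin f φ v

variable (B) in
/-- The counit as a functional on the space of the regular corepresentation. -/
def regCounit : Module.Dual ℂ (reg B).carrier := ε ∘ₗ (regB (B := B)).toLinearMap

lemma coef_regCounit (b : (reg B).carrier) : coef (reg B) (regCounit B) b = regB b := by
  rw [coef_apply, regCounit, LinearMap.rTensor_comp_apply, reg_coact, epsL_comul]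

/-- With naturality of `coefHom` and the lemma below, this gives the bijection between functionals φ
on H_U and morphisms f from U to `reg B`, the inverse being f ↦ ε ∘ f. -/
lemma coefHom_regCounit : coefHom (reg B) (regCounit B) = 𝟙 (reg B) :=
  regB_ext fun v => coef_regCounit v

lemma regCounit_comp_coefHom (U : UCorep B) (φ : Module.Dual ℂ U.carrier) :
    regCounit B ∘ₗ lin (coefHom U φ) = φ := LinearMap.ext fun v => counit_coef U φ v

end UCorep

end Regular

namespace UCorep

open Reconstruction (bar)

variable {B : Type u} [CStarAlgebra B] [WeakHopfCStarAlgebra B] [IsRegularQuantumGroupoid B]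

local notation "Δ" => (CoalgebraStruct.comul : B →ₗ[ℂ] B ⊗[ℂ] B)
local notation "ε" => (CoalgebraStruct.counit : B →ₗ[ℂ] ℂ)
local notation "S" => (antipode : B →ₗ[ℂ] B)

/-! ### The monoidal structure on vectors v ⊗_{B_s} w -/

section Generators

lemma proj_surjective (U V : UCorep B) : Function.Surjective (proj U V) :=
  fun z => ⟨incl U V z, proj_incl U V z⟩

lemma projL_surjective (U V W : UCorep B) : Function.Surjective (projL U V W) :=
  fun z => ⟨inclL U V W z, projL_inclL U V W z⟩

variable (B) in
/-- The inclusion of `B_s`, the space of the unit object, into `B`. -/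
def unitVal : (𝟙_ (UCorep B)).carrier →ₗ[ℂ] B := SourceSpace.val B

lemma unitVal_mem (z : (𝟙_ (UCorep B)).carrier) : unitVal B z ∈ source B := SourceSpace.val_mem z

variable (B) in
/-- The vector `1` of the unit object. -/
def unitVec : (𝟙_ (UCorep B)).carrier := unitOne B

lemma unitVal_unitVec : unitVal B (unitVec B) = 1 := rfl

/-- `v ⊗_{B_s} w` -/
def tmk (U V : UCorep B) : U.carrier →ₗ[ℂ] V.carrier →ₗ[ℂ] (U ⊗ V : UCorep B).carrier :=
  TensorProduct.curry (proj U V)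

lemma tmk_apply (U V : UCorep B) (v : U.carrier) (w : V.carrier) :
    tmk U V v w = proj U V (v ⊗ₜ w) := rfl

/-- Morphisms from a tensor product are determined by their values on `v ⊗_{B_s} w`. -/
lemma tensor_ext {U V W : UCorep B} {f g : (U ⊗ V : UCorep B) ⟶ W}
    (h : ∀ v w, lin f (tmk U V v w) = lin g (tmk U V v w)) : f = g := by
  have h' : lin f ∘ₗ proj U V = lin g ∘ₗ proj U V := TensorProduct.ext' h
  refine hom_ext (LinearMap.ext fun z => ?_)
  obtain ⟨t, rfl⟩ := proj_surjective U V z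
  exact LinearMap.congr_fun h' t

lemma tensor_extL {U V W X : UCorep B} {f g : ((U ⊗ V) ⊗ W : UCorep B) ⟶ X}
    (h : ∀ u v w, lin f (tmk _ _ (tmk _ _ u v) w) = lin g (tmk _ _ (tmk _ _ u v) w)) :
    f = g := by
  have h' : lin f ∘ₗ projL U V W = lin g ∘ₗ projL U V W :=
    TensorProduct.ext_threefold h
  refine hom_ext (LinearMap.ext fun z => ?_)
  obtain ⟨t, rfl⟩ := projL_surjective U V W z
  exact LinearMap.congr_fun h' t

lemma eq_sum_tmk {U V : UCorep B} {z : (U ⊗ V : UCorep B).carrier}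
    {s : Finset (U.carrier × V.carrier)} (hs : incl U V z = ∑ i ∈ s, i.1 ⊗ₜ[ℂ] i.2) :
    z = ∑ i ∈ s, tmk U V i.1 i.2 := by
  have h := proj_incl U V z
  rw [hs, map_sum] at h
  exact h.symm

@[simp] lemma lin_tensorHom_tmk {U V U' V' : UCorep B} (f : U ⟶ U') (g : V ⟶ V') (v : U.carrier)
    (w : V.carrier) : lin (f ⊗ₘ g) (tmk U V v w) = tmk U' V' (lin f v) (lin g w) :=
  lin_tensorMap_proj f g (v ⊗ₜ w)

@[simp] lemma lin_whiskerLeft_tmk (U : UCorep B) {V W : UCorep B} (f : V ⟶ W) (u : U.carrier)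
    (v : V.carrier) : lin (U ◁ f) (tmk U V u v) = tmk U W u (lin f v) :=
  lin_tensorMap_proj (𝟙 U) f (u ⊗ₜ v)

@[simp] lemma lin_whiskerRight_tmk {V W : UCorep B} (f : V ⟶ W) (U : UCorep B)
    (v : V.carrier) (u : U.carrier) : lin (f ▷ U) (tmk V U v u) = tmk W U (lin f v) u :=
  lin_tensorMap_proj f (𝟙 U) (v ⊗ₜ u)

@[simp] lemma lin_associator_tmk (U V W : UCorep B) (u : U.carrier) (v : V.carrier)
    (w : W.carrier) : lin (α_ U V W).hom (tmk _ _ (tmk _ _ u v) w) =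
      tmk _ _ u (tmk _ _ v w) := by
  change lin (assoc U V W).hom (projL U V W ((u ⊗ₜ v) ⊗ₜ w)) = projR U V W (u ⊗ₜ (v ⊗ₜ w))
  apply inclR_injective
  rw [inclR_assoc, inclL_projL, inclR_projR]
  exact ((Colin.assoc (δH := U.coact) (δK := V.coact) (δL := W.coact)).proj _).symm

@[simp] lemma lin_associator_inv_tmk (U V W : UCorep B) (u : U.carrier) (v : V.carrier)
    (w : W.carrier) : lin (α_ U V W).inv (tmk _ _ u (tmk _ _ v w)) =
      tmk _ _ (tmk _ _ u v) w := by
  rw [← lin_associator_tmk, ← LinearMap.comp_apply, ← lin_comp, Iso.hom_inv_id, lin_id,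
    LinearMap.id_apply]

@[simp] lemma lin_leftUnitor_tmk (U : UCorep B) (z : (𝟙_ (UCorep B)).carrier) (v : U.carrier) :
    lin (λ_ U).hom (tmk _ _ z v) = lAct U (unitVal B z) v := by
  change lAct' U (incl (unit B) U (proj (unit B) U (z ⊗ₜ v))) = _
  rw [incl_proj, lAct'_coactProj]
  rfl

@[simp] lemma lin_rightUnitor_tmk (U : UCorep B) (v : U.carrier) (z : (𝟙_ (UCorep B)).carrier) :
    lin (ρ_ U).hom (tmk _ _ v z) = rAct U v (unitVal B z) := by
  change rAct' U (incl U (unit B) (proj U (unit B) (v ⊗ₜ z))) = _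
  rw [incl_proj, rAct'_coactProj]
  rfl

lemma lin_rightUnitor_inv (U : UCorep B) (v : U.carrier) :
    lin (ρ_ U).inv v = tmk _ _ v (unitVec B) := rfl

lemma lin_leftUnitor_inv (U : UCorep B) (v : U.carrier) :
    lin (λ_ U).inv v = tmk _ _ (unitVec B) v := rfl

lemma lin_comp_apply {U V W : UCorep B} (f : U ⟶ V) (g : V ⟶ W) (v : U.carrier) :
    lin (f ≫ g) v = lin g (lin f v) := rfl

end Generators

/-! ### The regular corepresentation as an algebra object -/

section RegularAlgebra

/-- Multiplicativity of Δ is exactly colinearity of the product of B. -/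
lemma mul_colin (t : (reg B).carrier ⊗[ℂ] (reg B).carrier) :
    Δ (LinearMap.mul' ℂ B (TensorProduct.map (regB (B := B)).toLinearMap
      (regB (B := B)).toLinearMap t)) =
    (LinearMap.mul' ℂ B ∘ₗ TensorProduct.map (regB (B := B)).toLinearMap
      (regB (B := B)).toLinearMap).rTensor B (tensorCoact (reg B).coact (reg B).coact t) := by
  have h (p q : (reg B).carrier ⊗[ℂ] B) : (LinearMap.mul' ℂ B ∘ₗ
      TensorProduct.map (regB (B := B)).toLinearMap
      (regB (B := B)).toLinearMap).rTensor B (legMul B _ _ p q) =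
      (regB (B := B)).toLinearMap.rTensor B p * (regB (B := B)).toLinearMap.rTensor B q := by
    induction p with
    | zero => simp
    | add x y hx hy => simp only [map_add, LinearMap.add_apply, add_mul, hx, hy]
    | tmul x b =>
      induction q with
      | zero => simp
      | add x y hx hy => simp only [map_add, mul_add, hx, hy]
      | tmul y c => simp
  induction t with
  | zero => simp
  | add x y hx hy => simp only [map_add, hx, hy]
  | tmul x y =>
    rw [tensorCoact_tmul, h, reg_coact, reg_coact, ← comul_mul]
    simp

variable (B) in
/-- The product of `B`, as a morphism. -/
def regMul : reg B ⊗ reg B ⟶ reg B :=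
  toReg (LinearMap.mul' ℂ B ∘ₗ TensorProduct.map (regB (B := B)).toLinearMap
    (regB (B := B)).toLinearMap ∘ₗ incl (reg B) (reg B)) fun v => by
      refine (mul_colin (incl (reg B) (reg B) v)).trans ?_
      rw [incl_coact, ← LinearMap.rTensor_comp_apply]
      rfl

/-- A colinear map into a counital comodule absorbs the projection P, so the product of B can be
computed on any representative in the full tensor product. -/
lemma regMul_proj (t : (reg B).carrier ⊗[ℂ] (reg B).carrier) :
    regB (lin (regMul B) (proj (reg B) (reg B) t)) =
      LinearMap.mul' ℂ B (TensorProduct.map (regB (B := B)).toLinearMap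
        (regB (B := B)).toLinearMap t) := by
  have h := proj_comm (δ := tensorCoact (reg B).coact (reg B).coact) (δ' := (reg B).coact)
    (f := (regB (B := B)).symm.toLinearMap ∘ₗ LinearMap.mul' ℂ B ∘ₗ
      TensorProduct.map (regB (B := B)).toLinearMap (regB (B := B)).toLinearMap) (fun v => by
      rw [LinearMap.comp_apply, LinearEquiv.coe_coe, reg_coact_symm, LinearMap.rTensor_comp_apply]
      exact congrArg _ (mul_colin v)) t
  rw [proj_eq] at h
  exact congrArg regB h.symm

@[simp] lemma regMul_tmk (b c : (reg B).carrier) :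
    regB (lin (regMul B) (tmk _ _ b c)) = regB b * regB c := by
  rw [tmk_apply, regMul_proj]
  simp

variable (B) in
/-- The inclusion of `B_s` into `B`, as a morphism. -/
def regUnit : 𝟙_ (UCorep B) ⟶ reg B :=
  toReg (U := unit B) (SourceSpace.val B) fun v => (val_sourceCoact v).symm

@[simp] lemma regB_regUnit (z : (𝟙_ (UCorep B)).carrier) :
    regB (lin (regUnit B) z) = unitVal B z := rfl

lemma regMul_assoc : regMul B ▷ reg B ≫ regMul B =
    (α_ (reg B) (reg B) (reg B)).hom ≫ reg B ◁ regMul B ≫ regMul B := by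
  refine tensor_extL fun a b c => regB.injective ?_
  simp [mul_assoc]

lemma coef_reg_lAct {z : B} (hz : z ∈ source B) (b : (reg B).carrier) :
    regB (lAct (reg B) z b) = z * regB b := by
  rw [lAct, ← LinearEquiv.coe_coe, ← epsR_rTensor, ← LinearMap.comp_apply (LinearMap.rTensor _ _),
    LinearMap.rTensor_comp_lTensor, ← LinearMap.lTensor_comp_rTensor,
    LinearMap.comp_apply (LinearMap.lTensor _ _), reg_coact, epsR_mulLeft hz]
  rfl

lemma coef_reg_rAct {z : B} (hz : z ∈ source B) (b : (reg B).carrier) :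
    regB (rAct (reg B) b z) = regB b * z := by
  rw [rAct, ← LinearEquiv.coe_coe, ← epsR_rTensor, ← LinearMap.comp_apply (LinearMap.rTensor _ _),
    LinearMap.rTensor_comp_lTensor, ← LinearMap.lTensor_comp_rTensor,
    LinearMap.comp_apply (LinearMap.lTensor _ _), reg_coact, epsR_mulRight hz]
  rfl

lemma whiskerLeft_regUnit : reg B ◁ regUnit B ≫ regMul B = (ρ_ (reg B)).hom := by
  refine tensor_ext fun b z => regB.injective ?_
  simp [coef_reg_rAct (unitVal_mem z)]

lemma regUnit_whiskerRight : regUnit B ▷ reg B ≫ regMul B = (λ_ (reg B)).hom := by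
  refine tensor_ext fun b z => regB.injective ?_
  simp [coef_reg_lAct (unitVal_mem b)]

/-- Coefficients of tensor products are products of coefficients; this is what turns the product of
A into the product of the algebra object. -/
lemma coefHom_dualMul (U V : UCorep B) (φ : Module.Dual ℂ U.carrier)
    (ψ : Module.Dual ℂ V.carrier) :
    coefHom (U ⊗ V) (Reconstruction.dualMul U V φ ψ) =
      (coefHom U φ ⊗ₘ coefHom V ψ) ≫ regMul B := by
  refine regB_ext fun z => ?_
  obtain ⟨s, hs⟩ := TensorProduct.exists_finset (incl U V z)
  refine (coef_tensor U V φ ψ z).trans ?_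
  rw [hs, eq_sum_tmk hs]
  simp [map_sum]

lemma coefHom_unitOne : coefHom (𝟙_ (UCorep B)) (bar (unitOne B)) = regUnit B := by
  refine regB_ext fun z => ?_
  refine (innerSlice_sourceCoact z (SourceSpace.one B)).trans ?_
  rw [SourceSpace.val_one, antipode_one, star_one, mul_one]
  rfl

/-- The adjoint of right multiplication on the regular corepresentation. -/
lemma inner_regMul (c b : (reg B).carrier) (x : B) :
    inner ℂ c (regB.symm (regB b * x)) = inner ℂ (regB.symm (regB c * star (S (S x)))) b := by
  rw [inner_reg, inner_reg]
  simp only [LinearEquiv.apply_symm_apply, antipode_mul, antipode_star_antipode_eq, star_mul,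
    star_star, mul_assoc]

lemma inner_mul_left (c b : (reg B).carrier) (x : B) :
    inner ℂ (regB.symm (regB c * x)) b = inner ℂ c (regB.symm (regB b * star (S (S x)))) := by
  have h : star (S (S (star (S (S x))))) = x := by
    rw [antipode_star_antipode_eq, antipode_star_antipode_eq, star_star]
  rw [inner_regMul, h]

end RegularAlgebra

/-! ### Morphisms to the unit object as invariant pairings -/

section Pairing

/-- The bilinear form `(v, w) ↦ ε(f(v ⊗_{B_s} w))` of a morphism to the unit object. -/
def pairForm {U V : UCorep B} (f : (U ⊗ V : UCorep B) ⟶ 𝟙_ (UCorep B)) :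
    U.carrier →ₗ[ℂ] Module.Dual ℂ V.carrier :=
  (tmk U V).compr₂ (ε ∘ₗ unitVal B ∘ₗ lin f)

variable {U V : UCorep B} (f : (U ⊗ V : UCorep B) ⟶ 𝟙_ (UCorep B))

/-- The `B_s`-valued form of a morphism to the unit object. -/
def pairVal (v : U.carrier) (w : V.carrier) : B := unitVal B (lin f (tmk U V v w))

lemma pairVal_mem (v : U.carrier) (w : V.carrier) : pairVal f v w ∈ source B :=
  unitVal_mem _

lemma pairForm_apply (v : U.carrier) (w : V.carrier) : pairForm f v w = ε (pairVal f v w) := rfl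

/-- Applying ε ⊗ id to the colinearity of f recovers the B_s-valued form from the scalar one: f(v,
w) = ε(f(v¹, w¹))v²w². -/
lemma pairVal_eq_sum {J K : Type*} [Fintype J] [Fintype K] (e : OrthonormalBasis J ℂ U.carrier)
    (e' : OrthonormalBasis K ℂ V.carrier) (v : U.carrier) (w : V.carrier) :
    pairVal f v w = ∑ j, ∑ k, pairForm f (e j) (e' k) •
      (coef U (bar (e j)) v * coef V (bar (e' k)) w) := by
  have h1 : Δ (pairVal f v w) = (unitVal B).rTensor B
      ((𝟙_ (UCorep B)).coact (lin f (tmk U V v w))) := (val_sourceCoact _).symm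
  have h2 : (U ⊗ V : UCorep B).coact (tmk U V v w) = (proj U V).rTensor B
      (tensorCoact U.coact V.coact (v ⊗ₜ w)) := coact_proj U V _
  rw [← epsL_comul (pairVal f v w), h1, colin, h2, tensorCoact_tmul, coact_eq_sum U e,
    coact_eq_sum V e']
  simp only [map_sum, LinearMap.sum_apply, legMul_tmul]
  rw [Finset.sum_comm]
  rfl

/-- Inserting the expansion of the form into ε(f(v¹, w))v² leaves terms ε(a₁b)a₂, which are aε_t(b).
-/
lemma coef_pairForm_flip {J K : Type*} [Fintype J] [Fintype K]
    (e : OrthonormalBasis J ℂ U.carrier) (e' : OrthonormalBasis K ℂ V.carrier) (v : U.carrier)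
    (w : V.carrier) :
    coef U ((pairForm f).flip w) v = ∑ j, ∑ k, pairForm f (e j) (e' k) •
      (coef U (bar (e j)) v * targetCounital (coef V (bar (e' k)) w)) := by
  simp only [mul_target, comul_coef_eq_sum U e, map_sum, LinearMap.rTensor_tmul,
    TensorProduct.lid_tmul, LinearMap.comp_apply, LinearMap.mulRight_apply, Finset.smul_sum,
    smul_smul]
  rw [coef_apply, coact_eq_sum U e, map_sum, map_sum]
  simp only [LinearMap.rTensor_tmul, TensorProduct.lid_tmul, LinearMap.flip_apply]
  simp only [pairForm_apply f _ w, pairVal_eq_sum f e e' _ w, map_sum, map_smul, Finset.sum_smul,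
    smul_eq_mul]
  rw [Finset.sum_comm]
  refine Finset.sum_congr rfl fun j _ => ?_
  rw [Finset.sum_comm]

lemma counit_mul_coef_pairForm_flip (b : B) (v : U.carrier) (w : V.carrier) :
    ε (b * coef U ((pairForm f).flip w) v) = ε (b * pairVal f v w) := by
  rw [coef_pairForm_flip f (stdOrthonormalBasis ℂ _) (stdOrthonormalBasis ℂ _),
    pairVal_eq_sum f (stdOrthonormalBasis ℂ _) (stdOrthonormalBasis ℂ _)]
  simp only [Finset.mul_sum, map_sum, mul_smul_comm, map_smul, ← mul_assoc, counit_mul_target]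

/-- With ε_t(b) = b₁S(b₂), the preceding formula collects into f(v, w¹)S(w²), where f still takes
values in B_s. -/
lemma coef_pairForm_flip_eq_sum {K : Type*} [Fintype K]
    (e' : OrthonormalBasis K ℂ V.carrier) (v : U.carrier) (w : V.carrier) :
    coef U ((pairForm f).flip w) v = ∑ m, pairVal f v (e' m) * S (coef V (bar (e' m)) w) := by
  have e := stdOrthonormalBasis ℂ U.carrier
  rw [coef_pairForm_flip f e e']
  simp only [← mul_antipode, comul_coef_eq_sum V e', map_sum, LinearMap.lTensor_tmul,
    LinearMap.mul'_apply, pairVal_eq_sum f e e' v, Finset.sum_mul, Finset.mul_sum, Finset.smul_sum,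
    smul_mul_assoc, mul_assoc]
  symm
  rw [Finset.sum_comm]
  refine Finset.sum_congr rfl fun j _ => ?_
  rw [Finset.sum_comm]

/-- A morphism `U ⊗ V → 1` intertwines the coefficients of `U` with the contragredient ones of
`V`. -/
theorem coef_pairForm (v : U.carrier) (w : V.carrier) :
    coef U ((pairForm f).flip w) v = S (coef V (pairForm f v) w) := by
  have e := stdOrthonormalBasis ℂ U.carrier
  have e' := stdOrthonormalBasis ℂ V.carrier
  obtain ⟨s, hs⟩ := TensorProduct.exists_finset (Δ (1 : B))
  rw [coef_pairForm_flip_eq_sum f e']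
  -- To replace the B_s-value by its counit, write z = ε(z1₁)S(1₂) and absorb S(1₂) into the
  -- antipode on its right.
  have h1 (m) : pairVal f v (e' m) * S (coef V (bar (e' m)) w) =
      ∑ i ∈ s, ε (pairVal f v (e' m) * i.1) • S (coef V (bar (e' m)) w * i.2) := by
    conv_lhs => rw [← antipode_leg (pairVal_mem f v (e' m)) hs]
    simp only [Finset.sum_mul, smul_mul_assoc, antipode_mul]
  -- The inserted copy of Δ(1) disappears again, by Δ(b)Δ(1) = Δ(b).
  have h2 (j k) : ∑ m, ∑ i ∈ s, ε (coef U (bar (e j)) v * coef V (bar (e' k)) (e' m) * i.1) •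
      S (coef V (bar (e' m)) w * i.2) =
      ∑ m, ε (coef U (bar (e j)) v * coef V (bar (e' k)) (e' m)) • S (coef V (bar (e' m)) w) := by
    have h := congrArg (fun t => TensorProduct.lid ℂ B (TensorProduct.map
      (ε ∘ₗ LinearMap.mulLeft ℂ (coef U (bar (e j)) v)) S t))
      (comul_mul_one (coef V (bar (e' k)) w))
    simp only [comul_coef_eq_sum V e', hs, Finset.sum_mul_sum, map_sum,
      Algebra.TensorProduct.tmul_mul_tmul, TensorProduct.map_tmul, TensorProduct.lid_tmul,
      LinearMap.comp_apply, LinearMap.mulLeft_apply] at h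
    simpa only [mul_assoc] using h
  simp only [h1]
  rw [coef_apply, coact_eq_sum V e', map_sum, map_sum, map_sum]
  simp only [LinearMap.rTensor_tmul, TensorProduct.lid_tmul, map_smul, pairForm_apply f v]
  simp only [pairVal_eq_sum f e e' v, Finset.sum_mul, smul_mul_assoc, map_sum, map_smul,
    Finset.sum_smul, smul_eq_mul, mul_smul]
  have h3 : ∀ F : (Fin (Module.finrank ℂ V.carrier)) → (B × B) →
      (Fin (Module.finrank ℂ U.carrier)) → (Fin (Module.finrank ℂ V.carrier)) → B,
      ∑ m, ∑ i ∈ s, ∑ j, ∑ k, F m i j k = ∑ j, ∑ k, ∑ m, ∑ i ∈ s, F m i j k := by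
    intro F
    calc _ = ∑ m, ∑ j, ∑ k, ∑ i ∈ s, F m i j k := by
          refine Finset.sum_congr rfl fun m _ => ?_
          rw [Finset.sum_comm]
          refine Finset.sum_congr rfl fun j _ => ?_
          rw [Finset.sum_comm]
      _ = _ := by
          rw [Finset.sum_comm]
          refine Finset.sum_congr rfl fun j _ => ?_
          rw [Finset.sum_comm]
  rw [h3]
  simp only [← Finset.smul_sum, h2]
  simp only [Finset.smul_sum]
  symm
  rw [Finset.sum_comm]
  refine Finset.sum_congr rfl fun j _ => ?_
  rw [Finset.sum_comm]

end Pairing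

/-! ### Conjugates and the adjoint of multiplication by coefficients -/

section Conjugate

variable (U V : UCorep B) [ExactPairing U V]

/-- The conjugate equation on vectors. -/
lemma conjugate_equation {s : Finset (U.carrier × V.carrier)}
    (hs : incl U V (lin (η_ U V) (unitVec B)) = ∑ i ∈ s, i.1 ⊗ₜ[ℂ] i.2) (u : U.carrier) :
    ∑ i ∈ s, rAct U i.1 (pairVal (ε_ U V) i.2 u) = u := by
  have h := congrArg (fun f => lin (f ≫ (ρ_ U).hom) (tmk _ _ (unitVec B) u))
    (ExactPairing.evaluation_coevaluation U V)
  simp only [Category.assoc, Iso.inv_hom_id, Category.comp_id, lin_comp_apply,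
    lin_whiskerRight_tmk, lin_leftUnitor_tmk, unitVal_unitVec, lAct_one] at h
  rw [eq_sum_tmk hs] at h
  simpa [map_sum, LinearMap.sum_apply, pairVal] using h

/-- The form of the coevaluation is `⟨ξ, v⟩ ↦ ⟨ξ^•, v⟩`. -/
lemma dualBullet_bar (ξ : U.carrier) :
    Reconstruction.dualBullet U V (bar ξ) = pairForm (adj (η_ U V)) ξ := by
  obtain ⟨s, hs⟩ := TensorProduct.exists_finset (incl U V (lin (η_ U V) (unitVec B)))
  ext v
  have h1 : pairForm (adj (η_ U V)) ξ v =
      inner ℂ (unitVec B) (lin (adj (η_ U V)) (tmk U V ξ v)) := by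
    change _ = ε (star 1 * _)
    rw [star_one, one_mul]
    rfl
  have h2 : inner ℂ (lin (η_ U V) (unitVec B)) (tmk U V ξ v) =
      inner ℂ (incl U V (lin (η_ U V) (unitVec B))) (ξ ⊗ₜ[ℂ] v) := inner_proj U V _ _
  rw [h1, lin_adj, LinearMap.adjoint_inner_right, h2, hs]
  change inner ℂ (TensorProduct.lid ℂ V.carrier ((bar ξ).rTensor V.carrier
    (incl U V (lin (η_ U V) (unitVec B))))) v = _
  rw [hs]
  simp [map_sum, sum_inner, TensorProduct.inner_tmul, mul_comm]

/-- `ε(f(ξ^• ⊗ u)) = ⟨u, ξ⟩` for the evaluation `f`. -/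
lemma pairForm_eval_bullet (ξ u : U.carrier) {s : Finset (U.carrier × V.carrier)}
    (hs : incl U V (lin (η_ U V) (unitVec B)) = ∑ i ∈ s, i.1 ⊗ₜ[ℂ] i.2) :
    pairForm (ε_ U V) (∑ i ∈ s, inner ℂ ξ i.1 • i.2) u = inner ℂ ξ u := by
  have hr (v : U.carrier) (z : B) : inner ℂ ξ (rAct U v z) = ε (coef U (bar ξ) v * z) := by
    rw [rAct_eq_sum U (stdOrthonormalBasis ℂ _), coef_apply,
      coact_eq_sum U (stdOrthonormalBasis ℂ _) v]
    simp [map_sum, Finset.sum_mul, mul_comm]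
  -- The conjugate equation is paired with ξ; it remains to replace the B_s-valued evaluation by the
  -- scalar one.
  have h1 := congrArg (inner ℂ ξ) (conjugate_equation U V hs u)
  simp only [inner_sum, hr] at h1
  rw [← h1]
  -- The coevaluation vector is fixed by P, and a product functional after P is ε of the product of
  -- the coefficients.
  have h2 := congrArg (TensorProduct.dualDistrib ℂ _ _ (bar ξ ⊗ₜ (pairForm (ε_ U V)).flip u))
    (incl_mem U V (lin (η_ U V) (unitVec B)))
  have h3 (t : U.carrier ⊗[ℂ] V.carrier) : TensorProduct.dualDistrib ℂ _ _
      (bar ξ ⊗ₜ (pairForm (ε_ U V)).flip u) (coactProj (tensorCoact U.coact V.coact) t) =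
      ε (LinearMap.mul' ℂ B (TensorProduct.map (coef U (bar ξ))
        (coef V ((pairForm (ε_ U V)).flip u)) t)) := by
    rw [← tensorCoact_coef, coactProj, LinearMap.comp_apply]
    generalize tensorCoact U.coact V.coact t = q
    induction q with
    | zero => simp
    | add x y hx hy => simp only [map_add, hx, hy]
    | tmul x b => simp [mul_comm]
  rw [h3, hs] at h2
  simp only [map_sum, TensorProduct.map_tmul, LinearMap.mul'_apply,
    counit_mul_coef_pairForm_flip] at h2
  rw [h2, map_sum, LinearMap.sum_apply]
  simp

/-- The vector representing the functional `v ↦ ε(f(v ⊗ u))`. -/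
lemma coef_bullet (ξ u : U.carrier) {s : Finset (U.carrier × V.carrier)}
    (hs : incl U V (lin (η_ U V) (unitVec B)) = ∑ i ∈ s, i.1 ⊗ₜ[ℂ] i.2) :
    coef V ((pairForm (ε_ U V)).flip u) (∑ i ∈ s, inner ℂ ξ i.1 • i.2) =
      S (coef U (bar ξ) u) := by
  rw [coef_pairForm]
  congr 3
  ext v
  exact pairForm_eval_bullet U V ξ v hs

lemma dualBullet_bar_eq (ξ : U.carrier) {s : Finset (U.carrier × V.carrier)}
    (hs : incl U V (lin (η_ U V) (unitVec B)) = ∑ i ∈ s, i.1 ⊗ₜ[ℂ] i.2) :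
    Reconstruction.dualBullet U V (bar ξ) = bar (∑ i ∈ s, inner ℂ ξ i.1 • i.2) := by
  change innerₛₗ ℂ (TensorProduct.lid ℂ V.carrier ((bar ξ).rTensor V.carrier
    (incl U V (lin (η_ U V) (unitVec B))))) = _
  rw [hs]
  simp [map_sum]

/-- Right multiplication by the coefficients `φ(v¹)v²`. -/
def mulCoef (W : UCorep B) (φ : Module.Dual ℂ W.carrier) : reg B ⊗ W ⟶ reg B :=
  reg B ◁ coefHom W φ ≫ regMul B

@[simp] lemma regB_mulCoef (W : UCorep B) (φ : Module.Dual ℂ W.carrier) (b : (reg B).carrier)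
    (w : W.carrier) : regB (lin (mulCoef W φ) (tmk _ _ b w)) = regB b * coef W φ w := by
  simp [mulCoef]

/-- The adjoint of the right multiplication by coefficients of `U` in terms of the conjugate. -/
theorem adj_mulCoef (φ : Module.Dual ℂ U.carrier) :
    adj (mulCoef U φ) = (ρ_ (reg B)).inv ≫ reg B ◁ adj (ε_ U V) ≫ (α_ _ _ _).inv ≫
      mulCoef V (Reconstruction.dualBullet U V φ) ▷ U := by
  obtain ⟨ξ, rfl⟩ := exists_eq_bar φ
  obtain ⟨s, hs⟩ := TensorProduct.exists_finset (incl U V (lin (η_ U V) (unitVec B)))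
  obtain ⟨r, hr⟩ := TensorProduct.exists_finset (incl V U (lin (adj (ε_ U V)) (unitVec B)))
  refine hom_ext (LinearMap.ext fun c => ?_)
  -- This is the vector ξ^•, read off from a representation of R̄(1) by elementary tensors.
  set x := ∑ i ∈ s, inner ℂ ξ i.1 • i.2 with hx
  have hrc : lin ((ρ_ (reg B)).inv ≫ reg B ◁ adj (ε_ U V) ≫ (α_ _ _ _).inv ≫
      mulCoef V (Reconstruction.dualBullet U V (bar ξ)) ▷ U) c =
      ∑ i ∈ r, tmk (reg B) U (regB.symm (regB c * coef V (bar x) i.1)) i.2 := by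
    simp only [lin_comp_apply, lin_rightUnitor_inv, lin_whiskerLeft_tmk]
    rw [eq_sum_tmk hr]
    simp only [map_sum, lin_associator_inv_tmk, lin_whiskerRight_tmk]
    refine Finset.sum_congr rfl fun i _ => ?_
    congr 2
    apply regB.injective
    rw [regB_mulCoef, LinearEquiv.apply_symm_apply, dualBullet_bar_eq U V ξ hs]
  rw [hrc]
  refine ext_inner_right ℂ fun z => ?_
  obtain ⟨q, hq⟩ := TensorProduct.exists_finset (incl (reg B) U z)
  have hz := eq_sum_tmk hq
  -- The matrix element of the claimed equation on elementary tensors.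
  have key (b : (reg B).carrier) (v : U.carrier) :
      ∑ i ∈ r, inner ℂ (regB.symm (regB c * coef V (bar x) i.1)) b * inner ℂ i.2 v =
        inner ℂ c (regB.symm (regB b * coef U (bar ξ) v)) := by
    -- The functional y ↦ ε(R*(y ⊗ v)) on H_V, for the evaluation R*, is represented by the
    -- corresponding contraction of R(1).
    have hu : bar (∑ i ∈ r, inner ℂ v i.2 • i.1) = (pairForm (ε_ U V)).flip v := by
      ext y
      have h1 : pairForm (ε_ U V) y v =
          inner ℂ (unitVec B) (lin (ε_ U V) (tmk V U y v)) := by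
        change _ = ε (star 1 * _)
        rw [star_one, one_mul]
        rfl
      have h2 : inner ℂ (lin (adj (ε_ U V)) (unitVec B)) (tmk V U y v) =
          inner ℂ (incl V U (lin (adj (ε_ U V)) (unitVec B))) (y ⊗ₜ[ℂ] v) := inner_proj V U _ _
      rw [LinearMap.flip_apply, h1, ← LinearMap.adjoint_inner_left, ← lin_adj, h2, hr]
      simp [map_sum, sum_inner, TensorProduct.inner_tmul, mul_comm]
    -- `coef_bullet` and unitarity of V express the coefficient of U as the adjoint of S² of a
    -- coefficient of V. This S² is the one appearing in the adjoint of right multiplication on `reg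
    -- B`.
    have h3 : coef U (bar ξ) v = star (S (S (coef V (bar x) (∑ i ∈ r, inner ℂ v i.2 • i.1)))) := by
      have h4 := coef_bullet U V ξ v hs
      rw [← hx, ← hu, coef_bar_eq] at h4
      have h6 := congrArg star h4
      rw [star_star] at h6
      rw [h6, antipode_star_antipode_eq, star_star]
    rw [h3, ← inner_mul_left, map_sum]
    simp [map_sum, Finset.mul_sum, mul_comm]
  have hin : inner ℂ (∑ i ∈ r, tmk (reg B) U (regB.symm (regB c * coef V (bar x) i.1)) i.2) z =
      ∑ j ∈ q, ∑ i ∈ r, inner ℂ (regB.symm (regB c * coef V (bar x) i.1)) j.1 *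
        inner ℂ i.2 j.2 := by
    have h5 (a : (reg B).carrier) (v : U.carrier) :
        inner ℂ (tmk (reg B) U a v) z = inner ℂ (a ⊗ₜ[ℂ] v) (incl (reg B) U z) := by
      rw [← inner_conj_symm, ← inner_conj_symm (a ⊗ₜ[ℂ] v)]
      exact congrArg _ (inner_proj (reg B) U z (a ⊗ₜ v))
    rw [sum_inner, Finset.sum_comm]
    refine Finset.sum_congr rfl fun i _ => ?_
    rw [h5, hq, inner_sum]
    simp [TensorProduct.inner_tmul]
  rw [hin, lin_adj, LinearMap.adjoint_inner_left, hz, map_sum, inner_sum]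
  refine Finset.sum_congr rfl fun j _ => ?_
  rw [key, ← regB_mulCoef, LinearEquiv.symm_apply_apply]

end Conjugate

end UCorep

/-! ### Unitarizability of finite dimensional comodules -/

section Unitarizable

variable {B : Type u} [CStarAlgebra B] [WeakHopfCStarAlgebra B]

local notation "Δ" => (CoalgebraStruct.comul : B →ₗ[ℂ] B ⊗[ℂ] B)
local notation "ε" => (CoalgebraStruct.counit : B →ₗ[ℂ] ℂ)
local notation "S" => (antipode : B →ₗ[ℂ] B)

variable {H : Type u} [AddCommGroup H] [Module ℂ H] [FiniteDimensional ℂ H]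

/-- The coefficients of a comodule, as maps to the regular corepresentation. -/
def sliceReg (δ : H →ₗ[ℂ] H ⊗[ℂ] B) (i : Module.Free.ChooseBasisIndex ℂ H) :
    H →ₗ[ℂ] RegSpace B :=
  (RegSpace.toB B).symm.toLinearMap ∘ₗ (TensorProduct.lid ℂ B).toLinearMap ∘ₗ
    ((Module.Free.chooseBasis ℂ H).coord i).rTensor B ∘ₗ δ

/-- The scalar product induced by the regular corepresentation on a comodule. -/
abbrev comoduleCore (δ : H →ₗ[ℂ] H ⊗[ℂ] B) (counit : ∀ v, epsR B H (δ v) = v) :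
    InnerProductSpace.Core ℂ H where
  inner v w := ∑ i, inner ℂ (sliceReg δ i v) (sliceReg δ i w)
  conj_inner_symm x y := by simp [inner_conj_symm]
  re_inner_nonneg x := by
    rw [map_sum]
    exact Finset.sum_nonneg fun i _ => inner_self_nonneg
  add_left x y z := by simp [Finset.sum_add_distrib]
  smul_left x y r := by simp [Finset.mul_sum, mul_comm]
  definite x hx := by
    have h1 : ∀ i, inner ℂ (sliceReg δ i x) (sliceReg δ i x) = (0 : ℂ) := by
      have h2 : ∑ i, ‖sliceReg δ i x‖ ^ 2 = 0 := by
        have h3 := congrArg Complex.re hx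
        simp only [inner_self_eq_norm_sq_to_K] at h3
        rw [Complex.re_sum] at h3
        rw [← Complex.zero_re, ← h3]
        refine Finset.sum_congr rfl fun i _ => ?_
        norm_cast
      intro i
      rw [Finset.sum_eq_zero_iff_of_nonneg fun i _ => sq_nonneg _] at h2
      rw [inner_self_eq_norm_sq_to_K, pow_eq_zero_iff two_ne_zero, norm_eq_zero.1
        ((pow_eq_zero_iff two_ne_zero).1 (h2 i (Finset.mem_univ i)))]
      simp
    -- Definiteness: a vector whose coefficients all vanish is zero, since the counit recovers its
    -- coordinates from them.
    refine (Module.Free.chooseBasis ℂ H).ext_elem fun i => ?_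
    have h4 : RegSpace.toB B (sliceReg δ i x) = 0 := by
      rw [inner_self_eq_zero.1 (h1 i), map_zero]
    have h5 := counit_slice ((Module.Free.chooseBasis ℂ H).coord i) (δ x)
    rw [counit] at h5
    have h6 : TensorProduct.lid ℂ B (((Module.Free.chooseBasis ℂ H).coord i).rTensor B (δ x)) =
      0 := h4
    rw [h6, map_zero] at h5
    simpa using h5.symm

/-- Every finite dimensional comodule carries the structure of a unitary corepresentation. -/
def unitarize (δ : H →ₗ[ℂ] H ⊗[ℂ] B)
    (coassoc : ∀ v, TensorProduct.assoc ℂ H B B (δ.rTensor B (δ v)) = (Δ).lTensor H (δ v))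
    (counit : ∀ v, epsR B H (δ v) = v) : UCorep B where
  carrier := H
  normedAddCommGroup := (comoduleCore δ counit).toNormedAddCommGroup
  innerProductSpace := InnerProductSpace.ofCore (comoduleCore δ counit).toCore
  finiteDimensional := inferInstanceAs (FiniteDimensional ℂ H)
  coact := δ
  isUnitary :=
    letI := (comoduleCore δ counit).toNormedAddCommGroup
    letI := InnerProductSpace.ofCore (comoduleCore δ counit).toCore
    { coassoc := coassoc
      unitary := by
        -- Each coefficient map is colinear into the regular coaction, so unitarity is inherited
        -- summand by summand.
        have key (v w : H) : innerSlice w (δ v) =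
            ∑ i, innerSlice (sliceReg δ i w) (regCoact B (sliceReg δ i v)) := by
          have h1 (i) : regCoact B (sliceReg δ i v) = (sliceReg δ i).rTensor B (δ v) := by
            have h := comul_slice (coassoc v) ((Module.Free.chooseBasis ℂ H).coord i)
            rw [regCoact_apply]
            change ((RegSpace.toB B).symm.toLinearMap).rTensor B (Δ (TensorProduct.lid ℂ B
              (((Module.Free.chooseBasis ℂ H).coord i).rTensor B (δ v)))) = _
            rw [h, ← LinearMap.rTensor_comp_apply]
            rfl
          simp only [h1]
          generalize δ v = t
          induction t with
          | zero => simp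
          | add x y hx hy => simp only [map_add, hx, hy, Finset.sum_add_distrib]
          | tmul x b =>
            simp only [innerSlice_tmul, LinearMap.rTensor_tmul, ← Finset.sum_smul]
            rfl
        intro v w
        rw [key, key, map_sum, star_sum]
        exact Finset.sum_congr rfl fun i _ => regCoact_isUnitary.unitary _ _ }
  counit := counit

end Unitarizable

namespace UCorep

open Reconstruction (bar dualCoact)

variable {B : Type u} [CStarAlgebra B] [WeakHopfCStarAlgebra B]

local notation "Δ" => (CoalgebraStruct.comul : B →ₗ[ℂ] B ⊗[ℂ] B)
local notation "ε" => (CoalgebraStruct.counit : B →ₗ[ℂ] ℂ)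
local notation "S" => (antipode : B →ₗ[ℂ] B)

/-! ### The contragredient coaction -/

section DualCoaction

/-- Identities between values of `dualCoact` are tested by evaluation at vectors, where
`eval_dualCoact` applies. -/
lemma dual_separates {H : Type*} [AddCommGroup H] [Module ℂ H] [FiniteDimensional ℂ H]
    {C : Type*} [AddCommGroup C] [Module ℂ C] {t t' : Module.Dual ℂ H ⊗[ℂ] C}
    (h : ∀ v, TensorProduct.lid ℂ C ((Module.Dual.eval ℂ H v).rTensor C t) =
      TensorProduct.lid ℂ C ((Module.Dual.eval ℂ H v).rTensor C t')) : t = t' := by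
  have b := Module.Free.chooseBasis ℂ H
  have key (t : Module.Dual ℂ H ⊗[ℂ] C) : t = ∑ i, b.coord i ⊗ₜ[ℂ]
      TensorProduct.lid ℂ C ((Module.Dual.eval ℂ H (b i)).rTensor C t) := by
    induction t with
    | zero => simp
    | add x y hx hy =>
      simp only [map_add, tmul_add, Finset.sum_add_distrib]
      rw [← hx, ← hy]
    | tmul φ c =>
      simp only [LinearMap.rTensor_tmul, TensorProduct.lid_tmul, tmul_smul, smul_tmul', ← sum_tmul]
      congr 1
      refine b.ext fun j => ?_
      simp
  rw [key t, key t']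
  simp only [h]

lemma sum_inner_bar {H : Type u} [NormedAddCommGroup H] [InnerProductSpace ℂ H] {J : Type*}
    [Fintype J] (e : OrthonormalBasis J ℂ H) (φ : Module.Dual ℂ H) :
    ∑ j, φ (e j) • bar (e j) = φ := by
  refine LinearMap.ext fun v => ?_
  conv_rhs => rw [← e.sum_repr' v]
  simp [LinearMap.sum_apply, mul_comm]

lemma sum_coef_bar (U : UCorep B) {J : Type*} [Fintype J] (e : OrthonormalBasis J ℂ U.carrier)
    (φ : Module.Dual ℂ U.carrier) (v : U.carrier) :
    ∑ j, φ (e j) • coef U (bar (e j)) v = coef U φ v := by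
  conv_rhs => rw [← sum_inner_bar e φ]
  simp [map_sum, LinearMap.sum_apply]

/-- The basis-free form of the coaction on the conjugate space. It rests on the unitarity relation
(U_{j,i})* = S(U_{i,j}). -/
lemma eval_dualCoact (U : UCorep B) (φ : Module.Dual ℂ U.carrier) (v : U.carrier) :
    TensorProduct.lid ℂ B ((Module.Dual.eval ℂ U.carrier v).rTensor B (dualCoact U φ)) =
      S (coef U φ v) := by
  set e := stdOrthonormalBasis ℂ U.carrier with he
  have h1 (i j) : star (Reconstruction.matrixCoeff U e j i) = S (coef U (bar (e i)) (e j)) := by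
    rw [Reconstruction.matrixCoeff, ← coef_bar, coef_bar_eq, star_star]
  have h2 (i) : ∑ j, inner ℂ (e j) v • S (coef U (bar (e i)) (e j)) =
      S (coef U (bar (e i)) v) := by
    conv_rhs => rw [← e.sum_repr' v]
    simp [map_sum]
  simp only [dualCoact, LinearMap.sum_apply, LinearMap.smulRight_apply, map_sum, map_smul,
    LinearMap.rTensor_tmul, TensorProduct.lid_tmul, ← he, h1, Module.Dual.eval_apply]
  simp only [← Finset.smul_sum]
  have h3 (j) : bar (e j) v = inner ℂ (e j) v := rfl
  simp only [h3, h2]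
  rw [← sum_coef_bar U e φ v]
  simp [map_sum]

/-- The coaction on the conjugate space in an arbitrary orthonormal basis. -/
lemma dualCoact_bar (U : UCorep B) {J : Type*} [Fintype J] (e : OrthonormalBasis J ℂ U.carrier)
    (ξ : U.carrier) :
    dualCoact U (bar ξ) = ∑ j, bar (e j) ⊗ₜ[ℂ] star (coef U (bar (e j)) ξ) := by
  refine dual_separates fun v => ?_
  have h (j) : star (coef U (bar (e j)) ξ) = S (coef U (bar ξ) (e j)) := by
    rw [coef_bar_eq, star_star]
  rw [eval_dualCoact]
  simp only [map_sum, LinearMap.rTensor_tmul, TensorProduct.lid_tmul, Module.Dual.eval_apply, h]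
  conv_lhs => rw [← e.sum_repr' v]
  simp [map_sum]

lemma dualCoact_coassoc (U : UCorep B) (φ : Module.Dual ℂ U.carrier) :
    TensorProduct.assoc ℂ _ B B ((dualCoact U).rTensor B (dualCoact U φ)) =
      (Δ).lTensor _ (dualCoact U φ) := by
  obtain ⟨ξ, rfl⟩ := exists_eq_bar φ
  have e := stdOrthonormalBasis ℂ U.carrier
  simp only [dualCoact_bar U e, map_sum, LinearMap.rTensor_tmul, LinearMap.lTensor_tmul,
    comul_star, comul_coef_eq_sum U e, star_sum, tmul_sum, sum_tmul, TensorProduct.assoc_tmul,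
    TensorProduct.star_tmul]
  rw [Finset.sum_comm]

lemma dualCoact_counit (U : UCorep B) (φ : Module.Dual ℂ U.carrier) :
    epsR B _ (dualCoact U φ) = φ := by
  obtain ⟨ξ, rfl⟩ := exists_eq_bar φ
  have e := stdOrthonormalBasis ℂ U.carrier
  rw [dualCoact_bar U e]
  conv_rhs => rw [← sum_inner_bar e (bar ξ)]
  simp [map_sum, counit_star, counit_coef]

/-- The contragredient corepresentation. -/
def contragredient (U : UCorep B) : UCorep B :=
  unitarize (dualCoact U) (dualCoact_coassoc U) (dualCoact_counit U)

/-- Functionals as vectors of the contragredient corepresentation. -/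
def contraEquiv (U : UCorep B) : Module.Dual ℂ U.carrier ≃ₗ[ℂ] (contragredient U).carrier :=
  LinearEquiv.refl ℂ (Module.Dual ℂ U.carrier)

lemma contragredient_coact (U : UCorep B) (φ : Module.Dual ℂ U.carrier) :
    (contragredient U).coact (contraEquiv U φ) =
      (contraEquiv U).toLinearMap.rTensor B (dualCoact U φ) := by
  have h : (contraEquiv U).toLinearMap.rTensor B (dualCoact U φ) = dualCoact U φ :=
    LinearMap.congr_fun (LinearMap.rTensor_id B (Module.Dual ℂ U.carrier)) _
  rw [h]
  rfl

end DualCoaction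

variable [IsRegularQuantumGroupoid B]

/-! ### Existence of conjugates -/

section Evaluation

variable (B) in
/-- The map `ε_s` from `B` to the space of the unit object. -/
def unitOf : B →ₗ[ℂ] (𝟙_ (UCorep B)).carrier := SourceSpace.ofB B

lemma unitVal_unitOf (b : B) : unitVal B (unitOf B b) = sourceCounital b := rfl

lemma rTensor_unitVal_coact (z : (𝟙_ (UCorep B)).carrier) :
    (unitVal B).rTensor B ((𝟙_ (UCorep B)).coact z) = Δ (unitVal B z) := val_sourceCoact z

lemma rTensor_unitVal_injective : Function.Injective ((unitVal B).rTensor B) :=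
  rTensor_val_injective B

/-- A morphism from a tensor product defined on the full tensor product. -/
def tensorHomMk {U V W : UCorep B} (f : U.carrier ⊗[ℂ] V.carrier →ₗ[ℂ] W.carrier)
    (hf : Colin (tensorCoact U.coact V.coact) W.coact f) : (U ⊗ V : UCorep B) ⟶ W :=
  homMk (f ∘ₗ incl U V) (hf.comp (incl_colin U V))

@[simp] lemma lin_tensorHomMk_tmk {U V W : UCorep B}
    (f : U.carrier ⊗[ℂ] V.carrier →ₗ[ℂ] W.carrier)
    (hf : Colin (tensorCoact U.coact V.coact) W.coact f) (v : U.carrier) (w : V.carrier) :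
    lin (tensorHomMk f hf) (tmk U V v w) = f (v ⊗ₜ w) := by
  change f (incl U V (proj U V (v ⊗ₜ w))) = _
  rw [incl_proj, ← hf.proj, proj_eq]

/-- `φ ⊗ v ↦ φ(v¹) v²` -/
def coefLin (U : UCorep B) : (contragredient U).carrier ⊗[ℂ] U.carrier →ₗ[ℂ] B :=
  TensorProduct.lift ((coef U) ∘ₗ (contraEquiv U).symm.toLinearMap)

/-- `ε_s(b₂) ⊗ S(b₁)b₃ = Δ(ε_s(b))` -/
lemma comul_source_eq (b : B) :
    TensorProduct.lift ((LinearMap.mul ℂ (B ⊗[ℂ] B)).compl₁₂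
      (TensorProduct.mk ℂ B B 1 ∘ₗ S) (sourceCounital.rTensor B ∘ₗ Δ)) (Δ b) =
    Δ (sourceCounital b) := by
  have h1 (t : B ⊗[ℂ] B) : TensorProduct.lift ((LinearMap.mul ℂ (B ⊗[ℂ] B)).compl₁₂
      (TensorProduct.mk ℂ B B 1 ∘ₗ S) (sourceCounital.rTensor B ∘ₗ Δ)) t =
      (1 ⊗ₜ LinearMap.mul' ℂ B ((S).rTensor B t)) * Δ 1 := by
    induction t with
    | zero => simp
    | add x y hx hy => simp only [map_add, tmul_add, add_mul, hx, hy]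
    | tmul x y =>
      simp only [TensorProduct.lift.tmul, LinearMap.compl₁₂_apply, LinearMap.comp_apply,
        TensorProduct.mk_apply, rTensor_source_comul, LinearMap.mul_apply', ← mul_assoc,
        Algebra.TensorProduct.tmul_mul_tmul, one_mul, LinearMap.rTensor_tmul, LinearMap.mul'_apply]
  rw [h1, antipode_mul_id, comul_source]

/-- With b = φ(v¹)v², the coaction on φ ⊗ v followed by the evaluation is ε_s(b₂) ⊗ S(b₁)b₃, which
`comul_source_eq` identifies with Δ(ε_s(b)). -/
lemma evaluation_colin (U : UCorep B) :
    Colin (tensorCoact (contragredient U).coact U.coact) (𝟙_ (UCorep B)).coact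
      (unitOf B ∘ₗ coefLin U) := fun t => by
  induction t with
  | zero => simp only [map_zero]
  | add x y hx hy => simp only [map_add, hx, hy]
  | tmul φ v =>
    obtain ⟨ψ, rfl⟩ := (contraEquiv U).surjective φ
    obtain ⟨ξ, rfl⟩ := exists_eq_bar ψ
    have e := stdOrthonormalBasis ℂ U.carrier
    apply rTensor_unitVal_injective
    have h1 : (unitOf B ∘ₗ coefLin U) (contraEquiv U (bar ξ) ⊗ₜ[ℂ] v) =
      unitOf B (coef U (bar ξ) v) := rfl
    rw [rTensor_unitVal_coact, h1, unitVal_unitOf, ← comul_source_eq, tensorCoact_tmul,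
      contragredient_coact, dualCoact_bar U e, coact_eq_sum U e]
    have h2 (j) : star (coef U (bar (e j)) ξ) = S (coef U (bar ξ) (e j)) := by
      rw [coef_bar_eq, star_star]
    have h3 (j k) (b : B) : (unitVal B).rTensor B ((unitOf B ∘ₗ
        coefLin U).rTensor B ((contraEquiv U (bar (e j)) ⊗ₜ[ℂ] e k) ⊗ₜ[ℂ] b)) =
        sourceCounital (coef U (bar (e j)) (e k)) ⊗ₜ b := rfl
    simp only [map_sum, LinearMap.rTensor_tmul, LinearMap.sum_apply, legMul_tmul,
      LinearEquiv.coe_coe]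
    simp only [← LinearMap.rTensor_tmul, h3]
    simp only [comul_coef_eq_sum U e, map_sum, TensorProduct.lift.tmul, LinearMap.compl₁₂_apply,
      LinearMap.comp_apply, LinearMap.rTensor_tmul, TensorProduct.mk_apply, LinearMap.mul_apply',
      Algebra.TensorProduct.tmul_mul_tmul, one_mul, h2]
    rw [Finset.sum_comm]

/-- The evaluation `φ ⊗ v ↦ ε_s(φ(v¹) v²)`. -/
def evaluationHom (U : UCorep B) : (contragredient U ⊗ U : UCorep B) ⟶ 𝟙_ (UCorep B) :=
  tensorHomMk _ (evaluation_colin U)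

lemma unitVal_evaluationHom (U : UCorep B) (φ : Module.Dual ℂ U.carrier) (v : U.carrier) :
    unitVal B (lin (evaluationHom U) (tmk _ _ (contraEquiv U φ) v)) =
      sourceCounital (coef U φ v) := by
  rw [evaluationHom, lin_tensorHomMk_tmk]
  rfl

/-- `z ↦ ∑ z·e_k ⊗ ē_k` -/
def coevaluationLin (U : UCorep B) :
    (𝟙_ (UCorep B)).carrier →ₗ[ℂ] U.carrier ⊗[ℂ] (contragredient U).carrier :=
  ∑ k, (TensorProduct.mk ℂ U.carrier (contragredient U).carrier).flip
      (contraEquiv U (bar (stdOrthonormalBasis ℂ U.carrier k))) ∘ₗ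
    lin (λ_ U).hom ∘ₗ (tmk (𝟙_ (UCorep B)) U).flip (stdOrthonormalBasis ℂ U.carrier k)

lemma coevaluationLin_apply (U : UCorep B) (z : (𝟙_ (UCorep B)).carrier) : coevaluationLin U z =
    ∑ k, lAct U (unitVal B z) (stdOrthonormalBasis ℂ U.carrier k) ⊗ₜ[ℂ]
      contraEquiv U (bar (stdOrthonormalBasis ℂ U.carrier k)) := by
  simp [coevaluationLin, LinearMap.sum_apply]

/-- Both sides equal the sum of e_l ⊗ ē_j ⊗ zε_t(U_{l,j}). One side uses b₁S(b₂) = ε_t(b); the other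
uses Δ(z) = (1 ⊗ z)Δ(1) and the formula for ε_t. -/
lemma coevaluation_colin (U : UCorep B) :
    Colin (𝟙_ (UCorep B)).coact (tensorCoact U.coact (contragredient U).coact) (coevaluationLin U) := by
  intro z
  set e := stdOrthonormalBasis ℂ U.carrier with he
  have hz : unitVal B z ∈ source B := unitVal_mem z
  have hR (t : (𝟙_ (UCorep B)).carrier ⊗[ℂ] B) : (coevaluationLin U).rTensor B t =
      ∑ l, ∑ k, (e l ⊗ₜ[ℂ] contraEquiv U (bar (e k))) ⊗ₜ[ℂ] TensorProduct.lid ℂ B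
        ((ε ∘ₗ LinearMap.mulRight ℂ (coef U (bar (e l)) (e k))).rTensor B
          ((unitVal B).rTensor B t)) := by
    induction t with
    | zero => simp
    | add x y hx hy => simp only [map_add, tmul_add, Finset.sum_add_distrib, hx, hy]
    | tmul x b =>
      rw [LinearMap.rTensor_tmul, coevaluationLin_apply, ← he]
      simp only [lAct_eq_sum U e, sum_tmul, LinearMap.rTensor_tmul, TensorProduct.lid_tmul,
        LinearMap.comp_apply, LinearMap.mulRight_apply, tmul_smul, smul_tmul']
      rw [Finset.sum_comm]
  have hL : tensorCoact U.coact (contragredient U).coact (coevaluationLin U z) =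
      ∑ l, ∑ j, (e l ⊗ₜ[ℂ] contraEquiv U (bar (e j))) ⊗ₜ[ℂ]
        (unitVal B z * targetCounital (coef U (bar (e l)) (e j))) := by
    have h2 (j k) : star (coef U (bar (e j)) (e k)) = S (coef U (bar (e k)) (e j)) := by
      rw [coef_bar_eq, star_star]
    rw [coevaluationLin_apply, ← he]
    simp only [map_sum, tensorCoact_tmul, coact_lAct U _ hz, contragredient_coact,
      dualCoact_bar U e, coact_eq_sum U e, LinearMap.lTensor_tmul, LinearMap.rTensor_tmul,
      LinearMap.sum_apply, legMul_tmul, LinearMap.mulLeft_apply, h2, ← mul_antipode,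
      comul_coef_eq_sum U e, LinearMap.mul'_apply, Finset.mul_sum, tmul_sum, LinearEquiv.coe_coe,
      mul_assoc]
    rw [Finset.sum_congr rfl fun k _ => Finset.sum_comm, Finset.sum_comm]
    exact Finset.sum_congr rfl fun l _ => Finset.sum_comm
  obtain ⟨s, hs⟩ := TensorProduct.exists_finset (Δ (1 : B))
  rw [hL, hR]
  refine Finset.sum_congr rfl fun l _ => Finset.sum_congr rfl fun k _ => ?_
  rw [rTensor_unitVal_coact, comul_of_mem hz, hs, target_apply hs]
  simp [map_sum, Finset.mul_sum]

/-- The coevaluation `z ↦ ∑ z·e_k ⊗ ē_k`. -/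
def coevaluationHom (U : UCorep B) : 𝟙_ (UCorep B) ⟶ (U ⊗ contragredient U : UCorep B) :=
  homMk (proj U (contragredient U) ∘ₗ coevaluationLin U)
    ((proj_colin U (contragredient U)).comp (coevaluation_colin U))

lemma coevaluationHom_unitVec (U : UCorep B) : lin (coevaluationHom U) (unitVec B) =
    ∑ k, tmk _ _ (stdOrthonormalBasis ℂ U.carrier k)
      (contraEquiv U (bar (stdOrthonormalBasis ℂ U.carrier k))) := by
  change proj U (contragredient U) (coevaluationLin U (unitVec B)) = _
  rw [coevaluationLin_apply, map_sum]
  simp only [unitVal_unitVec, lAct_one]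
  rfl

/-- The conjugate of a corepresentation. -/
abbrev exactPairing (U : UCorep B) : ExactPairing U (contragredient U) where
  coevaluation' := coevaluationHom U
  evaluation' := evaluationHom U
  coevaluation_evaluation' := by
    -- The unitors are moved to one side, so that the conjugate equation becomes the statement that
    -- an endomorphism is the identity and can be checked on vectors.
    rw [← cancel_epi (ρ_ _).inv, ← cancel_mono (λ_ _).hom]
    simp only [Category.assoc, Iso.inv_hom_id_assoc, Iso.inv_hom_id]
    refine hom_ext (LinearMap.ext fun φ => ?_)
    obtain ⟨ψ, rfl⟩ := (contraEquiv U).surjective φ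
    obtain ⟨ξ, rfl⟩ := exists_eq_bar ψ
    set e := stdOrthonormalBasis ℂ U.carrier with he
    simp only [lin_comp_apply, lin_rightUnitor_inv, lin_whiskerLeft_tmk, coevaluationHom_unitVec,
      map_sum, lin_associator_inv_tmk, lin_whiskerRight_tmk, lin_leftUnitor_tmk,
      unitVal_evaluationHom, lin_id, LinearMap.id_apply, ← he]
    have h1 (z : B) (k) : lAct (contragredient U) z (contraEquiv U (bar (e k))) =
        ∑ j, ε (z * S (coef U (bar (e k)) (e j))) • contraEquiv U (bar (e j)) := by
      have h2 (j) : star (coef U (bar (e j)) (e k)) = S (coef U (bar (e k)) (e j)) := by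
        rw [coef_bar_eq, star_star]
      rw [lAct, contragredient_coact, dualCoact_bar U e]
      simp [map_sum, h2]
    simp only [h1, counit_source_mul]
    rw [Finset.sum_comm]
    simp only [← Finset.sum_smul]
    -- This is ε(b₁S(b₂)) = ε(ε_t(b)) = ε(b) for a coefficient b.
    have h3 (j) : ∑ k, ε (coef U (bar ξ) (e k) * S (coef U (bar (e k)) (e j))) = bar ξ (e j) := by
      have h4 := mul_antipode (coef U (bar ξ) (e j))
      rw [comul_coef_eq_sum U e] at h4
      have h5 := congrArg ε h4
      have h6 := counit_mul_target 1 (coef U (bar ξ) (e j))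
      rw [one_mul, one_mul] at h6
      rw [h6, counit_coef] at h5
      simpa [map_sum] using h5
    simp only [h3]
    conv_rhs => rw [← sum_inner_bar e (bar ξ), map_sum]
    simp
  evaluation_coevaluation' := by
    rw [← cancel_epi (λ_ _).inv, ← cancel_mono (ρ_ _).hom]
    simp only [Category.assoc, Iso.inv_hom_id_assoc, Iso.inv_hom_id]
    refine hom_ext (LinearMap.ext fun u => ?_)
    set e := stdOrthonormalBasis ℂ U.carrier with he
    simp only [lin_comp_apply, lin_leftUnitor_inv, lin_whiskerRight_tmk, coevaluationHom_unitVec,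
      map_sum, LinearMap.sum_apply, lin_associator_tmk, lin_whiskerLeft_tmk, lin_rightUnitor_tmk,
      unitVal_evaluationHom, lin_id, LinearMap.id_apply, ← he, rAct_eq_sum U e]
    rw [Finset.sum_comm]
    simp only [← Finset.sum_smul]
    -- This is ε applied to b₁ε_s(b₂) = b.
    have h1 (l) : ∑ k, ε (coef U (bar (e l)) (e k) * sourceCounital (coef U (bar (e k)) u)) =
        inner ℂ (e l) u := by
      have h2 := mul_source_comul (coef U (bar (e l)) u)
      rw [comul_coef_eq_sum U e] at h2
      have h3 := congrArg ε h2
      rw [counit_coef] at h3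
      simpa [map_sum] using h3
    simp only [h1]
    exact e.sum_repr' u

end Evaluation

end UCorep

namespace UCorep

variable {B : Type u} [CStarAlgebra B] [WeakHopfCStarAlgebra B]

local notation "Δ" => (CoalgebraStruct.comul : B →ₗ[ℂ] B ⊗[ℂ] B)

/-! ### Invariant subspaces -/

section Subcomodule

/-- The slice `v¹ χ(v²)`. -/
def slice (U : UCorep B) (χ : B →ₗ[ℂ] ℂ) : U.carrier →ₗ[ℂ] U.carrier :=
  (TensorProduct.rid ℂ U.carrier).toLinearMap ∘ₗ χ.lTensor U.carrier ∘ₗ U.coact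

lemma slice_lin {U V : UCorep B} (f : U ⟶ V) (χ : B →ₗ[ℂ] ℂ) (v : U.carrier) :
    slice V χ (lin f v) = lin f (slice U χ v) := by
  simp only [slice, LinearMap.comp_apply, colin]
  generalize U.coact v = t
  induction t with
  | zero => simp
  | add x y hx hy => simp only [map_add, hx, hy]
  | tmul x b => simp

/-- Invariant subspaces. -/
def IsInvariant (U : UCorep B) (W : Submodule ℂ U.carrier) : Prop :=
  ∀ χ : B →ₗ[ℂ] ℂ, ∀ v ∈ W, slice U χ v ∈ W

lemma isInvariant_ker {U V : UCorep B} (f : U ⟶ V) : IsInvariant U (LinearMap.ker (lin f)) :=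
  fun χ v hv => by
    rw [LinearMap.mem_ker] at hv ⊢
    rw [← slice_lin, hv, map_zero]

lemma isInvariant_map {U V : UCorep B} (f : U ⟶ V) {W : Submodule ℂ U.carrier}
    (hW : IsInvariant U W) : IsInvariant V (W.map (lin f)) := by
  rintro χ _ ⟨v, hv, rfl⟩
  rw [slice_lin]
  exact ⟨_, hW χ v hv, rfl⟩

lemma isInvariant_top (U : UCorep B) : IsInvariant U ⊤ := fun _ _ _ => trivial

/-- A linear retraction onto a subspace. -/
def retract {H : Type*} [AddCommGroup H] [Module ℂ H] (W : Submodule ℂ H) : H →ₗ[ℂ] W :=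
  (LinearMap.exists_leftInverse_of_injective W.subtype (Submodule.ker_subtype W)).choose

lemma retract_subtype {H : Type*} [AddCommGroup H] [Module ℂ H] (W : Submodule ℂ H) :
    retract W ∘ₗ W.subtype = LinearMap.id :=
  (LinearMap.exists_leftInverse_of_injective W.subtype (Submodule.ker_subtype W)).choose_spec

variable (U : UCorep B) (W : Submodule ℂ U.carrier)

/-- Expanding along a basis of B, invariance under all slices puts the coaction of W into W ⊗ B. Any
linear retraction therefore serves to restrict the coaction, colinear or not. -/
lemma subtype_retract_coact {W} (hW : IsInvariant U W) (v : W) :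
    W.subtype.rTensor B ((retract W).rTensor B (U.coact v)) = U.coact v := by
  have b := Module.Free.chooseBasis ℂ B
  have key (t : U.carrier ⊗[ℂ] B) :
      t = ∑ i, (TensorProduct.rid ℂ _ ((b.coord i).lTensor _ t)) ⊗ₜ[ℂ] b i := by
    induction t with
    | zero => simp
    | add x y hx hy =>
      simp only [map_add, add_tmul, Finset.sum_add_distrib]
      rw [← hx, ← hy]
    | tmul x y =>
      simp only [LinearMap.lTensor_tmul, TensorProduct.rid_tmul, ← smul_tmul', ← tmul_smul,
        ← tmul_sum]
      congr 1
      exact (b.sum_repr y).symm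
  rw [key (U.coact v)]
  simp only [map_sum, LinearMap.rTensor_tmul]
  refine Finset.sum_congr rfl fun i _ => ?_
  congr 1
  have h := hW (b.coord i) v v.2
  exact congrArg Subtype.val (LinearMap.congr_fun (retract_subtype W) ⟨_, h⟩)

lemma rTensor_subtype_injective (C : Type*) [AddCommGroup C] [Module ℂ C] :
    Function.Injective (W.subtype.rTensor C) := by
  refine Function.LeftInverse.injective (g := (retract W).rTensor C) fun x => ?_
  rw [← LinearMap.rTensor_comp_apply, retract_subtype, LinearMap.rTensor_id, LinearMap.id_apply]

/-- The restriction of a corepresentation to an invariant subspace. -/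
def sub {W : Submodule ℂ U.carrier} (hW : IsInvariant U W) : UCorep B where
  carrier := W
  normedAddCommGroup := Submodule.normedAddCommGroup _
  innerProductSpace := Submodule.innerProductSpace _
  finiteDimensional := FiniteDimensional.finiteDimensional_submodule _
  coact := (retract W).rTensor B ∘ₗ U.coact ∘ₗ W.subtype
  isUnitary :=
    { coassoc := fun v => by
        apply rTensor_subtype_injective U W (B ⊗[ℂ] B)
        have h1 (t : W ⊗[ℂ] B) : W.subtype.rTensor (B ⊗[ℂ] B) (TensorProduct.assoc ℂ _ B B
            (((retract W).rTensor B ∘ₗ U.coact ∘ₗ W.subtype).rTensor B t)) =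
            TensorProduct.assoc ℂ _ B B (U.coact.rTensor B (W.subtype.rTensor B t)) := by
          induction t with
          | zero => simp
          | add x y hx hy => simp only [map_add, hx, hy]
          | tmul x y =>
            simp only [LinearMap.rTensor_tmul, LinearMap.comp_apply, Submodule.subtype_apply]
            rw [← subtype_retract_coact U hW x]
            generalize (retract W).rTensor B (U.coact x) = q
            have h3 : (retract W).rTensor B (W.subtype.rTensor B q) = q := by
              rw [← LinearMap.rTensor_comp_apply, retract_subtype, LinearMap.rTensor_id,
                LinearMap.id_apply]
            rw [h3]
            clear h3
            induction q with
            | zero => simp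
            | add x y hx hy => simp only [map_add, add_tmul, hx, hy]
            | tmul x y => simp
        have h2 (t : W ⊗[ℂ] B) : W.subtype.rTensor (B ⊗[ℂ] B) ((Δ).lTensor _ t) =
            (Δ).lTensor _ (W.subtype.rTensor B t) := by
          induction t with
          | zero => simp
          | add x y hx hy => simp only [map_add, hx, hy]
          | tmul x y => simp
        rw [h1, h2, LinearMap.comp_apply, LinearMap.comp_apply, Submodule.subtype_apply,
          subtype_retract_coact U hW, U.isUnitary.coassoc]
      unitary := fun v w => by
        have key (v w : W) : innerSlice w (((retract W).rTensor B ∘ₗ U.coact ∘ₗ W.subtype) v) =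
            innerSlice (w : U.carrier) (U.coact (v : U.carrier)) := by
          rw [← subtype_retract_coact U hW v]
          exact (innerSlice_rTensor (fun x => rfl) _).symm
        rw [key, key, U.isUnitary.unitary] }
  counit v := by
    apply Subtype.val_injective
    change W.subtype (epsR B _ ((retract W).rTensor B (U.coact v))) = v
    rw [← epsR_rTensor, subtype_retract_coact U hW, U.counit]

/-- The inclusion of a subcorepresentation. -/
def subHom {W : Submodule ℂ U.carrier} (hW : IsInvariant U W) : sub U hW ⟶ U :=
  homMk W.subtype fun v => (subtype_retract_coact U hW v).symm

lemma mem_of_lin_subHom {W : Submodule ℂ U.carrier} (hW : IsInvariant U W)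
    (v : (sub U hW).carrier) : lin (subHom U hW) v ∈ W := Subtype.property v

lemma subHom_injective {W : Submodule ℂ U.carrier} (hW : IsInvariant U W) :
    Function.Injective (lin (subHom U hW)) := Subtype.val_injective

lemma subHom_comp_adj {W : Submodule ℂ U.carrier} (hW : IsInvariant U W) :
    subHom U hW ≫ adj (subHom U hW) = 𝟙 _ := by
  refine hom_ext (LinearMap.ext fun v => ext_inner_left ℂ fun w => ?_)
  rw [lin_comp, LinearMap.comp_apply, lin_adj, LinearMap.adjoint_inner_right]
  rfl

end Subcomodule

/-! ### Schur's lemma -/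

section Schur

lemma lin_zero {U V : UCorep B} : lin (0 : U ⟶ V) = 0 := rfl

lemma lin_add {U V : UCorep B} (f g : U ⟶ V) : lin (f + g) = lin f + lin g := rfl

lemma lin_smul {U V : UCorep B} (c : ℂ) (f : U ⟶ V) : lin (c • f) = c • lin f := rfl

lemma lin_sub {U V : UCorep B} (f g : U ⟶ V) : lin (f - g) = lin f - lin g := rfl

lemma lin_sum {U V : UCorep B} {ι : Type*} (s : Finset ι) (f : ι → (U ⟶ V)) :
    lin (∑ i ∈ s, f i) = ∑ i ∈ s, lin (f i) :=
  map_sum (AddMonoidHom.mk' (lin : (U ⟶ V) → _) lin_add) f s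

lemma adj_comp {U V W : UCorep B} (f : U ⟶ V) (g : V ⟶ W) : adj (f ≫ g) = adj g ≫ adj f :=
  hom_ext (LinearMap.adjoint_comp _ _)

lemma adj_adj {U V : UCorep B} (f : U ⟶ V) : adj (adj f) = f :=
  hom_ext (LinearMap.adjoint_adjoint _)

lemma adj_smul {U V : UCorep B} (c : ℂ) (f : U ⟶ V) : adj (c • f) = conj c • adj f :=
  hom_ext (by rw [lin_adj, lin_smul, lin_smul, lin_adj]; exact map_smulₛₗ LinearMap.adjoint c _)

lemma isIso_of_bijective {U V : UCorep B} (f : U ⟶ V) (h : Function.Bijective (lin f)) :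
    IsIso f := by
  let e := LinearEquiv.ofBijective (lin f) h
  exact (isoMk (lin f) e.symm.toLinearMap (colin' f) (fun x => e.symm_apply_apply x)
    (fun x => e.apply_symm_apply x)).isIso_hom

/-- The kernel is itself a corepresentation, so cancelling f against its inclusion shows that it
vanishes. -/
lemma injective_of_mono {U V : UCorep B} (f : U ⟶ V) [Mono f] : Function.Injective (lin f) := by
  rw [← LinearMap.ker_eq_bot, Submodule.eq_bot_iff]
  intro v hv
  have h : subHom U (isInvariant_ker f) = 0 := by
    rw [← cancel_mono f, Limits.zero_comp]
    exact hom_ext (LinearMap.ext fun w => w.2)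
  exact LinearMap.congr_fun (congrArg lin h) ⟨v, hv⟩

lemma mono_of_injective {U V : UCorep B} (f : U ⟶ V) (h : Function.Injective (lin f)) : Mono f :=
  ⟨fun _ _ hg => hom_ext (LinearMap.ext fun v => h (LinearMap.congr_fun (congrArg lin hg) v))⟩

/-- A nonzero kernel would be a nonzero subobject of a simple object, hence everything, and then f =
0. -/
lemma injective_of_simple {U V : UCorep B} [Simple U] {f : U ⟶ V} (hf : f ≠ 0) :
    Function.Injective (lin f) := by
  have := mono_of_injective (subHom U (isInvariant_ker f)) (subHom_injective U _)
  have h0 : subHom U (isInvariant_ker f) ≫ f = 0 := hom_ext (LinearMap.ext fun w => w.2)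
  by_contra hk
  rw [← LinearMap.ker_eq_bot, Submodule.eq_bot_iff] at hk
  push Not at hk
  obtain ⟨v, hv, hv0⟩ := hk
  have h1 : subHom U (isInvariant_ker f) ≠ 0 := fun h =>
    hv0 (LinearMap.congr_fun (congrArg lin h) ⟨v, hv⟩)
  have h2 : IsIso (subHom U (isInvariant_ker f)) :=
    (Simple.mono_isIso_iff_nonzero _).2 h1
  exact hf (by rw [← cancel_epi (subHom U (isInvariant_ker f)), Limits.comp_zero, h0])

/-- Schur's lemma. -/
lemma isIso_of_simple {U V : UCorep B} [Simple U] [Simple V] {f : U ⟶ V} (hf : f ≠ 0) :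
    IsIso f := by
  have := mono_of_injective f (injective_of_simple hf)
  exact (Simple.mono_isIso_iff_nonzero f).2 hf

lemma nontrivial_of_simple (U : UCorep B) [Simple U] : Nontrivial U.carrier := by
  by_contra h
  rw [not_nontrivial_iff_subsingleton] at h
  exact id_nonzero U (hom_ext (LinearMap.ext fun v => Subsingleton.elim _ _))

/-- Schur's lemma. -/
lemma exists_eq_smul_id {U : UCorep B} [Simple U] (f : U ⟶ U) : ∃ c : ℂ, f = c • 𝟙 U := by
  have := nontrivial_of_simple U
  obtain ⟨c, hc⟩ := Module.End.exists_eigenvalue (lin f)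
  obtain ⟨v, hv⟩ := hc.exists_hasEigenvector
  refine ⟨c, ?_⟩
  by_contra h
  refine hv.2 (injective_of_simple (sub_ne_zero.2 h) ?_)
  rw [map_zero, lin_sub, lin_smul, LinearMap.sub_apply, hv.apply_eq_smul]
  simp

/-- A nonzero morphism from an irreducible corepresentation is proportional to an isometry. -/
lemma exists_isometry {U V : UCorep B} [Simple U] {f : U ⟶ V} (hf : f ≠ 0) :
    ∃ w : U ⟶ V, w ≫ adj w = 𝟙 U := by
  have := nontrivial_of_simple U
  obtain ⟨c, hc⟩ := exists_eq_smul_id (f ≫ adj f)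
  obtain ⟨v, hv⟩ := exists_ne (0 : U.carrier)
  have hfv : lin f v ≠ 0 := fun h => hv (injective_of_simple hf (h.trans (map_zero _).symm))
  have h1 : c * (‖v‖ : ℂ) ^ 2 = (‖lin f v‖ : ℂ) ^ 2 := by
    have h2 : inner ℂ v (lin (f ≫ adj f) v) = inner ℂ v (lin (c • 𝟙 U) v) := by rw [hc]
    rw [lin_comp, LinearMap.comp_apply, lin_adj, LinearMap.adjoint_inner_right, lin_smul,
      LinearMap.smul_apply, inner_smul_right, lin_id, LinearMap.id_apply,
      inner_self_eq_norm_sq_to_K, inner_self_eq_norm_sq_to_K] at h2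
    exact h2.symm
  -- By Schur's lemma f*f is a scalar c, and comparing norms at v gives c = ‖fv‖²/‖v‖²; thus r =
  -- c^(-1/2).
  set r : ℝ := ‖v‖ / ‖lin f v‖ with hr
  refine ⟨(r : ℂ) • f, ?_⟩
  rw [adj_smul, Linear.smul_comp, Linear.comp_smul, hc, smul_smul, smul_smul, Complex.conj_ofReal]
  have h3 : (r : ℂ) * (r * c) = 1 := by
    have h4 : (‖lin f v‖ : ℂ) ≠ 0 := by exact_mod_cast norm_ne_zero_iff.2 hfv
    rw [hr]
    push_cast
    field_simp
    rw [mul_comm]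
    exact h1
  rw [← mul_assoc] at h3
  rw [h3, one_smul]

end Schur

/-! ### Decomposition into irreducibles -/

section Decomposition

variable {Ω : Type t} {Ux : Ω → UCorep B}

/-- A nonzero invariant subspace of least dimension has no proper nonzero invariant subspace; images
of monomorphisms into it are invariant. -/
lemma exists_simple_sub (U : UCorep B) [Nontrivial U.carrier] :
    ∃ (V : UCorep B) (f : V ⟶ U), Simple V ∧ f ≠ 0 := by
  let P : ℕ → Prop := fun n => ∃ W : Submodule ℂ U.carrier, IsInvariant U W ∧ W ≠ ⊥ ∧
    Module.finrank ℂ W = n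
  have hP : ∃ n, P n := ⟨_, ⊤, isInvariant_top U, top_ne_bot, rfl⟩
  classical
  obtain ⟨W, hW, hW0, hWn⟩ := Nat.find_spec hP
  have hmin (W' : Submodule ℂ U.carrier) (hW' : IsInvariant U W') (h0 : W' ≠ ⊥) (hle : W' ≤ W) :
      W' = W := by
    refine Submodule.eq_of_le_of_finrank_le hle ?_
    rw [hWn]
    exact Nat.find_min' hP ⟨W', hW', h0, rfl⟩
  obtain ⟨v, hv, hv0⟩ := Submodule.exists_mem_ne_zero_of_ne_bot hW0
  refine ⟨sub U hW, subHom U hW, ⟨fun {Y} f _ => ⟨fun h hf => ?_, fun hf => ?_⟩⟩, fun h =>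
    hv0 (LinearMap.congr_fun (congrArg lin h) ⟨v, hv⟩)⟩
  · have h1 : 𝟙 (sub U hW) = 0 := by
      rw [← IsIso.inv_hom_id f]
      exact (congrArg (inv f ≫ ·) hf).trans Limits.comp_zero
    exact hv0 (congrArg Subtype.val (LinearMap.congr_fun (congrArg lin h1) ⟨v, hv⟩))
  · refine isIso_of_bijective f ⟨injective_of_mono f, fun w => ?_⟩
    have h1 := isInvariant_map (f ≫ subHom U hW) (isInvariant_top Y)
    have h2 := hmin _ h1 (fun h => hf (hom_ext (LinearMap.ext fun y => ?_))) ?_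
    · have h3 : lin (subHom U hW) w ∈ W := mem_of_lin_subHom U hW w
      obtain ⟨y, -, hy⟩ := h2.ge h3
      exact ⟨y, subHom_injective U hW hy⟩
    · apply subHom_injective U hW
      rw [Submodule.eq_bot_iff] at h
      rw [lin_zero, LinearMap.zero_apply, map_zero]
      exact h _ ⟨y, trivial, rfl⟩
    · rintro _ ⟨y, -, rfl⟩
      exact mem_of_lin_subHom U hW _

/-- The decomposition of a corepresentation along an isometry. -/
def decompositionCons {U : UCorep B} {x : Ω} (w : Ux x ⟶ U) (hw : w ≫ adj w = 𝟙 _)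
    (D : IrrDecomposition Ux (sub U (isInvariant_ker (adj w)))) : IrrDecomposition Ux U where
  n := D.n + 1
  idx := Fin.cons x D.idx
  w := Fin.cases w fun i => D.w i ≫ subHom U _
  isometry := Fin.cases hw fun i => by
    change (D.w i ≫ subHom U _) ≫ adj (D.w i ≫ subHom U _) = 𝟙 _
    rw [adj_comp, Category.assoc, ← Category.assoc (subHom U _), subHom_comp_adj,
      Category.id_comp, D.isometry]
  sum_eq := by
    rw [Fin.sum_univ_succ]
    change adj w ≫ w + ∑ i, adj (D.w i ≫ subHom U _) ≫ D.w i ≫ subHom U _ = 𝟙 U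
    have h1 : ∑ i, adj (D.w i ≫ subHom U _) ≫ D.w i ≫ subHom U _ =
        adj (subHom U (isInvariant_ker (adj w))) ≫ subHom U _ := by
      have h0 := congrArg (fun f => adj (subHom U (isInvariant_ker (adj w))) ≫ f ≫ subHom U _)
        D.sum_eq
      simp only [Preadditive.sum_comp, Preadditive.comp_sum, Category.id_comp] at h0
      rw [← h0]
      simp only [adj_comp, Category.assoc]
    rw [h1]
    refine hom_ext (LinearMap.ext fun v => ?_)
    have h2 : v - lin w (lin (adj w) v) ∈ LinearMap.ker (lin (adj w)) := by
      have h3 : lin (adj w) (lin w (lin (adj w) v)) = lin (adj w) v :=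
        LinearMap.congr_fun (congrArg lin hw) _
      rw [LinearMap.mem_ker, map_sub, h3, sub_self]
    -- The orthogonal projection onto ker w* is 1 - ww*, as w is an isometry.
    have h4 : lin (adj (subHom U (isInvariant_ker (adj w)))) v = ⟨_, h2⟩ := by
      refine ext_inner_left ℂ fun k => ?_
      refine (LinearMap.adjoint_inner_right (lin (subHom U _)) k v).trans ?_
      change inner ℂ (lin (subHom U _) k) v =
        inner ℂ (lin (subHom U _) k) (v - lin w (lin (adj w) v))
      have h5 : lin (adj w) (lin (subHom U _) k) = 0 := mem_of_lin_subHom U _ k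
      rw [inner_sub_right, ← LinearMap.adjoint_inner_left, ← lin_adj, h5, inner_zero_left, sub_zero]
    rw [lin_add, LinearMap.add_apply, lin_comp, lin_comp, LinearMap.comp_apply,
      LinearMap.comp_apply, h4]
    change lin w (lin (adj w) v) + (v - lin w (lin (adj w) v)) = v
    abel

/-- Induction on the dimension: an isometry w from an irreducible is split off, and the
decomposition continues on ker w*, which is a corepresentation because w* is colinear. -/
lemma exists_decomposition (hUx : IsIrrFamily Ux) (n : ℕ) (U : UCorep B)
    (hn : Module.finrank ℂ U.carrier = n) : Nonempty (IrrDecomposition Ux U) := by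
  induction n using Nat.strong_induction_on generalizing U with
  | _ n ih =>
    rcases subsingleton_or_nontrivial U.carrier with h | h
    · exact ⟨⟨0, Fin.elim0, fun i => i.elim0, fun i => i.elim0,
        hom_ext (LinearMap.ext fun v => Subsingleton.elim _ _)⟩⟩
    · obtain ⟨V, f, hV, hf⟩ := exists_simple_sub U
      obtain ⟨x, ⟨e⟩⟩ := hUx.exhaustive V hV
      have := hUx.simple x
      obtain ⟨w, hw⟩ := exists_isometry (f := e.inv ≫ f) (fun h => hf (by
        rw [← cancel_epi e.inv, h, Limits.comp_zero]))
      have := nontrivial_of_simple (Ux x)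
      obtain ⟨v, hv⟩ := exists_ne (0 : (Ux x).carrier)
      -- The dimension drops since w*(wv) = v ≠ 0 exhibits a vector outside the kernel.
      have hlt : Module.finrank ℂ (LinearMap.ker (lin (adj w))) < n := by
        rw [← hn]
        refine Submodule.finrank_lt (lt_top_iff_ne_top.1 (lt_top_iff_ne_top.2 fun h => hv ?_))
        have h1 : lin w v ∈ LinearMap.ker (lin (adj w)) := by rw [h]; trivial
        have h2 : lin (adj w) (lin w v) = v := LinearMap.congr_fun (congrArg lin hw) v
        rw [← h2]
        exact h1
      obtain ⟨D⟩ := ih _ hlt (sub U (isInvariant_ker (adj w))) rfl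
      exact ⟨decompositionCons w hw D⟩

theorem nonempty_reconstructionChoice [IsRegularQuantumGroupoid B] (hUx : IsIrrFamily Ux) :
    Nonempty (ReconstructionChoice Ux) :=
  ⟨⟨fun U => (exists_decomposition hUx _ U rfl).some, fun x => contragredient (Ux x),
    fun x => exactPairing (Ux x)⟩⟩

end Decomposition

end UCorep

/-! ### Kleisli extension along an algebra object in a module category -/

namespace ModuleCategory

open MonoidalLeftAction

variable {C : Type*} [Category C] [MonoidalCategory C] {D : Type*} [Category D]
  [MonoidalLeftAction C D]

lemma actionHomRight_assoc_inv (U V : C) {X Y : D} (f : X ⟶ Y) :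
    U ⊴ₗ V ⊴ₗ f ≫ (αₗ U V Y).inv = (αₗ U V X).inv ≫ (U ⊗ V) ⊴ₗ f := by
  simp

lemma whiskerLeft_assoc_inv (U : C) {V W : C} (f : V ⟶ W) (X : D) :
    U ⊴ₗ (f ⊵ₗ X) ≫ (αₗ U W X).inv = (αₗ U V X).inv ≫ (U ◁ f) ⊵ₗ X := by
  simp

lemma whiskerRight_assoc_inv {U V : C} (f : U ⟶ V) (W : C) (X : D) :
    f ⊵ₗ (W ⊙ₗ X) ≫ (αₗ V W X).inv = (αₗ U W X).inv ≫ (f ▷ W) ⊵ₗ X := by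
  simp

/-- The pentagon of the action, rearranged for inverse associators, in which form the associator of
the acting category can be absorbed. -/
lemma associator_assoc_inv (U V W : C) (X : D) :
    (αₗ U V (W ⊙ₗ X)).inv ≫ (αₗ (U ⊗ V) W X).inv ≫ (α_ U V W).hom ⊵ₗ X =
      U ⊴ₗ (αₗ V W X).inv ≫ (αₗ U (V ⊗ W) X).inv := by
  rw [Iso.inv_comp_eq, Iso.inv_comp_eq, ← Category.assoc, ← Category.assoc, Iso.eq_comp_inv,
    ← cancel_mono (U ⊴ₗ (αₗ V W X).hom)]
  simp

variable {Q : C} (m : Q ⊗ Q ⟶ Q) (u : 𝟙_ C ⟶ Q)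

/-- The extension of a morphism `X → Q ⊠ Y` to `Q ⊠ X → Q ⊠ Y` by means of the product of `Q`. -/
def extend {X Y : D} (z : X ⟶ Q ⊙ₗ Y) : Q ⊙ₗ X ⟶ Q ⊙ₗ Y :=
  Q ⊴ₗ z ≫ (αₗ Q Q Y).inv ≫ m ⊵ₗ Y

/-- The associativity law of Kleisli composition for Q ⊠ -, equivalent here to moving one extension
past another and using associativity of m. -/
lemma extend_comp (hm : m ▷ Q ≫ m = (α_ Q Q Q).hom ≫ Q ◁ m ≫ m) {X Y Z : D} (z : X ⟶ Q ⊙ₗ Y)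
    (z' : Y ⟶ Q ⊙ₗ Z) : extend m (z ≫ extend m z') = extend m z ≫ extend m z' := by
  simp only [extend, actionHomRight_comp, Category.assoc]
  rw [reassoc_of% @whiskerLeft_assoc_inv, ← action_exchange_assoc, reassoc_of% @whiskerRight_assoc_inv,
    ← comp_actionHomLeft, ← comp_actionHomLeft, hm, comp_actionHomLeft (α_ Q Q Q).hom,
    ← reassoc_of% @actionHomRight_assoc_inv, reassoc_of% @associator_assoc_inv]

/-- The unit `X → Q ⊠ X`. -/
def unitMor (X : D) : X ⟶ Q ⊙ₗ X := (λₗ X).inv ≫ u ⊵ₗ X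

/-- The left unit law shows that a morphism is recovered from its extension; injectivity and
completeness of the representation of A both depend on this. -/
lemma unitMor_extend (hu : u ▷ Q ≫ m = (λ_ Q).hom) {X Y : D} (z : X ⟶ Q ⊙ₗ Y) :
    unitMor u X ≫ extend m z = z := by
  simp only [unitMor, extend, Category.assoc]
  rw [← action_exchange_assoc, actionUnitIso_inv_naturality_assoc, reassoc_of% @whiskerRight_assoc_inv,
    ← comp_actionHomLeft, hu, leftUnitor_actionHom]
  simp

lemma extend_unitMor (hu : Q ◁ u ≫ m = (ρ_ Q).hom) (X : D) :
    extend m (unitMor u X) = 𝟙 (Q ⊙ₗ X) := by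
  simp only [unitMor, extend, actionHomRight_comp, Category.assoc]
  rw [reassoc_of% @whiskerLeft_assoc_inv, ← comp_actionHomLeft, hu, rightUnitor_actionHom]
  simp

lemma extend_whisker {X Y : D} {U : C} (f : U ⟶ Q) (z : X ⟶ U ⊙ₗ Y) :
    extend m (z ≫ f ⊵ₗ Y) = Q ⊴ₗ z ≫ (αₗ Q U Y).inv ≫ (Q ◁ f ≫ m) ⊵ₗ Y := by
  simp only [extend, actionHomRight_comp, Category.assoc, comp_actionHomLeft]
  rw [reassoc_of% @whiskerLeft_assoc_inv]

/-- The product of `X ⊗ f` and `Y ⊗ g`. -/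
lemma comp_extend {X Y Z : D} {U V : C} (z : X ⟶ U ⊙ₗ Y) (z' : Y ⟶ V ⊙ₗ Z) (f : U ⟶ Q)
    (g : V ⟶ Q) : (z ≫ f ⊵ₗ Y) ≫ extend m (z' ≫ g ⊵ₗ Z) =
      (z ≫ U ⊴ₗ z' ≫ (αₗ U V Z).inv) ≫ ((f ⊗ₘ g) ≫ m) ⊵ₗ Z := by
  rw [extend_whisker, Category.assoc, ← action_exchange_assoc, reassoc_of% @whiskerRight_assoc_inv,
    ← comp_actionHomLeft, MonoidalCategory.tensorHom_def]
  simp only [Category.assoc]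

/-- The extension of the conjugate of a morphism. -/
lemma extend_conjugate {X Y : D} {U V : C} (r : 𝟙_ C ⟶ V ⊗ U) (z : U ⊙ₗ Y ⟶ X) (f : Q ⊗ V ⟶ Q) :
    Q ⊴ₗ ((λₗ Y).inv ≫ r ⊵ₗ Y ≫ (αₗ V U Y).hom ≫ V ⊴ₗ z) ≫ (αₗ Q V X).inv ≫ f ⊵ₗ X =
      ((ρ_ Q).inv ≫ Q ◁ r ≫ (α_ Q V U).inv ≫ f ▷ U) ⊵ₗ Y ≫ (αₗ Q U Y).hom ≫ Q ⊴ₗ z := by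
  -- The unit triangle and, below, the pentagon convert the associators of the acting category into
  -- those of the action; the rest is naturality and interchange.
  have h1 : (ρ_ Q).inv ⊵ₗ Y = Q ⊴ₗ (λₗ Y).inv ≫ (αₗ Q (𝟙_ C) Y).inv := by
    rw [← cancel_mono ((ρ_ Q).hom ⊵ₗ Y), ← comp_actionHomLeft, Iso.inv_hom_id, id_actionHomLeft,
      rightUnitor_actionHom]
    simp
  have h2 : (αₗ Q (V ⊗ U) Y).inv ≫ (α_ Q V U).inv ⊵ₗ Y ≫ (αₗ (Q ⊗ V) U Y).hom =
      Q ⊴ₗ (αₗ V U Y).hom ≫ (αₗ Q V (U ⊙ₗ Y)).inv := by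
    have h := associator_assoc_inv Q V U Y
    rw [← cancel_mono ((αₗ (Q ⊗ V) U Y).inv ≫ (α_ Q V U).hom ⊵ₗ Y)]
    simp only [Category.assoc, Iso.hom_inv_id_assoc]
    rw [inv_hom_actionHomLeft, Category.comp_id, h, actionHomRight_hom_inv_assoc]
  simp only [actionHomRight_comp, comp_actionHomLeft, Category.assoc]
  rw [reassoc_of% @actionHomRight_assoc_inv, action_exchange, h1]
  simp only [Category.assoc]
  rw [← reassoc_of% @whiskerLeft_assoc_inv, whiskerRight_actionHomLeft]
  simp only [Category.assoc, Iso.inv_hom_id_assoc]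
  rw [reassoc_of% h2]

end ModuleCategory

namespace Reconstruction

open MonoidalLeftAction CStarCategory UCorep ModuleCategory IsModuleCStarCategory

variable {B : Type u} [CStarAlgebra B] [WeakHopfCStarAlgebra B] [IsRegularQuantumGroupoid B]
  {M : Type w} [Category.{v} M] [Preadditive M] [Linear ℂ M] [CStarCategory M]
  [MonoidalLeftAction (UCorep B) M] [IsModuleCStarCategory B M]

lemma zero_actionHomLeft (U V : UCorep B) (X : M) : (0 : U ⟶ V) ⊵ₗ X = 0 := by
  simpa using smul_actionHomLeft (0 : ℂ) (0 : U ⟶ V) X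

lemma sum_actionHomLeft {ι : Type*} (s : Finset ι) {U V : UCorep B} (f : ι → (U ⟶ V)) (X : M) :
    (∑ i ∈ s, f i) ⊵ₗ X = ∑ i ∈ s, f i ⊵ₗ X := by
  classical
  induction s using Finset.induction_on with
  | empty => simp [zero_actionHomLeft]
  | insert i s hi ih => rw [Finset.sum_insert hi, Finset.sum_insert hi, add_actionHomLeft, ih]

lemma dagger_actionAssocIso_inv (U V : UCorep B) (X : M) :
    dagger (αₗ U V X).inv = (αₗ U V X).hom := by
  rw [← dagger_actionAssocIso, dagger_dagger]

lemma adj_id (U : UCorep B) : adj (𝟙 U) = 𝟙 U := by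
  rw [← Category.comp_id (adj _), ← adj_adj (adj (𝟙 U) ≫ 𝟙 U), adj_comp, adj_adj, Category.comp_id,
    adj_adj]

/-! ### The projection onto A -/

section Proj

variable (M₀ : M) {Ω : Type t} {Ux : Ω → UCorep B}

open Classical in
lemma proj_tmul {U : UCorep B} (D : IrrDecomposition Ux U) (X : M₀ ⟶ U ⊙ₗ M₀)
    (φ : Module.Dual ℂ U.carrier) : proj M₀ Ux D (X ⊗ₜ φ) =
      ∑ i, elem M₀ Ux (D.idx i) (X ≫ adj (D.w i) ⊵ₗ M₀) (φ ∘ₗ lin (D.w i)) := by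
  simp [proj, LinearMap.sum_apply, elem, Linear.rightComp_apply]
  rfl

lemma elem_sum_left (x : Ω) {ι : Type*} (s : Finset ι) (X : ι → (M₀ ⟶ Ux x ⊙ₗ M₀))
    (φ : Module.Dual ℂ (Ux x).carrier) :
    elem M₀ Ux x (∑ i ∈ s, X i) φ = ∑ i ∈ s, elem M₀ Ux x (X i) φ := by
  simp [elem, sum_tmul]

lemma elem_sum_right (x : Ω) {ι : Type*} (s : Finset ι) (X : M₀ ⟶ Ux x ⊙ₗ M₀)
    (φ : ι → Module.Dual ℂ (Ux x).carrier) :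
    elem M₀ Ux x X (∑ i ∈ s, φ i) = ∑ i ∈ s, elem M₀ Ux x X (φ i) := by
  simp [elem, tmul_sum]

/-- By Schur's lemma, `A` does not see the choice of the representatives. -/
lemma elem_comp (hUx : IsIrrFamily Ux) {x y : Ω} (f : Ux x ⟶ Ux y) (X : M₀ ⟶ Ux x ⊙ₗ M₀)
    (φ : Module.Dual ℂ (Ux y).carrier) :
    elem M₀ Ux y (X ≫ f ⊵ₗ M₀) φ = elem M₀ Ux x X (φ ∘ₗ lin f) := by
  have := hUx.simple x
  have := hUx.simple y
  by_cases hf : f = 0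
  · subst hf
    simp [zero_actionHomLeft, elem, lin_zero]
  · have := isIso_of_simple hf
    obtain rfl := hUx.eq_of_iso x y ⟨asIso f⟩
    obtain ⟨c, rfl⟩ := exists_eq_smul_id f
    rw [smul_actionHomLeft, id_actionHomLeft, Linear.comp_smul, Category.comp_id, lin_smul, lin_id,
      LinearMap.comp_smul, LinearMap.comp_id, elem, elem, smul_tmul]

/-- Inserting the resolution of the identity for U reduces the claim to morphisms between
irreducibles, where Schur's lemma (`elem_comp`) applies; the resolution for V then removes the
remaining sum. With f the identity, this says that p does not depend on the decomposition. -/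
lemma proj_comp (hUx : IsIrrFamily Ux) {U V : UCorep B} (D : IrrDecomposition Ux U)
    (E : IrrDecomposition Ux V) (f : U ⟶ V) (X : M₀ ⟶ U ⊙ₗ M₀) (φ : Module.Dual ℂ V.carrier) :
    proj M₀ Ux E ((X ≫ f ⊵ₗ M₀) ⊗ₜ φ) = proj M₀ Ux D (X ⊗ₜ (φ ∘ₗ lin f)) := by
  have h (i) : elem M₀ Ux (E.idx i) ((X ≫ f ⊵ₗ M₀) ≫ adj (E.w i) ⊵ₗ M₀) (φ ∘ₗ lin (E.w i)) =
      ∑ j, elem M₀ Ux (D.idx j) (X ≫ adj (D.w j) ⊵ₗ M₀)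
        (φ ∘ₗ lin (D.w j ≫ f ≫ adj (E.w i) ≫ E.w i)) := by
    have h1 : (X ≫ f ⊵ₗ M₀) ≫ adj (E.w i) ⊵ₗ M₀ =
        ∑ j, (X ≫ adj (D.w j) ⊵ₗ M₀) ≫ (D.w j ≫ f ≫ adj (E.w i)) ⊵ₗ M₀ := by
      simp only [Category.assoc, ← comp_actionHomLeft]
      rw [← Preadditive.comp_sum, ← sum_actionHomLeft]
      congr 2
      conv_lhs => rw [← Category.id_comp (f ≫ _), ← D.sum_eq, Preadditive.sum_comp]
      simp only [Category.assoc]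
    rw [h1, elem_sum_left]
    refine Finset.sum_congr rfl fun j _ => ?_
    rw [elem_comp M₀ hUx, LinearMap.comp_assoc, ← lin_comp]
    simp only [Category.assoc]
  rw [proj_tmul, proj_tmul, Finset.sum_congr rfl fun i _ => h i, Finset.sum_comm]
  refine Finset.sum_congr rfl fun j _ => ?_
  rw [← elem_sum_right]
  congr 1
  rw [LinearMap.comp_assoc, ← lin_comp]
  conv_rhs => rw [← Category.comp_id f, ← E.sum_eq]
  rw [Preadditive.comp_sum, Preadditive.comp_sum, lin_sum]
  ext v
  simp

/-- The decomposition of an irreducible corepresentation. -/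
def IrrDecomposition.self (Ux : Ω → UCorep B) (x : Ω) : IrrDecomposition Ux (Ux x) where
  n := 1
  idx _ := x
  w _ := 𝟙 _
  isometry _ := by rw [adj_id, Category.comp_id]
  sum_eq := by rw [adj_id]; simp

lemma proj_self (x : Ω) (X : M₀ ⟶ Ux x ⊙ₗ M₀) (φ : Module.Dual ℂ (Ux x).carrier) :
    proj M₀ Ux (IrrDecomposition.self Ux x) (X ⊗ₜ φ) = elem M₀ Ux x X φ := by
  rw [proj_tmul]
  refine (Fin.sum_univ_one _).trans ?_
  change elem M₀ Ux x (X ≫ adj (𝟙 (Ux x)) ⊵ₗ M₀) (φ ∘ₗ lin (𝟙 (Ux x))) = _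
  rw [adj_id, id_actionHomLeft, Category.comp_id, lin_id, LinearMap.comp_id]

end Proj

/-! ### The representation of A on the regular object -/

section Regular

variable (M₀ : M)

/-- `X ⊗ φ ↦ (φ̂ ⊠ id)X`, where `φ̂ : U → B` is the morphism into the regular corepresentation given
by the matrix coefficients of `φ`. -/
def compReg (U : UCorep B) : Comp M₀ U →ₗ[ℂ] (M₀ ⟶ reg B ⊙ₗ M₀) :=
  TensorProduct.lift (LinearMap.mk₂ ℂ (fun X φ => X ≫ coefHom U φ ⊵ₗ M₀)
    (fun X X' φ => by simp) (fun c X φ => by simp)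
    (fun X φ φ' => by simp [coefHom_add, add_actionHomLeft])
    (fun c X φ => by simp [coefHom_smul, smul_actionHomLeft]))

@[simp]
lemma compReg_tmul (U : UCorep B) (X : M₀ ⟶ U ⊙ₗ M₀) (φ : Module.Dual ℂ U.carrier) :
    compReg M₀ U (X ⊗ₜ φ) = X ≫ coefHom U φ ⊵ₗ M₀ := rfl

variable {Ω : Type t} (Ux : Ω → UCorep B)

open Classical in
/-- The map `A → F(B)` into the value of `F` at the regular corepresentation. -/
def algReg : Alg M₀ Ux →ₗ[ℂ] (M₀ ⟶ reg B ⊙ₗ M₀) :=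
  DirectSum.toModule ℂ Ω _ fun x => compReg M₀ (Ux x)

variable {Ux}

@[simp]
lemma algReg_elem (x : Ω) (X : M₀ ⟶ Ux x ⊙ₗ M₀) (φ : Module.Dual ℂ (Ux x).carrier) :
    algReg M₀ Ux (elem M₀ Ux x X φ) = X ≫ coefHom (Ux x) φ ⊵ₗ M₀ := by
  classical
  rw [algReg, elem, DirectSum.toModule_lof, compReg_tmul]

/-- Since coefficients are natural and the sum of w_i w_i* is 1, passing to irreducible components
does not change the image in F(`reg B`). -/
lemma algReg_proj {U : UCorep B} (D : IrrDecomposition Ux U) (a : Comp M₀ U) :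
    algReg M₀ Ux (proj M₀ Ux D a) = compReg M₀ U a := by
  induction a using TensorProduct.induction_on with
  | zero => simp
  | add a b ha hb => simp only [map_add, ha, hb]
  | tmul X φ =>
    rw [proj_tmul, map_sum, compReg_tmul]
    simp only [algReg_elem, Category.assoc, ← comp_actionHomLeft, ← comp_coefHom]
    rw [← Preadditive.comp_sum, ← sum_actionHomLeft]
    congr 2
    conv_rhs => rw [← Category.id_comp (coefHom U φ), ← D.sum_eq, Preadditive.sum_comp]
    simp only [Category.assoc]

lemma alg_induction {p : Alg M₀ Ux → Prop} (a : Alg M₀ Ux) (zero : p 0)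
    (add : ∀ a b, p a → p b → p (a + b)) (elem : ∀ x X φ, p (elem M₀ Ux x X φ)) : p a := by
  classical
  induction a using DirectSum.induction_on with
  | zero => exact zero
  | add a b ha hb => exact add a b ha hb
  | of x a =>
    induction a using TensorProduct.induction_on with
    | zero => simpa using zero
    | add a b ha hb => rw [map_add]; exact add _ _ ha hb
    | tmul X φ => exact elem x X φ

/-- The map `A → F(B)` is bijective. -/
def algRegEquiv (hUx : IsIrrFamily Ux) (D : IrrDecomposition Ux (reg B)) :
    Alg M₀ Ux ≃ₗ[ℂ] (M₀ ⟶ reg B ⊙ₗ M₀) where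
  __ := algReg M₀ Ux
  -- The counit is the functional whose coefficient morphism is the identity of `reg B`; naturality
  -- of p then returns X ⊗ φ, because ε composed with the coefficient morphism of φ is φ.
  invFun z := proj M₀ Ux D (z ⊗ₜ regCounit B)
  left_inv a := by
    change proj M₀ Ux D (algReg M₀ Ux a ⊗ₜ _) = a
    induction a using alg_induction with
    | zero => simp
    | add a b ha hb => rw [map_add, add_tmul, map_add, ha, hb]
    | elem x X φ =>
      rw [algReg_elem, proj_comp M₀ hUx (IrrDecomposition.self Ux x), proj_self,
        regCounit_comp_coefHom]
  right_inv z := by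
    change algReg M₀ Ux (proj M₀ Ux D (z ⊗ₜ _)) = z
    rw [algReg_proj, compReg_tmul, coefHom_regCounit, id_actionHomLeft, Category.comp_id]

lemma algReg_injective (hUx : IsIrrFamily Ux) : Function.Injective (algReg M₀ Ux) :=
  (algRegEquiv M₀ hUx ((nonempty_reconstructionChoice hUx).some.decomp _)).injective

lemma algReg_surjective (hUx : IsIrrFamily Ux) : Function.Surjective (algReg M₀ Ux) :=
  (algRegEquiv M₀ hUx ((nonempty_reconstructionChoice hUx).some.decomp _)).surjective

/-- The action of `F(B)` on `B ⊠ M₀`. -/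
def regExtend : (M₀ ⟶ reg B ⊙ₗ M₀) →ₗ[ℂ] (reg B ⊙ₗ M₀ ⟶ reg B ⊙ₗ M₀) where
  toFun z := extend (regMul B) z
  map_add' z z' := by simp [extend, actionHomRight_add]
  map_smul' c z := by simp [extend, actionHomRight_smul]

lemma regExtend_apply (z : M₀ ⟶ reg B ⊙ₗ M₀) : regExtend M₀ z = extend (regMul B) z := rfl

variable (Ux) in
/-- The representation of `A` on `B ⊠ M₀`. -/
def rep : Alg M₀ Ux →ₗ[ℂ] (reg B ⊙ₗ M₀ ⟶ reg B ⊙ₗ M₀) := regExtend M₀ ∘ₗ algReg M₀ Ux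

lemma rep_apply (a : Alg M₀ Ux) : rep M₀ Ux a = extend (regMul B) (algReg M₀ Ux a) := rfl

/-- Restriction along the unit of `reg B` inverts the extension, which makes `rep` faithful and
bounds the norm of `algReg` by that of `rep`. -/
lemma unitMor_rep (a : Alg M₀ Ux) :
    unitMor (regUnit B) M₀ ≫ rep M₀ Ux a = algReg M₀ Ux a :=
  unitMor_extend _ _ regUnit_whiskerRight _

lemma rep_injective (hUx : IsIrrFamily Ux) : Function.Injective (rep M₀ Ux) := fun a b h =>
  algReg_injective M₀ hUx (by rw [← unitMor_rep, h, unitMor_rep])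

variable (c : ReconstructionChoice Ux)

open Classical in
lemma mulMap_elem (x y : Ω) (X : M₀ ⟶ Ux x ⊙ₗ M₀) (Y : M₀ ⟶ Ux y ⊙ₗ M₀)
    (φ : Module.Dual ℂ (Ux x).carrier) (ψ : Module.Dual ℂ (Ux y).carrier) :
    mulMap M₀ c (elem M₀ Ux x X φ) (elem M₀ Ux y Y ψ) =
      proj M₀ Ux (c.decomp (Ux y ⊗ Ux x))
        (homMul M₀ (Ux y) (Ux x) Y X ⊗ₜ dualMul (Ux y) (Ux x) ψ φ) := by
  rw [mulMap, elem, elem, DirectSum.toModule_lof, LinearMap.flip_apply, DirectSum.toModule_lof]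
  rfl

lemma starMap_elem (x : Ω) (X : M₀ ⟶ Ux x ⊙ₗ M₀) (φ : Module.Dual ℂ (Ux x).carrier) :
    letI := c.pairing x
    starMap M₀ c (elem M₀ Ux x X φ) = proj M₀ Ux (c.decomp (c.dual x))
        (homBullet M₀ (Ux x) (c.dual x) X ⊗ₜ dualBullet (Ux x) (c.dual x) φ) := by
  classical
  let _ := c.pairing x
  refine (DirectSum.toAddMonoid_of _ _ _).trans rfl

/-- The reversed order in the product of A appears here as Kleisli composition in diagrammatic
order: b first, then a. -/
lemma algReg_mulMap (a b : Alg M₀ Ux) :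
    algReg M₀ Ux (mulMap M₀ c a b) = algReg M₀ Ux b ≫ rep M₀ Ux a := by
  induction a using alg_induction with
  | zero => simp
  | add a a' ha ha' => simp only [map_add, LinearMap.add_apply, ha, ha', Preadditive.comp_add]
  | elem x X φ =>
    induction b using alg_induction with
    | zero => simp
    | add b b' hb hb' => simp only [map_add, hb, hb', Preadditive.add_comp]
    | elem y Y ψ =>
      rw [mulMap_elem, algReg_proj, compReg_tmul, coefHom_dualMul, rep_apply, algReg_elem,
        algReg_elem, comp_extend]
      rfl

/-- In the usual order of composition the right side is the product of the operators of a and b, so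
`rep` is a homomorphism and not an antihomomorphism. -/
lemma rep_mulMap (a b : Alg M₀ Ux) :
    rep M₀ Ux (mulMap M₀ c a b) = rep M₀ Ux b ≫ rep M₀ Ux a := by
  rw [rep_apply, algReg_mulMap, rep_apply, rep_apply, extend_comp _ regMul_assoc]

lemma algReg_unitElt : algReg M₀ Ux (unitElt M₀ c) = unitMor (regUnit B) M₀ := by
  rw [unitElt, algReg_proj, compReg_tmul, coefHom_unitOne]
  rfl

lemma rep_unitElt : rep M₀ Ux (unitElt M₀ c) = 𝟙 _ := by
  rw [rep_apply, algReg_unitElt, extend_unitMor _ _ whiskerLeft_regUnit]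

/-- The extension of X^• slides past X* by interchange (`extend_conjugate`), which leaves an
identity between morphisms of corepresentations that no longer involves X. That identity is
`adj_mulCoef`. -/
lemma rep_starMap (a : Alg M₀ Ux) : rep M₀ Ux (starMap M₀ c a) = dagger (rep M₀ Ux a) := by
  induction a using alg_induction with
  | zero =>
    have : dagger (0 : reg B ⊙ₗ M₀ ⟶ reg B ⊙ₗ M₀) = 0 := by
      simpa using dagger_smul (0 : ℂ) (0 : reg B ⊙ₗ M₀ ⟶ reg B ⊙ₗ M₀)
    simp [this]
  | add a b ha hb => simp only [map_add, dagger_add, ha, hb]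
  | elem x X φ =>
    let _ := c.pairing x
    rw [rep_apply, rep_apply, starMap_elem, algReg_proj, compReg_tmul, algReg_elem, extend_whisker,
      extend_whisker]
    refine (extend_conjugate (adj (ε_ (Ux x) (c.dual x))) (dagger X) _).trans ?_
    rw [dagger_comp, dagger_comp, dagger_actionHomLeft, dagger_actionHomRight,
      dagger_actionAssocIso_inv, Category.assoc]
    congr 2
    exact (adj_mulCoef (Ux x) (c.dual x) φ).symm

/-- Each axiom holds for endomorphisms of `reg B` ⊠ M₀ and is reflected by the injective map `rep`.
-/
lemma isUnitalStarAlgebra (hUx : IsIrrFamily Ux) : (starAlgebra M₀ c).IsUnitalStarAlgebra where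
  mul_assoc a b d := rep_injective M₀ hUx (by simp [starAlgebra, rep_mulMap])
  one_mul a := rep_injective M₀ hUx (by simp [starAlgebra, rep_mulMap, rep_unitElt])
  mul_one a := rep_injective M₀ hUx (by simp [starAlgebra, rep_mulMap, rep_unitElt])
  star_star a := rep_injective M₀ hUx (by simp [starAlgebra, rep_starMap, dagger_dagger])
  star_mul a b := rep_injective M₀ hUx (by
    simp [starAlgebra, rep_starMap, rep_mulMap, dagger_comp])

end Regular

end Reconstruction

namespace Reconstruction

open MonoidalLeftAction CStarCategory UCorep ModuleCategory IsModuleCStarCategory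

/-! ### Compatibility of the coactions on conjugate spaces -/

section DualCoact

variable {B : Type u} [CStarAlgebra B] [WeakHopfCStarAlgebra B]

local notation "S" => (antipode : B →ₗ[ℂ] B)

/-- The coactions on the conjugate spaces are natural. -/
lemma dualCoact_comp {U V : UCorep B} (f : U ⟶ V) (φ : Module.Dual ℂ V.carrier) :
    dualCoact U (φ ∘ₗ lin f) = (lin f).dualMap.rTensor B (dualCoact V φ) := by
  refine dual_separates fun v => ?_
  have h : Module.Dual.eval ℂ U.carrier v ∘ₗ (lin f).dualMap =
      Module.Dual.eval ℂ V.carrier (lin f v) := rfl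
  rw [eval_dualCoact, ← LinearMap.rTensor_comp_apply, h, eval_dualCoact, coef_lin]

/-- The slice of the coaction on the conjugate space. -/
lemma slice_dualCoact (U : UCorep B) (χ : Module.Dual ℂ B) (φ : Module.Dual ℂ U.carrier) :
    TensorProduct.rid ℂ _ (χ.lTensor _ (dualCoact U φ)) = χ ∘ₗ S ∘ₗ coef U φ := by
  ext v
  simp only [LinearMap.comp_apply]
  rw [← eval_dualCoact]
  generalize dualCoact U φ = t
  induction t with
  | zero => simp
  | add x y hx hy => simp only [map_add, LinearMap.add_apply, hx, hy]
  | tmul x y => simp [mul_comm]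

/-- A slice of the coaction becomes composition with an endomorphism of `reg B` that depends neither
on U nor on φ. Continuity of the coaction comes from this. -/
lemma coefHom_slice_dualCoact (U : UCorep B) (χ : Module.Dual ℂ B) (φ : Module.Dual ℂ U.carrier) :
    coefHom U (TensorProduct.rid ℂ _ (χ.lTensor _ (dualCoact U φ))) =
      coefHom U φ ≫ coefHom (reg B) (χ ∘ₗ S ∘ₗ (regB (B := B)).toLinearMap) := by
  rw [comp_coefHom, slice_dualCoact]
  rfl

variable [IsRegularQuantumGroupoid B]

/-- The coactions on the conjugate spaces are compatible with tensor products. -/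
lemma dualCoact_dualMul (U V : UCorep B) (φ : Module.Dual ℂ U.carrier)
    (ψ : Module.Dual ℂ V.carrier) : dualCoact (U ⊗ V) (dualMul U V φ ψ) =
      TensorProduct.map₂ (dualMul U V) (LinearMap.mul ℂ B).flip (dualCoact U φ)
        (dualCoact V ψ) := by
  refine dual_separates fun z => ?_
  obtain ⟨s, hs⟩ := TensorProduct.exists_finset (incl U V z)
  have h (t : Module.Dual ℂ U.carrier ⊗[ℂ] B) (r : Module.Dual ℂ V.carrier ⊗[ℂ] B) :
      TensorProduct.lid ℂ B ((Module.Dual.eval ℂ _ z).rTensor B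
        (TensorProduct.map₂ (dualMul U V) (LinearMap.mul ℂ B).flip t r)) =
      ∑ i ∈ s, TensorProduct.lid ℂ B ((Module.Dual.eval ℂ _ i.2).rTensor B r) *
        TensorProduct.lid ℂ B ((Module.Dual.eval ℂ _ i.1).rTensor B t) := by
    induction t with
    | zero => simp
    | add x y hx hy =>
      simp only [map_add, LinearMap.add_apply, hx, hy, mul_add, Finset.sum_add_distrib]
    | tmul x b =>
      induction r with
      | zero => simp
      | add x y hx hy => simp only [map_add, hx, hy, add_mul, Finset.sum_add_distrib]
      | tmul y c =>
        have : dualMul U V x y z = ∑ i ∈ s, x i.1 * y i.2 := by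
          change TensorProduct.dualDistrib ℂ _ _ (x ⊗ₜ y) (incl U V z) = _
          simp [hs, map_sum]
        rw [TensorProduct.map₂_apply_tmul, TensorProduct.map_tmul, LinearMap.rTensor_tmul,
          TensorProduct.lid_tmul, Module.Dual.eval_apply, this, Finset.sum_smul]
        refine Finset.sum_congr rfl fun i _ => ?_
        simp only [LinearMap.rTensor_tmul, TensorProduct.lid_tmul, Module.Dual.eval_apply,
          LinearMap.flip_apply, LinearMap.mul_apply', smul_mul_smul_comm, mul_comm (x i.1)]
  rw [h, eval_dualCoact]
  simp only [eval_dualCoact]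
  have : coef (U ⊗ V) (dualMul U V φ ψ) z = ∑ i ∈ s, coef U φ i.1 * coef V ψ i.2 := by
    refine (coef_tensor U V φ ψ z).trans ?_
    simp [hs, map_sum]
  -- S reverses the product of the coefficients, which accounts for the flipped multiplication of B.
  rw [this, map_sum]
  simp only [antipode_mul]

/-- The coactions on the conjugate spaces are compatible with conjugation. -/
lemma dualCoact_dualBullet (U V : UCorep B) [ExactPairing U V] (φ : Module.Dual ℂ U.carrier) :
    dualCoact V (dualBullet U V φ) = TensorProduct.map (dualBullet U V)
      (starLinearEquiv ℂ : B ≃ₗ⋆[ℂ] B).toLinearMap (dualCoact U φ) := by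
  refine dual_separates fun w => ?_
  obtain ⟨ξ, rfl⟩ := exists_eq_bar φ
  -- The bullet is the form of the adjoint of the coevaluation, so `coef_pairForm` exchanges S of
  -- the coefficient of V for a coefficient of U.
  rw [eval_dualCoact, dualBullet_bar, ← coef_pairForm,
    dualCoact_bar U (stdOrthonormalBasis ℂ U.carrier),
    ← sum_coef_bar U (stdOrthonormalBasis ℂ U.carrier)]
  simp only [map_sum]
  refine Finset.sum_congr rfl fun j _ => ?_
  rw [TensorProduct.map_tmul, dualBullet_bar]
  simp

/-- The coefficients involved are S(z)* with z in B_s, so their adjoints are S(z) = ε_t(z). -/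
lemma dualCoact_unitOne : dualCoact (𝟙_ (UCorep B)) (bar (unitOne B)) ∈
    LinearMap.range ((target B).subtype.lTensor (Module.Dual ℂ (𝟙_ (UCorep B)).carrier)) := by
  rw [dualCoact_bar _ (stdOrthonormalBasis ℂ (𝟙_ (UCorep B)).carrier)]
  refine Submodule.sum_mem _ fun j _ => ?_
  have h (z : SourceSpace B) : star (coef (𝟙_ (UCorep B)) (bar z) (unitOne B)) ∈ target B := by
    have : coef (𝟙_ (UCorep B)) (bar z) (unitOne B) = star (S (SourceSpace.val B z)) := by
      refine (innerSlice_sourceCoact (SourceSpace.one B) z).trans ?_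
      rw [SourceSpace.val_one, one_mul]
    rw [this, star_star, ← target_eq_antipode z.val_mem]
    exact LinearMap.mem_range_self _ _
  exact ⟨bar _ ⊗ₜ ⟨_, h _⟩, rfl⟩

end DualCoact

/-! ### The coaction on A -/

section Coaction

variable {B : Type u} [CStarAlgebra B] [WeakHopfCStarAlgebra B] [IsRegularQuantumGroupoid B]
  {M : Type w} [Category.{v} M] [Preadditive M] [Linear ℂ M] [CStarCategory M]
  [MonoidalLeftAction (UCorep B) M] [IsModuleCStarCategory B M]
  (M₀ : M) {Ω : Type t} {Ux : Ω → UCorep B}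

open Classical in
variable (Ux) in
/-- `φ ↦ X ⊗ φ` -/
def elemHom (x : Ω) (X : M₀ ⟶ Ux x ⊙ₗ M₀) : Module.Dual ℂ (Ux x).carrier →ₗ[ℂ] Alg M₀ Ux :=
  DirectSum.lof ℂ Ω (fun x => Comp M₀ (Ux x)) x ∘ₗ TensorProduct.mk ℂ _ _ X

lemma elemHom_apply (x : Ω) (X : M₀ ⟶ Ux x ⊙ₗ M₀) (φ : Module.Dual ℂ (Ux x).carrier) :
    elemHom M₀ Ux x X φ = elem M₀ Ux x X φ := rfl

/-- `φ ↦ p(X ⊗ φ)` -/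
def projHom {U : UCorep B} (D : IrrDecomposition Ux U) (X : M₀ ⟶ U ⊙ₗ M₀) :
    Module.Dual ℂ U.carrier →ₗ[ℂ] Alg M₀ Ux :=
  proj M₀ Ux D ∘ₗ TensorProduct.mk ℂ _ _ X

lemma projHom_apply {U : UCorep B} (D : IrrDecomposition Ux U) (X : M₀ ⟶ U ⊙ₗ M₀)
    (φ : Module.Dual ℂ U.carrier) : projHom M₀ D X φ = proj M₀ Ux D (X ⊗ₜ φ) := rfl

lemma coaction_elem (x : Ω) (X : M₀ ⟶ Ux x ⊙ₗ M₀) (φ : Module.Dual ℂ (Ux x).carrier) :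
    coaction M₀ Ux (elem M₀ Ux x X φ) = (elemHom M₀ Ux x X).rTensor B (dualCoact (Ux x) φ) := by
  classical
  rw [coaction, elem, DirectSum.toModule_lof]
  simp only [LinearMap.comp_apply, LinearMap.lTensor_tmul, LinearEquiv.coe_coe]
  generalize dualCoact (Ux x) φ = t
  induction t using TensorProduct.induction_on with
  | zero => simp
  | add a b ha hb => simp only [tmul_add, map_add, ha, hb]
  | tmul ψ b => rfl

/-- Naturality of `dualCoact` for the isometries w_i extends the formula for the coaction to F(U) ⊗
H̄_U with U arbitrary, so products and conjugates need not be decomposed. -/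
lemma coaction_proj {U : UCorep B} (D : IrrDecomposition Ux U) (X : M₀ ⟶ U ⊙ₗ M₀)
    (φ : Module.Dual ℂ U.carrier) :
    coaction M₀ Ux (proj M₀ Ux D (X ⊗ₜ φ)) = (projHom M₀ D X).rTensor B (dualCoact U φ) := by
  have h : projHom M₀ D X = ∑ i, elemHom M₀ Ux (D.idx i) (X ≫ adj (D.w i) ⊵ₗ M₀) ∘ₗ
      (lin (D.w i)).dualMap := LinearMap.ext fun ψ => by
    rw [projHom_apply, proj_tmul, LinearMap.sum_apply]
    rfl
  have h' (t : Module.Dual ℂ U.carrier ⊗[ℂ] B) : (projHom M₀ D X).rTensor B t =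
      ∑ i, (elemHom M₀ Ux (D.idx i) (X ≫ adj (D.w i) ⊵ₗ M₀) ∘ₗ (lin (D.w i)).dualMap).rTensor B
        t := by
    induction t with
    | zero => simp
    | add x y hx hy => simp only [map_add, hx, hy, Finset.sum_add_distrib]
    | tmul ψ b => simp only [LinearMap.rTensor_tmul, h, LinearMap.sum_apply, sum_tmul]
  rw [proj_tmul, map_sum, h']
  refine Finset.sum_congr rfl fun i _ => ?_
  rw [coaction_elem, dualCoact_comp, ← LinearMap.rTensor_comp_apply]

/-- The coaction in terms of orthonormal bases. -/
lemma coaction_elem_bar (x : Ω) (X : M₀ ⟶ Ux x ⊙ₗ M₀) {J : Type*} [Fintype J]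
    (e : OrthonormalBasis J ℂ (Ux x).carrier) (i : J) :
    coaction M₀ Ux (elem M₀ Ux x X (bar (e i))) =
      ∑ j, elem M₀ Ux x X (bar (e j)) ⊗ₜ[ℂ] star (matrixCoeff (Ux x) e j i) := by
  rw [coaction_elem, dualCoact_bar _ e, map_sum]
  rfl

variable (c : ReconstructionChoice Ux)

/-- Two reversals cancel: the product of A exchanges the tensor factors, and `dualCoact_dualMul`
exchanges the factors in B. -/
lemma coaction_mulMap (a b : Alg M₀ Ux) : coaction M₀ Ux (mulMap M₀ c a b) =
    TensorProduct.map₂ (mulMap M₀ c) (LinearMap.mul ℂ B) (coaction M₀ Ux a)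
      (coaction M₀ Ux b) := by
  induction a using alg_induction with
  | zero => simp
  | add a a' ha ha' => simp only [map_add, LinearMap.add_apply, ha, ha']
  | elem x X φ =>
    induction b using alg_induction with
    | zero => simp
    | add b b' hb hb' => simp only [map_add, hb, hb']
    | elem y Y ψ =>
      rw [mulMap_elem, coaction_proj, dualCoact_dualMul, coaction_elem, coaction_elem]
      generalize dualCoact (Ux x) φ = t
      generalize dualCoact (Ux y) ψ = r
      induction t using TensorProduct.induction_on with
      | zero => simp
      | add a b ha hb => simp only [map_add, LinearMap.add_apply, ha, hb]
      | tmul φ b =>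
        induction r using TensorProduct.induction_on with
        | zero => simp
        | add a b ha hb => simp only [map_add, LinearMap.add_apply, ha, hb]
        | tmul ψ d =>
          simp only [TensorProduct.map₂_apply_tmul, TensorProduct.map_tmul,
            LinearMap.rTensor_tmul, elemHom_apply, mulMap_elem]
          rfl

lemma coaction_starMap (a : Alg M₀ Ux) : coaction M₀ Ux (starMap M₀ c a) =
    TensorProduct.map (starMap M₀ c) (starLinearEquiv ℂ : B ≃ₗ⋆[ℂ] B).toLinearMap
      (coaction M₀ Ux a) := by
  induction a using alg_induction with
  | zero => simp
  | add a b ha hb => simp only [map_add, ha, hb]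
  | elem x X φ =>
    let _ := c.pairing x
    rw [starMap_elem, coaction_proj, dualCoact_dualBullet, coaction_elem]
    generalize dualCoact (Ux x) φ = t
    induction t using TensorProduct.induction_on with
    | zero => simp
    | add a b ha hb => simp only [map_add, ha, hb]
    | tmul φ b =>
      rw [TensorProduct.map_tmul, LinearMap.rTensor_tmul, LinearMap.rTensor_tmul,
        TensorProduct.map_tmul, elemHom_apply, starMap_elem]
      rfl

lemma coaction_coassoc (a : Alg M₀ Ux) :
    TensorProduct.assoc ℂ _ B B ((coaction M₀ Ux).rTensor B (coaction M₀ Ux a)) =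
      (CoalgebraStruct.comul : B →ₗ[ℂ] B ⊗[ℂ] B).lTensor _ (coaction M₀ Ux a) := by
  induction a using alg_induction with
  | zero => simp
  | add a b ha hb => simp only [map_add, ha, hb]
  | elem x X φ =>
    have h1 (t : Module.Dual ℂ (Ux x).carrier ⊗[ℂ] B) :
        TensorProduct.assoc ℂ _ B B ((coaction M₀ Ux).rTensor B
          ((elemHom M₀ Ux x X).rTensor B t)) = (elemHom M₀ Ux x X).rTensor (B ⊗[ℂ] B)
            (TensorProduct.assoc ℂ _ B B ((dualCoact (Ux x)).rTensor B t)) := by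
      induction t using TensorProduct.induction_on with
      | zero => simp
      | add a b ha hb => simp only [map_add, ha, hb]
      | tmul φ b =>
        simp only [LinearMap.rTensor_tmul, elemHom_apply, coaction_elem]
        generalize dualCoact (Ux x) φ = r
        induction r using TensorProduct.induction_on with
        | zero => simp
        | add a b ha hb => simp only [map_add, add_tmul, ha, hb]
        | tmul φ d => rfl
    rw [coaction_elem, h1, dualCoact_coassoc, ← LinearMap.comp_apply,
      ← LinearMap.comp_apply (LinearMap.lTensor _ _), LinearMap.rTensor_comp_lTensor,
      LinearMap.lTensor_comp_rTensor]

lemma coaction_counit (a : Alg M₀ Ux) : epsR B _ (coaction M₀ Ux a) = a := by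
  induction a using alg_induction with
  | zero => simp
  | add a b ha hb => rw [map_add, map_add, ha, hb]
  | elem x X φ =>
    have h (t : Module.Dual ℂ (Ux x).carrier ⊗[ℂ] B) :
        epsR B _ ((elemHom M₀ Ux x X).rTensor B t) = elemHom M₀ Ux x X (epsR B _ t) := by
      induction t using TensorProduct.induction_on with
      | zero => simp
      | add a b ha hb => simp only [map_add, ha, hb]
      | tmul φ b => simp
    rw [coaction_elem, h, dualCoact_counit, elemHom_apply]

lemma coaction_unitElt : coaction M₀ Ux (unitElt M₀ c) ∈
    LinearMap.range ((target B).subtype.lTensor (Alg M₀ Ux)) := by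
  obtain ⟨t, ht⟩ := dualCoact_unitOne (B := B)
  rw [unitElt, coaction_proj, ← ht, ← LinearMap.comp_apply, LinearMap.rTensor_comp_lTensor,
    ← LinearMap.lTensor_comp_rTensor]
  exact ⟨_, rfl⟩

lemma coaction_isRightCoaction : (starAlgebra M₀ c).IsRightCoaction (coaction M₀ Ux) where
  map_mul := coaction_mulMap M₀ c
  map_star := coaction_starMap M₀ c
  coassoc := coaction_coassoc M₀
  counit := coaction_counit M₀
  map_one := coaction_unitElt M₀ c

/-- The slices of the coaction on `A ≅ F(B)` are given by endomorphisms of the regular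
corepresentation. -/
lemma algReg_slice_coaction (χ : Module.Dual ℂ B) (a : Alg M₀ Ux) :
    algReg M₀ Ux (TensorProduct.rid ℂ _ (χ.lTensor _ (coaction M₀ Ux a))) =
      algReg M₀ Ux a ≫
        coefHom (reg B) (χ ∘ₗ antipode ∘ₗ (regB (B := B)).toLinearMap) ⊵ₗ M₀ := by
  induction a using alg_induction with
  | zero => simp
  | add a b ha hb => simp only [map_add, ha, hb, Preadditive.add_comp]
  | elem x X φ =>
    have h (t : Module.Dual ℂ (Ux x).carrier ⊗[ℂ] B) :
        TensorProduct.rid ℂ _ (χ.lTensor _ ((elemHom M₀ Ux x X).rTensor B t)) =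
          elemHom M₀ Ux x X (TensorProduct.rid ℂ _ (χ.lTensor _ t)) := by
      induction t using TensorProduct.induction_on with
      | zero => simp
      | add a b ha hb => simp only [map_add, ha, hb]
      | tmul φ b => simp
    rw [coaction_elem, h, elemHom_apply, algReg_elem, algReg_elem, coefHom_slice_dualCoact,
      comp_actionHomLeft, Category.assoc]

end Coaction

end Reconstruction

/-! ### C*-algebras from complete C*-norms -/

namespace StarAlgebraData

variable {A : Type w} [AddCommGroup A] [Module ℂ A]

/-- Complete C*-norms. -/
structure IsCStarNorm (s : StarAlgebraData A) (N : A → ℝ) : Prop where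
  add_le (a b : A) : N (a + b) ≤ N a + N b
  smul (c : ℂ) (a : A) : N (c • a) = ‖c‖ * N a
  eq_zero (a : A) : N a = 0 → a = 0
  mul_le (a b : A) : N (s.mul a b) ≤ N a * N b
  star_mul_self (a : A) : N (s.mul (s.star a) a) = N a ^ 2
  complete (f : ℕ → A)
    (hf : ∀ r : ℝ, 0 < r → ∃ n₀ : ℕ, ∀ m n : ℕ, n₀ ≤ m → n₀ ≤ n → N (f m - f n) < r) :
    ∃ g : A, ∀ r : ℝ, 0 < r → ∃ n₀ : ℕ, ∀ n : ℕ, n₀ ≤ n → N (f n - g) < r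

variable {s : StarAlgebraData A} (h : s.IsUnitalStarAlgebra) {N : A → ℝ} (hN : s.IsCStarNorm N)

/-- A `*`-algebra which is complete in a C*-norm, as a C*-algebra. -/
def CStar (_ : s.IsUnitalStarAlgebra) (_ : s.IsCStarNorm N) : Type w := A

namespace CStar

instance : AddCommGroup (CStar h hN) := inferInstanceAs (AddCommGroup A)
instance : Module ℂ (CStar h hN) := inferInstanceAs (Module ℂ A)

/-- The identity map. -/
def of : A ≃ₗ[ℂ] CStar h hN := LinearEquiv.refl ℂ A

instance : Norm (CStar h hN) := ⟨fun a => N ((of h hN).symm a)⟩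

lemma core : NormedSpace.Core ℂ (CStar h hN) where
  norm_nonneg a := by
    have h0 : N 0 = 0 := by simpa using hN.smul 0 0
    -- Nonnegativity is not among the axioms of a C*-norm; it follows from 0 = N(a - a) ≤ 2N(a).
    have h1 := hN.add_le ((of h hN).symm a) ((-1 : ℂ) • (of h hN).symm a)
    rw [hN.smul, neg_one_smul, add_neg_cancel, h0, norm_neg, norm_one, one_mul] at h1
    change 0 ≤ N ((of h hN).symm a)
    linarith
  norm_smul c a := hN.smul c _
  norm_triangle a b := hN.add_le _ _
  norm_eq_zero_iff a := ⟨fun ha => hN.eq_zero _ ha, fun ha => by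
    subst ha
    change N 0 = 0
    simpa using hN.smul 0 0⟩

instance : NormedAddCommGroup (CStar h hN) := NormedAddCommGroup.ofCore (core h hN)

instance : Ring (CStar h hN) where
  __ := (inferInstance : AddCommGroup (CStar h hN))
  mul a b := of h hN (s.mul ((of h hN).symm a) ((of h hN).symm b))
  one := of h hN s.one
  left_distrib a b d := (s.mul ((of h hN).symm a)).map_add _ _
  right_distrib a b d := LinearMap.map_add₂ s.mul _ _ _
  zero_mul a := LinearMap.map_zero₂ s.mul _
  mul_zero a := (s.mul ((of h hN).symm a)).map_zero
  mul_assoc a b d := h.mul_assoc _ _ _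
  one_mul a := h.one_mul _
  mul_one a := h.mul_one _

instance : NormedRing (CStar h hN) where
  __ := (inferInstance : NormedAddCommGroup (CStar h hN))
  __ := (inferInstance : Ring (CStar h hN))
  norm_mul_le _ _ := hN.mul_le _ _

instance : Algebra ℂ (CStar h hN) :=
  Algebra.ofModule (fun r _ _ => LinearMap.map_smul₂ s.mul r _ _)
    (fun r x _ => (s.mul ((of h hN).symm x)).map_smul r _)

instance : NormedAlgebra ℂ (CStar h hN) where
  norm_smul_le r _ := (hN.smul r _).le

instance : StarRing (CStar h hN) where
  star a := of h hN (s.star ((of h hN).symm a))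
  star_involutive _ := h.star_star _
  star_mul _ _ := h.star_mul _ _
  star_add _ _ := s.star.map_add _ _

instance : StarModule ℂ (CStar h hN) := ⟨fun r _ => s.star.map_smulₛₗ r _⟩

instance : CStarRing (CStar h hN) := ⟨fun a => by
  rw [← sq]
  exact (hN.star_mul_self _).ge⟩

instance : CompleteSpace (CStar h hN) := Metric.complete_of_cauchySeq_tendsto fun f hf => by
  rw [Metric.cauchySeq_iff] at hf
  obtain ⟨g, hg⟩ := hN.complete (fun n => (of h hN).symm (f n)) fun r hr => by
    obtain ⟨n₀, hn⟩ := hf r hr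
    exact ⟨n₀, fun m n hm hn' => by
      have := hn m hm n hn'
      rw [dist_eq_norm] at this
      exact this⟩
  refine ⟨of h hN g, Metric.tendsto_atTop.2 fun r hr => ?_⟩
  obtain ⟨n₀, hn⟩ := hg r hr
  exact ⟨n₀, fun n hn' => by
    rw [dist_eq_norm]
    exact hn n hn'⟩

instance : CStarAlgebra (CStar h hN) where

lemma of_mul (a b : A) : of h hN (s.mul a b) = of h hN a * of h hN b := rfl

lemma of_one : of h hN s.one = 1 := rfl

lemma of_star (a : A) : of h hN (s.star a) = Star.star (of h hN a) := rfl

/-- A homomorphism from `A` to a C*-algebra. -/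
def lift {C : Type*} [CStarAlgebra C] (f : A →ₗ[ℂ] C) (hmul : ∀ a b, f (s.mul a b) = f a * f b)
    (hstar : ∀ a, f (s.star a) = Star.star (f a)) : CStar h hN →⋆ₙₐ[ℂ] C where
  toFun a := f ((of h hN).symm a)
  map_smul' c _ := f.map_smul c _
  map_zero' := f.map_zero
  map_add' _ _ := f.map_add _ _
  map_mul' _ _ := hmul _ _
  map_star' _ := hstar _

end CStar

/-! ### Existence and uniqueness of the completion of a complete algebra -/

section Completion

variable {B : Type u} [CStarAlgebra B] [WeakHopfCStarAlgebra B] {𝔞 : A →ₗ[ℂ] A ⊗[ℂ] B}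

/-- If `A` is complete in a C*-norm, then it is its own completion. -/
def completionSelf (h𝔞 : s.IsRightCoaction 𝔞)
    (hc : ∀ χ : Module.Dual ℂ B, ∃ K : ℝ, ∀ a,
      N (TensorProduct.rid ℂ A (χ.lTensor A (𝔞 a))) ≤ K * N a) :
    s.CStarCompletion 𝔞 (CStar h hN) where
  incl := (CStar.of h hN).toLinearMap
  incl_injective := (CStar.of h hN).injective
  incl_dense := (CStar.of h hN).surjective.denseRange
  incl_mul := CStar.of_mul h hN
  incl_one := CStar.of_one h hN
  incl_star := CStar.of_star h hN
  coact := (𝔞 : A →ₗ[ℂ] A ⊗[ℂ] B)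
  coact_isRightCoaction :=
    { map_mul := h𝔞.map_mul
      map_star := h𝔞.map_star
      coassoc := h𝔞.coassoc
      counit := h𝔞.counit
      map_one := h𝔞.map_one }
  coact_continuous χ := by
    obtain ⟨K, hK⟩ := hc χ
    exact AddMonoidHomClass.continuous_of_bound
      (show CStar h hN →ₗ[ℂ] CStar h hN from
        (TensorProduct.rid ℂ A).toLinearMap ∘ₗ χ.lTensor A ∘ₗ 𝔞) K hK
  coact_incl a := (LinearMap.rTensor_id_apply B A (𝔞 a)).symm

/-- If `A` is complete in a C*-norm, then the embedding into any C*-completion is bijective. -/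
lemma CStarCompletion.incl_surjective (h : s.IsUnitalStarAlgebra) (hN : s.IsCStarNorm N) {C : Type*} [CStarAlgebra C] 
    (K : s.CStarCompletion 𝔞 C) : Function.Surjective K.incl := by
  let φ := CStar.lift h hN K.incl K.incl_mul K.incl_star
  -- An injective `*`-homomorphism of C*-algebras is isometric. Its range is then complete, hence
  -- closed, and it is dense by assumption.
  have hφ : Isometry φ := (AddMonoidHomClass.isometry_iff_norm φ).2
    (NonUnitalStarAlgHom.norm_map φ K.incl_injective)
  have h1 : IsClosed (Set.range K.incl) := hφ.isClosedEmbedding.isClosed_range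
  intro y
  have h2 := K.incl_dense y
  rwa [h1.closure_eq] at h2

/-- If `A` is complete in a C*-norm, then its C*-completion is unique. -/
theorem CStarCompletion.exists_unique_equiv (h : s.IsUnitalStarAlgebra)
    (hN : s.IsCStarNorm N) {C₁ : Type w'} {C₂ : Type t'} [CStarAlgebra C₁]
    [CStarAlgebra C₂] (K₁ : s.CStarCompletion 𝔞 C₁) (K₂ : s.CStarCompletion 𝔞 C₂) :
    ∃ Φ : C₁ ≃⋆ₐ[ℂ] C₂, (∀ a, Φ (K₁.incl a) = K₂.incl a) ∧
      (∀ y, K₂.coact (Φ y) =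
        ((Φ : C₁ →⋆ₐ[ℂ] C₂) : C₁ →ₗ[ℂ] C₂).rTensor B (K₁.coact y)) ∧
      ∀ Ψ : C₁ ≃⋆ₐ[ℂ] C₂, (∀ a, Ψ (K₁.incl a) = K₂.incl a) → Ψ = Φ := by
  have hs₁ := incl_surjective h hN K₁
  let e₁ : CStar h hN ≃⋆ₐ[ℂ] C₁ := StarAlgEquiv.ofBijective
    (CStar.lift h hN K₁.incl K₁.incl_mul K₁.incl_star) ⟨K₁.incl_injective, hs₁⟩
  let e₂ : CStar h hN ≃⋆ₐ[ℂ] C₂ := StarAlgEquiv.ofBijective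
    (CStar.lift h hN K₂.incl K₂.incl_mul K₂.incl_star)
    ⟨K₂.incl_injective, incl_surjective h hN K₂⟩
  -- Both embeddings are isomorphisms, so Φ is forced on all of C₁; this gives the intertwining
  -- property and the uniqueness.
  let Φ : C₁ ≃⋆ₐ[ℂ] C₂ := e₁.symm.trans e₂
  have hΦ (a : A) : Φ (K₁.incl a) = K₂.incl a :=
    congrArg e₂ (e₁.symm_apply_apply (CStar.of h hN a))
  refine ⟨Φ, hΦ, fun y => ?_, fun Ψ hΨ => StarAlgEquiv.ext fun y => ?_⟩
  · obtain ⟨a, rfl⟩ := hs₁ y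
    rw [hΦ, K₂.coact_incl, K₁.coact_incl, ← LinearMap.rTensor_comp_apply]
    congr 2
    exact LinearMap.ext fun a => (hΦ a).symm
  · obtain ⟨a, rfl⟩ := hs₁ y
    rw [hΨ, hΦ]

end Completion

end StarAlgebraData

/-! ### Endomorphism algebras in C*-categories -/

namespace CStarCategory

open StarAlgebraData

variable {M : Type w} [Category.{v} M] [Preadditive M] [Linear ℂ M] [CStarCategory M]

/-- The `*`-algebra of the endomorphisms of an object. -/
def endStarAlgebra (X : M) : StarAlgebraData (X ⟶ X) where
  mul := LinearMap.mk₂ ℂ (fun f g => g ≫ f) (fun f f' g => by simp) (fun c f g => by simp)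
    (fun f g g' => by simp) (fun c f g => by simp)
  one := 𝟙 X
  star :=
    { toFun := dagger
      map_add' := dagger_add
      map_smul' := dagger_smul }

lemma endStarAlgebra_isUnitalStarAlgebra (X : M) : (endStarAlgebra X).IsUnitalStarAlgebra where
  mul_assoc f g k := (Category.assoc k g f).symm
  one_mul f := Category.comp_id f
  mul_one f := Category.id_comp f
  star_star f := dagger_dagger f
  star_mul f g := dagger_comp g f

lemma endStarAlgebra_isCStarNorm (X : M) :
    (endStarAlgebra X).IsCStarNorm (homNorm (X := X) (Y := X)) where
  add_le := homNorm_add_le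
  smul := homNorm_smul
  eq_zero := eq_zero_of_homNorm
  mul_le f g := (homNorm_comp_le g f).trans_eq (mul_comm _ _)
  star_mul_self f := homNorm_comp_dagger f
  complete := complete

lemma homNorm_nonneg {X Y : M} (f : X ⟶ Y) : 0 ≤ homNorm f := by
  have h0 : homNorm (0 : X ⟶ Y) = 0 := by simpa using homNorm_smul 0 (0 : X ⟶ Y)
  have h1 := homNorm_add_le f ((-1 : ℂ) • f)
  rw [homNorm_smul, neg_one_smul, add_neg_cancel, h0, norm_neg, norm_one, one_mul] at h1
  linarith

variable {B : Type u} [CStarAlgebra B] [WeakHopfCStarAlgebra B] [IsRegularQuantumGroupoid B]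
  [MonoidalLeftAction (UCorep B) M] [IsModuleCStarCategory B M]

open MonoidalLeftAction IsModuleCStarCategory

/-- The functors `U ⊠ -` are contractive. -/
lemma homNorm_actionHomRight_le (U : UCorep B) {X Y : M} (f : X ⟶ Y) :
    homNorm (U ⊴ₗ f) ≤ homNorm f := by
  let ι := CStar.of (endStarAlgebra_isUnitalStarAlgebra (U ⊙ₗ X))
    (endStarAlgebra_isCStarNorm (U ⊙ₗ X))
  let φ := CStar.lift (endStarAlgebra_isUnitalStarAlgebra X) (endStarAlgebra_isCStarNorm X)
    (ι.toLinearMap ∘ₗ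
      { toFun := fun f => U ⊴ₗ f
        map_add' := actionHomRight_add U
        map_smul' := actionHomRight_smul U })
    (fun f g => congrArg ι (actionHomRight_comp U g f))
    (fun f => congrArg ι (dagger_actionHomRight U f).symm)
  -- The functor restricts to a `*`-homomorphism between endomorphism C*-algebras, which is
  -- contractive. The C*-identity carries this over to morphisms between different objects.
  have h1 : homNorm (U ⊴ₗ (f ≫ dagger f)) ≤ homNorm (f ≫ dagger f) :=
    NonUnitalStarAlgHom.norm_apply_le φ (CStar.of _ _ (f ≫ dagger f))
  rw [actionHomRight_comp, ← dagger_actionHomRight, homNorm_comp_dagger, homNorm_comp_dagger] at h1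
  exact le_of_sq_le_sq h1 (homNorm_nonneg f)

end CStarCategory

/-! ### The C*-norm on A and continuity of the coaction -/

namespace Reconstruction

open MonoidalLeftAction CStarCategory UCorep ModuleCategory IsModuleCStarCategory

variable {B : Type u} [CStarAlgebra B] [WeakHopfCStarAlgebra B] [IsRegularQuantumGroupoid B]
  {M : Type w} [Category.{v} M] [Preadditive M] [Linear ℂ M] [CStarCategory M]
  [MonoidalLeftAction (UCorep B) M] [IsModuleCStarCategory B M]
  (M₀ : M) {Ω : Type t} {Ux : Ω → UCorep B} (c : ReconstructionChoice Ux)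

/-- With the next estimate this makes the operator norm on A equivalent to the norm of the Hom space
F(`reg B`). -/
lemma homNorm_regExtend_le (z : M₀ ⟶ reg B ⊙ₗ M₀) : homNorm (regExtend M₀ z) ≤
    homNorm ((αₗ (reg B) (reg B) M₀).inv ≫ regMul B ⊵ₗ M₀) * homNorm z := by
  rw [regExtend_apply, extend, mul_comm]
  exact (homNorm_comp_le _ _).trans
    (mul_le_mul_of_nonneg_right (homNorm_actionHomRight_le _ z) (homNorm_nonneg _))

lemma homNorm_algReg_le (a : Alg M₀ Ux) : homNorm (algReg M₀ Ux a) ≤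
    homNorm (unitMor (regUnit B) M₀) * homNorm (rep M₀ Ux a) := by
  rw [← unitMor_rep]
  exact homNorm_comp_le _ _

/-- The C*-identity is inherited from the endomorphism algebra. For completeness, a Cauchy sequence
is sent to F(`reg B`), which is complete; the limit lies in the image since `algReg` is onto, and
the norms are equivalent. -/
lemma starAlgebra_isCStarNorm (hUx : IsIrrFamily Ux) :
    (starAlgebra M₀ c).IsCStarNorm fun a => homNorm (rep M₀ Ux a) where
  add_le a b := by rw [map_add]; exact homNorm_add_le _ _
  smul r a := by rw [map_smul]; exact homNorm_smul _ _
  eq_zero a ha := rep_injective M₀ hUx (by rw [eq_zero_of_homNorm _ ha, map_zero])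
  mul_le a b := by
    rw [mul_comm]
    exact (congrArg homNorm (rep_mulMap M₀ c a b)).trans_le (homNorm_comp_le _ _)
  star_mul_self a := by
    rw [← homNorm_comp_dagger, ← rep_starMap M₀ c]
    exact congrArg homNorm (rep_mulMap M₀ c _ a)
  complete f hf := by
    have key (K : ℝ) (hK : 0 ≤ K) (r : ℝ) (hr : 0 < r) :
        ∃ r' : ℝ, 0 < r' ∧ ∀ x, x < r' → K * x < r := by
      -- The summand 1 avoids a division by zero when K = 0.
      refine ⟨r / (K + 1), by positivity, fun x hx => ?_⟩
      rw [lt_div_iff₀ (by positivity)] at hx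
      by_cases h0 : 0 ≤ x
      · nlinarith
      · nlinarith
    obtain ⟨z, hz⟩ := complete (fun n => algReg M₀ Ux (f n)) fun r hr => by
      obtain ⟨r', hr', h⟩ := key (homNorm (unitMor (regUnit B) M₀)) (homNorm_nonneg _) r hr
      obtain ⟨n₀, hn⟩ := hf r' hr'
      refine ⟨n₀, fun m n hm hn' => ?_⟩
      rw [← map_sub]
      exact (homNorm_algReg_le M₀ _).trans_lt (h _ (hn m n hm hn'))
    obtain ⟨a, rfl⟩ := algReg_surjective M₀ hUx z
    refine ⟨a, fun r hr => ?_⟩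
    obtain ⟨r', hr', h⟩ := key (homNorm ((αₗ (reg B) (reg B) M₀).inv ≫ regMul B ⊵ₗ M₀))
      (homNorm_nonneg _) r hr
    obtain ⟨n₀, hn⟩ := hz r' hr'
    refine ⟨n₀, fun n hn' => ?_⟩
    refine (homNorm_regExtend_le M₀ _).trans_lt (h _ ?_)
    rw [map_sub]
    exact hn n hn'

/-- In F(`reg B`) a slice of the coaction is composition with one fixed morphism, so it is bounded
there, and the equivalence of norms transfers the bound to A. -/
lemma homNorm_slice_le (χ : Module.Dual ℂ B) : ∃ K : ℝ, ∀ a : Alg M₀ Ux,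
    homNorm (rep M₀ Ux (TensorProduct.rid ℂ _ (χ.lTensor _ (coaction M₀ Ux a)))) ≤
      K * homNorm (rep M₀ Ux a) := by
  let τ := coefHom (reg B) (χ ∘ₗ antipode ∘ₗ (regB (B := B)).toLinearMap) ⊵ₗ M₀
  refine ⟨homNorm ((αₗ (reg B) (reg B) M₀).inv ≫ regMul B ⊵ₗ M₀) *
    (homNorm (unitMor (regUnit B) M₀) * homNorm τ), fun a => ?_⟩
  refine (homNorm_regExtend_le M₀ _).trans ?_
  rw [mul_assoc]
  refine mul_le_mul_of_nonneg_left ?_ (homNorm_nonneg _)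
  rw [algReg_slice_coaction, mul_right_comm]
  exact (homNorm_comp_le _ _).trans
    (mul_le_mul_of_nonneg_right (homNorm_algReg_le M₀ a) (homNorm_nonneg _))

end Reconstruction

end

/-! ### The theorem -/

open MonoidalLeftAction in
theorem mainTheorem9 {B : Type u} [CStarAlgebra B] [WeakHopfCStarAlgebra B]
    [IsRegularQuantumGroupoid B]
    {M : Type w} [Category.{v} M] [Preadditive M] [Linear ℂ M] [CStarCategory M]
    [MonoidalLeftAction (UCorep B) M] [IsModuleCStarCategory B M]
    (M₀ : M) (hM₀ : IsGenerator B M₀)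
    {Ω : Type t} (Ux : Ω → UCorep B) (hUx : IsIrrFamily Ux) :
    Nonempty (ReconstructionChoice Ux) ∧
    ∀ c : ReconstructionChoice Ux,
      (Reconstruction.starAlgebra M₀ c).IsUnitalStarAlgebra ∧
      (∀ (x : Ω) (X : M₀ ⟶ Ux x ⊙ₗ M₀) (n : ℕ) (e : OrthonormalBasis (Fin n) ℂ (Ux x).carrier)
        (i : Fin n),
        Reconstruction.coaction M₀ Ux (Reconstruction.elem M₀ Ux x X (Reconstruction.bar (e i))) =
          ∑ j, Reconstruction.elem M₀ Ux x X (Reconstruction.bar (e j)) ⊗ₜ[ℂ]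
            star (Reconstruction.matrixCoeff (Ux x) e j i)) ∧
      (Reconstruction.starAlgebra M₀ c).IsRightCoaction (Reconstruction.coaction M₀ Ux) ∧
      (∃ (C : Type (max t u v)) (_ : CStarAlgebra C),
        Nonempty ((Reconstruction.starAlgebra M₀ c).CStarCompletion
          (Reconstruction.coaction M₀ Ux) C)) ∧
      ∀ (C₁ : Type w') (C₂ : Type t') [CStarAlgebra C₁] [CStarAlgebra C₂]
        (K₁ : (Reconstruction.starAlgebra M₀ c).CStarCompletion (Reconstruction.coaction M₀ Ux) C₁)
        (K₂ : (Reconstruction.starAlgebra M₀ c).CStarCompletion (Reconstruction.coaction M₀ Ux) C₂),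
        ∃ Φ : C₁ ≃⋆ₐ[ℂ] C₂,
          (∀ a, Φ (K₁.incl a) = K₂.incl a) ∧
          (∀ y, K₂.coact (Φ y) =
            ((Φ : C₁ →⋆ₐ[ℂ] C₂) : C₁ →ₗ[ℂ] C₂).rTensor B (K₁.coact y)) ∧
          ∀ Ψ : C₁ ≃⋆ₐ[ℂ] C₂, (∀ a, Ψ (K₁.incl a) = K₂.incl a) → Ψ = Φ := by
  refine ⟨UCorep.nonempty_reconstructionChoice hUx, fun c => ?_⟩
  have h := Reconstruction.isUnitalStarAlgebra M₀ c hUx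
  have hN := Reconstruction.starAlgebra_isCStarNorm M₀ c hUx
  have h𝔞 := Reconstruction.coaction_isRightCoaction M₀ c
  exact ⟨h, fun x X n e i => Reconstruction.coaction_elem_bar M₀ x X e i, h𝔞,
    -- A itself, with the norm of its operators on `reg B` ⊠ M₀, serves as the completion.
    ⟨StarAlgebraData.CStar h hN, inferInstance,
      ⟨StarAlgebraData.completionSelf h hN h𝔞 (Reconstruction.homNorm_slice_le M₀)⟩⟩,
    fun C₁ C₂ _ _ K₁ K₂ => StarAlgebraData.CStarCompletion.exists_unique_equiv h hN K₁ K₂⟩
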